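/- Let $0\le m\le n$ be integers. Let $G(n,m)$ be the Grassmannian of $m$-dimensional linear subspaces of $\mathbb{R}^n$, with the metric $d(V,W)=\|P_V-P_W\|$, where $P_V:\mathbb{R}^n\to V$ denotes the orthogonal projection onto $V$, and let $\gamma_{n,m}$ be the Haar measure on $G(n,m)$, i.e. the $O(n)$-invariant Borel probability measure, obtained as the image of the Haar probability measure of $O(n)$ under $g\mapsto gV_0$ for a fixed $V_0\in G(n,m)$. Let $\dim$ denote Hausdorff dimension (with $\dim\emptyset=0$) and $\mathcal{H}^m$ the $m$-dimensional Hausdorff measure; for a set that is not known to be measurable, $\gamma_{n,m}$ is understood as an outer measure. Let $A,B\subset\mathbb{R}^n$ be Borel sets. (i) If $\dim A>m$ and $\dim B>m$, then $$\gamma_{n,m}\big(\{V\in G(n,m):\ \mathcal{H}^m(P_V(A)\cap P_V(B))>0\}\big)>0.$$ (ii) If $\dim A>2m$ and $\dim B>2m$, then $$\gamma_{n,m}\big(\{V\in G(n,m):\ \operatorname{Int}(P_V(A)\cap P_V(B))\neq\emptyset\}\big)>0,$$ where $\operatorname{Int}$ denotes the interior relative to $V$. (iii) If $\dim A>m$,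 $\dim B\le m$ and $\dim A+\dim B>2m$, then for every $\varepsilon>0$, $$\gamma_{n,m}\big(\{V\in G(n,m):\ \dim(P_V(A)\cap P_V(B))>\dim B-\varepsilon\}\big)>0.$$ -/

import Mathlib

open MeasureTheory Topology
open scoped ENNReal

namespace ProjInter

/-- Euclidean space `ℝⁿ`. -/
abbrev E (n : ℕ) : Type := EuclideanSpace ℝ (Fin n)

/-- The orthogonal group `O(n)`: the linear maps `g` of `ℝⁿ` with `g* g = g g* = 1`, with the
topology of the operator norm. -/
abbrev OrthGroup (n : ℕ) : Type := unitary (E n →L[ℝ] E n)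

instance continuousStar_clm (n : ℕ) : ContinuousStar (E n →L[ℝ] E n) :=
  ⟨(ContinuousLinearMap.adjoint (𝕜 := ℝ) (E := E n) (F := E n)).continuous⟩

instance compactSpace_orthGroup (n : ℕ) : CompactSpace (OrthGroup n) := by
  have : ProperSpace (E n →L[ℝ] E n) := FiniteDimensional.proper ℝ _
  refine isCompact_iff_compactSpace.mp (Metric.isCompact_of_isClosed_isBounded
    (isClosed_unitary (R := E n →L[ℝ] E n)) ?_)
  refine (Metric.isBounded_closedBall (x := (0 : E n →L[ℝ] E n)) (r := 1)).subset fun g hg => ?_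
  rw [mem_closedBall_zero_iff]
  refine ContinuousLinearMap.opNorm_le_bound _ zero_le_one fun x => ?_
  rw [one_mul]
  exact ((Unitary.linearIsometryEquiv ⟨g, hg⟩).norm_map x).le

/-- The Haar probability measure `θ_n` on `O(n)`. -/
noncomputable def haarO (n : ℕ) : Measure (OrthGroup n) :=
  Measure.haarMeasure ⊤

instance isProbabilityMeasure_haarO (n : ℕ) : IsProbabilityMeasure (haarO n) :=
  ⟨by simpa [haarO] using Measure.haarMeasure_self (K₀ := (⊤ : TopologicalSpace.PositiveCompacts
    (OrthGroup n)))⟩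

/-- The Grassmannian `G(n,m)` of `m`-dimensional linear subspaces of `ℝⁿ`. -/
def Grass (n m : ℕ) : Type :=
  {V : Submodule ℝ (E n) // Module.finrank ℝ V = m}

/-- The topology of `G(n,m)` is the one of the metric `d(V, W) = ‖P_V - P_W‖`. -/
noncomputable instance topologicalSpace_grass (n m : ℕ) : TopologicalSpace (Grass n m) :=
  TopologicalSpace.induced (fun V => V.1.starProjection) inferInstance

noncomputable instance measurableSpace_grass (n m : ℕ) : MeasurableSpace (Grass n m) := borel _

instance borelSpace_grass (n m : ℕ) : BorelSpace (Grass n m) := ⟨rfl⟩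

/-- The image `g V` of an `m`-plane `V` under `g ∈ O(n)`. -/
noncomputable def rotate {n m : ℕ} (g : OrthGroup n) (V : Grass n m) : Grass n m :=
  ⟨V.1.map ((Unitary.linearIsometryEquiv g).toLinearEquiv : E n →ₗ[ℝ] E n), by
    rw [LinearEquiv.finrank_map_eq]; exact V.2⟩

/-- The coordinate `m`-plane spanned by the first `m` standard basis vectors of `ℝⁿ`. -/
noncomputable def coordPlane {n m : ℕ} (hm : m ≤ n) : Grass n m :=
  ⟨Submodule.span ℝ (Set.range fun i : Fin m =>
      EuclideanSpace.basisFun (Fin n) ℝ (Fin.castLE hm i)), by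
    rw [finrank_span_eq_card, Fintype.card_fin]
    exact (EuclideanSpace.basisFun (Fin n) ℝ).orthonormal.linearIndependent.comp _
      (Fin.castLE_injective hm)⟩

/-- The Haar measure `γ_{n,m}` of `G(n,m)`: the image of the Haar probability measure of `O(n)`
under `g ↦ g V₀`, where `V₀` is the coordinate `m`-plane. -/
noncomputable def gammaMeas {n m : ℕ} (hm : m ≤ n) : Measure (Grass n m) :=
  (haarO n).map fun g => rotate g (coordPlane hm)

theorem starProjection_rotate {n m : ℕ} (g : OrthGroup n) (V : Grass n m) :
    (rotate g V).1.starProjection = (g : E n →L[ℝ] E n) * V.1.starProjection *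
      ((g⁻¹ : OrthGroup n) : E n →L[ℝ] E n) := by
  ext1 x
  have h := Submodule.starProjection_map_apply (Unitary.linearIsometryEquiv g) V.1 x
  have h2 : (Unitary.linearIsometryEquiv g).symm x = ((g⁻¹ : OrthGroup n) : E n →L[ℝ] E n) x := by
    rfl
  rw [h2] at h
  exact h

theorem continuous_rotate {n m : ℕ} (V : Grass n m) :
    Continuous fun g : OrthGroup n => rotate g V := by
  refine continuous_induced_rng.mpr ?_
  simp only [Function.comp_def, starProjection_rotate]
  exact (continuous_subtype_val.mul continuous_const).mul
    (continuous_subtype_val.comp continuous_inv)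

theorem continuous_rotate_right {n m : ℕ} (g : OrthGroup n) :
    Continuous fun V : Grass n m => rotate g V := by
  refine continuous_induced_rng.mpr ?_
  simp only [Function.comp_def, starProjection_rotate]
  have : Continuous fun V : Grass n m => V.1.starProjection := continuous_induced_dom
  exact (continuous_const.mul this).mul continuous_const

instance isProbabilityMeasure_gammaMeas {n m : ℕ} (hm : m ≤ n) :
    IsProbabilityMeasure (gammaMeas hm) :=
  Measure.isProbabilityMeasure_map (continuous_rotate _).measurable.aemeasurable

/-- `γ_{n,m}` is invariant under the action of `O(n)`. -/
theorem map_rotate_gammaMeas {n m : ℕ} (hm : m ≤ n) (g : OrthGroup n) :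
    (gammaMeas hm).map (rotate g) = gammaMeas hm := by
  have hmul : ∀ h : OrthGroup n, rotate g (rotate h (coordPlane hm)) =
      rotate (g * h) (coordPlane hm) := fun h => by
    refine Subtype.ext ?_
    simp only [rotate, ← Submodule.map_comp]
    congr 1
  rw [gammaMeas, Measure.map_map (continuous_rotate_right g).measurable
    (continuous_rotate _).measurable]
  have h1 : rotate g ∘ (fun h => rotate h (coordPlane hm)) =
      (fun h => rotate h (coordPlane hm)) ∘ fun h => g * h := funext hmul
  rw [h1, ← Measure.map_map (continuous_rotate _).measurable (measurable_const_mul g)]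
  congr 1
  exact map_mul_left_eq_self (Measure.haarMeasure ⊤) g

/-- The orthogonal projection `P_V(A) ⊆ V` of a set `A ⊆ ℝⁿ`, as a subset of `V`. -/
noncomputable def proj {n m : ℕ} (V : Grass n m) (A : Set (E n)) : Set V.1 :=
  (fun x => V.1.orthogonalProjectionOnto x) '' A

end ProjInter

-- Planes are replaced by Gaussian random linear maps `lin ω` from ℝⁿ to ℝᵐ. Their law is rotation
-- invariant, so a null set of planes is almost surely avoided by `coker ω`, the orthogonal
-- complement of the kernel (`ae_notMem_of_gammaMeas_eq_zero`). On this complement `lin ω` is an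
-- isomorphism taking projections to images (`exists_equiv_image_proj`), and dimension, null sets
-- and interior survive it. The task is thus to show that the images of A and B do not almost surely
-- have a small intersection.
--
-- A capacitability argument for dyadic net contents and Frostman's lemma give probability measures
-- μ, ν on compact subsets of A, B with finite s- and t-energy, where s + t = 2m
-- (`exists_measure_energy_ne_top`). The double integral of a Gaussian kernel of width about √a
-- against the two image measures stands in for the integral of the product of their densities. Its
-- mean over ω is explicit and stays above a positive constant as a → 0. Uniformly in a, it is
-- dominated by the sum of the Fourier energies of the images with exponents s and t, whose means
-- are multiples of the original energies. By dominated convergence it cannot tend to 0 almost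
-- surely (`not_ae_tendsto_gaussEnergy_lin`).
--
-- If the set of planes in question were null, it would tend to 0 almost surely. In (i) and (iii)
-- the image of ν does not charge the compact image carrying μ: in (i) it is absolutely continuous
-- and the intersection is Lebesgue null, in (iii) a measure of finite t-energy charges no set of
-- dimension below t (`le_dimH_of_energy`). The energies then force the limit 0
-- (`tendsto_gaussEnergy_of_energy`). In (ii) both Fourier transforms are integrable, so the
-- mollified measures converge to continuous functions, which cannot both be nonzero at a point if
-- the intersection has empty interior (`tendsto_gaussEnergy_of_integrable_charFun`).
-- `gammaMeas_pos` combines the two halves.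

namespace ProjInter

/-! ### Dyadic net content -/

section Dyadic

variable {n : ℕ}

/-- The index of the half-open dyadic cube of side `2⁻ᵏ` that contains `x`. -/
noncomputable def dyadicIndex (k : ℕ) (x : E n) : Fin n → ℤ := fun i => ⌊(2 : ℝ) ^ k * x i⌋

theorem dyadicIndex_succ (k : ℕ) (x : E n) (i : Fin n) :
    dyadicIndex k x i = dyadicIndex (k + 1) x i / 2 := by
  have h := Int.floor_div_natCast ((2 : ℝ) ^ (k + 1) * x i) 2
  simp only [dyadicIndex]
  rw [show ((2 : ℤ)) = ((2 : ℕ) : ℤ) from rfl, ← h]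
  congr 1
  push_cast
  ring

theorem dyadicIndex_eq_of_le {j k : ℕ} (hjk : j ≤ k) {x y : E n}
    (h : dyadicIndex k x = dyadicIndex k y) : dyadicIndex j x = dyadicIndex j y := by
  induction k, hjk using Nat.le_induction with
  | base => exact h
  | succ k _ ih =>
    refine ih (funext fun i => ?_)
    rw [dyadicIndex_succ k x, dyadicIndex_succ k y, h]

/-- The set covered by a family of dyadic cubes. -/
def cover (C : Set (ℕ × (Fin n → ℤ))) : Set (E n) := {x | ∃ k, (k, dyadicIndex k x) ∈ C}

/-- The maximal cubes of a family of dyadic cubes. -/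
def maxCubes (C : Set (ℕ × (Fin n → ℤ))) : Set (ℕ × (Fin n → ℤ)) :=
  {c ∈ C | ∀ x : E n, dyadicIndex c.1 x = c.2 → ∀ j < c.1, (j, dyadicIndex j x) ∉ C}

theorem cover_maxCubes (C : Set (ℕ × (Fin n → ℤ))) : cover (maxCubes C) = cover C := by
  classical
  refine Set.Subset.antisymm (fun x ⟨k, hk⟩ => ⟨k, hk.1⟩) fun x hx => ?_
  have hx' : ∃ k, (k, dyadicIndex k x) ∈ C := hx
  refine ⟨Nat.find hx', Nat.find_spec hx', fun y hy j hj => ?_⟩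
  rw [dyadicIndex_eq_of_le hj.le hy]
  exact Nat.find_min hx' hj

/-- The measure on the set of dyadic cubes that gives mass `ℓ(Q)ˢ` to the cube `Q`. -/
noncomputable def cubeWeight (n : ℕ) (s : ℝ) : Measure (ℕ × (Fin n → ℤ)) :=
  Measure.count.withDensity fun c => ENNReal.ofReal ((2 : ℝ) ^ (-(c.1 * s)))

/-- The `s`-dimensional dyadic net content. -/
noncomputable def netContent (s : ℝ) (S : Set (E n)) : ℝ≥0∞ :=
  ⨅ (C : Set (ℕ × (Fin n → ℤ))) (_ : S ⊆ cover C), cubeWeight n s C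

theorem netContent_le {s : ℝ} {S : Set (E n)} {C : Set (ℕ × (Fin n → ℤ))} (h : S ⊆ cover C) :
    netContent s S ≤ cubeWeight n s C := iInf₂_le C h

theorem netContent_mono {s : ℝ} {S T : Set (E n)} (h : S ⊆ T) :
    netContent s S ≤ netContent s T :=
  le_iInf₂ fun _ hC => netContent_le (h.trans hC)

theorem exists_cover_lt {s : ℝ} {S : Set (E n)} {c : ℝ≥0∞} (h : netContent s S < c) :
    ∃ C, S ⊆ cover C ∧ cubeWeight n s C < c := by
  simpa only [netContent, iInf_lt_iff, exists_prop] using h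

theorem netContent_iUnion_le {ι : Type*} [Countable ι] {s : ℝ} (S : ι → Set (E n)) :
    netContent s (⋃ i, S i) ≤ ∑' i, netContent s (S i) := by
  refine ENNReal.le_of_forall_pos_le_add fun ε hε hfin => ?_
  obtain ⟨δ, hδ, hδε⟩ := ENNReal.exists_pos_sum_of_countable (ENNReal.coe_pos.2 hε).ne' ι
  have hlt : ∀ i, netContent s (S i) < netContent s (S i) + δ i := fun i =>
    ENNReal.lt_add_right (ne_top_of_le_ne_top hfin.ne (ENNReal.le_tsum i))
      (ENNReal.coe_pos.2 (hδ i)).ne'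
  choose C hC hCw using fun i => exists_cover_lt (hlt i)
  have hcov : (⋃ i, S i) ⊆ cover (⋃ i, C i) := Set.iUnion_subset fun i x hx => by
    obtain ⟨k, hk⟩ := hC i hx
    exact ⟨k, Set.mem_iUnion.2 ⟨i, hk⟩⟩
  calc netContent s (⋃ i, S i) ≤ cubeWeight n s (⋃ i, C i) := netContent_le hcov
    _ ≤ ∑' i, cubeWeight n s (C i) := measure_iUnion_le _
    _ ≤ ∑' i, (netContent s (S i) + δ i) := ENNReal.tsum_le_tsum fun i => (hCw i).le
    _ = ∑' i, netContent s (S i) + ∑' i, (δ i : ℝ≥0∞) := ENNReal.tsum_add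
    _ ≤ _ := by gcongr

theorem cubeWeight_singleton (s : ℝ) (c : ℕ × (Fin n → ℤ)) :
    cubeWeight n s {c} = ENNReal.ofReal ((2 : ℝ) ^ (-(c.1 * s))) := by
  rw [cubeWeight, withDensity_apply _ (.of_discrete), lintegral_singleton]
  simp

/-- The maximal cubes of two covers of `S`, together with the cubes that are left over, do not
weigh more than the two covers. -/
theorem cubeWeight_maxCubes_union_add_le {s : ℝ} {S : Set (E n)} {C D : Set (ℕ × (Fin n → ℤ))}
    (hC : S ⊆ cover C) (hD : S ⊆ cover D) :
    cubeWeight n s (maxCubes (D ∪ C)) + netContent s S ≤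
      cubeWeight n s (maxCubes D) + cubeWeight n s C := by
  set D' := maxCubes D
  set M := maxCubes (D ∪ C)
  have hM : M ⊆ D' ∪ C := fun c hc => by
    rcases hc.1 with h | h
    · exact Or.inl ⟨h, fun x hx j hj hjD => hc.2 x hx j hj (Or.inl hjD)⟩
    · exact Or.inr h
  -- A point lies in a cube of each family. The smaller of the two cubes is not maximal in the
  -- union, hence is left over; if they coincide, the cube lies in both families.
  have hS : S ⊆ cover (((D' ∪ C) \ M) ∪ (D' ∩ C)) := fun x hx => by
    obtain ⟨k, hk⟩ := hC hx
    obtain ⟨j, hj⟩ : x ∈ cover D' := by rw [cover_maxCubes]; exact hD hx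
    rcases lt_trichotomy j k with h | rfl | h
    · exact ⟨k, Or.inl ⟨Or.inr hk, fun hm => hm.2 x rfl j h (Or.inl hj.1)⟩⟩
    · exact ⟨j, Or.inr ⟨hj, hk⟩⟩
    · exact ⟨j, Or.inl ⟨Or.inl hj, fun hm => hm.2 x rfl k h (Or.inr hk)⟩⟩
  calc cubeWeight n s M + netContent s S
      ≤ cubeWeight n s M + (cubeWeight n s ((D' ∪ C) \ M) + cubeWeight n s (D' ∩ C)) := by
        gcongr
        exact (netContent_le hS).trans (measure_union_le _ _)
    _ = cubeWeight n s (D' ∪ C) + cubeWeight n s (D' ∩ C) := by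
        rw [← add_assoc, ← measure_union Set.disjoint_sdiff_right (.of_discrete),
          Set.union_sdiff_cancel hM]
    _ = _ := measure_union_add_inter _ (.of_discrete)

/-- A cube maximal in the whole union is maximal in every partial union from the one where it first
occurs. Continuity from below of `cubeWeight` then bounds the weight of the limit family by those of
the stages. -/
theorem maxCubes_iUnion_subset (C : ℕ → Set (ℕ × (Fin n → ℤ))) :
    maxCubes (⋃ i, C i) ⊆ ⋃ k, ⋂ N ≥ k, maxCubes (⋃ i ≤ N, C i) := fun c hc => by
  obtain ⟨i, hi⟩ := Set.mem_iUnion.1 hc.1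
  refine Set.mem_iUnion.2 ⟨i, Set.mem_iInter₂.2 fun N hN => ⟨Set.mem_iUnion₂.2 ⟨i, hN, hi⟩,
    fun x hx j hj hmem => hc.2 x hx j hj ?_⟩⟩
  obtain ⟨l, _, hl⟩ := Set.mem_iUnion₂.1 hmem
  exact Set.mem_iUnion.2 ⟨l, hl⟩

/-- The net content is continuous along increasing sequences of arbitrary sets. -/
theorem netContent_iUnion_le_of_monotone {s : ℝ} {S : ℕ → Set (E n)} (hS : Monotone S)
    {c : ℝ≥0∞} (hc : ∀ i, netContent s (S i) ≤ c) : netContent s (⋃ i, S i) ≤ c := by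
  refine ENNReal.le_of_forall_pos_le_add fun ε hε hfin => ?_
  obtain ⟨δ, hδ, hδε⟩ := ENNReal.exists_pos_sum_of_countable (ENNReal.coe_pos.2 hε).ne' ℕ
  have hne : ∀ i, netContent s (S i) ≠ ∞ := fun i => ne_top_of_le_ne_top hfin.ne (hc i)
  choose C hC hCw using fun i => exists_cover_lt
    (ENNReal.lt_add_right (hne i) (ENNReal.coe_pos.2 (hδ i)).ne')
  have hcov : ∀ N, S N ⊆ cover (⋃ i ≤ N, C i) := fun N x hx => by
    obtain ⟨k, hk⟩ := hC N hx
    exact ⟨k, Set.mem_iUnion₂.2 ⟨N, le_rfl, hk⟩⟩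
  -- Strong subadditivity makes the errors of the successive near-optimal covers add up, instead of
  -- the covers' weights.
  have hD : ∀ N, cubeWeight n s (maxCubes (⋃ i ≤ N, C i)) ≤
      netContent s (S N) + ∑ i ∈ Finset.range (N + 1), (δ i : ℝ≥0∞) := fun N => by
    induction N with
    | zero =>
      simp only [Nat.le_zero, Set.iUnion_iUnion_eq_left, zero_add, Finset.sum_range_one]
      exact (measure_mono fun c hc => hc.1).trans (hCw 0).le
    | succ N ih =>
      have h1 := cubeWeight_maxCubes_union_add_le (s := s)
        ((hS N.le_succ).trans (hC (N + 1))) (hcov N)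
      have h2 : (⋃ i ≤ N + 1, C i) = (⋃ i ≤ N, C i) ∪ C (N + 1) := Set.biUnion_le_succ C N
      rw [h2, Finset.sum_range_succ]
      refine (ENNReal.add_le_add_iff_right (hne N)).1 (h1.trans ?_)
      calc _ ≤ (netContent s (S N) + ∑ i ∈ Finset.range (N + 1), (δ i : ℝ≥0∞)) +
            (netContent s (S (N + 1)) + δ (N + 1)) := add_le_add ih (hCw _).le
        _ = _ := by ring
  have hDε : ∀ N, cubeWeight n s (maxCubes (⋃ i ≤ N, C i)) ≤ c + ε := fun N =>
    (hD N).trans (add_le_add (hc N) ((ENNReal.sum_le_tsum _).trans hδε.le))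
  have hcovU : (⋃ i, S i) ⊆ cover (maxCubes (⋃ i, C i)) := by
    rw [cover_maxCubes]
    refine Set.iUnion_subset fun i x hx => ?_
    obtain ⟨k, hk⟩ := hC i hx
    exact ⟨k, Set.mem_iUnion.2 ⟨i, hk⟩⟩
  refine (netContent_le hcovU).trans ((measure_mono (maxCubes_iUnion_subset C)).trans ?_)
  rw [Monotone.measure_iUnion fun a b hab => Set.biInter_subset_biInter_left
    fun N (hN : N ≥ b) => le_trans hab hN]
  exact iSup_le fun k => (measure_mono (Set.biInter_subset_of_mem (Set.mem_ofPred.2 le_rfl))).trans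
    (hDε k)

/-! ### Neighbouring cubes -/

/-- The indices of the cubes of the same size that touch a given dyadic cube. -/
noncomputable def nbrs (z : Fin n → ℤ) : Finset (Fin n → ℤ) :=
  Fintype.piFinset fun i => Finset.Icc (z i - 1) (z i + 1)

theorem card_nbrs (z : Fin n → ℤ) : (nbrs z).card = 3 ^ n := by
  have h : ∀ i, (Finset.Icc (z i - 1) (z i + 1)).card = 3 := fun i => by
    rw [Int.card_Icc]; omega
  simp [nbrs, Fintype.card_piFinset, h]

theorem dyadicIndex_mem_nbrs {k : ℕ} {x y : E n} (h : dist x y ≤ (2 : ℝ)⁻¹ ^ k) :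
    dyadicIndex k y ∈ nbrs (dyadicIndex k x) := by
  refine Fintype.mem_piFinset.2 fun i => Finset.mem_Icc.2 ?_
  have h1 : |x i - y i| ≤ (2 : ℝ)⁻¹ ^ k := by
    refine le_trans ?_ h
    rw [dist_eq_norm]
    simpa using PiLp.norm_apply_le (x - y) i
  have h2 : |(2 : ℝ) ^ k * x i - 2 ^ k * y i| ≤ 1 := by
    rw [← mul_sub, abs_mul, abs_of_pos (by positivity)]
    calc (2 : ℝ) ^ k * |x i - y i| ≤ 2 ^ k * 2⁻¹ ^ k := by gcongr
      _ = 1 := by rw [← mul_pow]; norm_num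
  rw [abs_le] at h2
  constructor
  · rw [sub_le_iff_le_add]
    simp only [dyadicIndex]
    rw [← Int.floor_add_one]
    exact Int.floor_le_floor (by linarith)
  · simp only [dyadicIndex]
    rw [← Int.floor_add_one]
    exact Int.floor_le_floor (by linarith)

theorem cubeWeight_apply (s : ℝ) (C : Set (ℕ × (Fin n → ℤ))) :
    cubeWeight n s C = ∑' c, C.indicator (fun c => ENNReal.ofReal ((2 : ℝ) ^ (-(c.1 * s)))) c := by
  rw [cubeWeight, withDensity_apply _ (.of_discrete), ← lintegral_indicator (.of_discrete),
    lintegral_count]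

theorem cubeWeight_preimage_add (s : ℝ) (C : Set (ℕ × (Fin n → ℤ))) (e : Fin n → ℤ) :
    cubeWeight n s ((fun c => (c.1, c.2 + e)) ⁻¹' C) = cubeWeight n s C := by
  rw [cubeWeight_apply, cubeWeight_apply,
    ← ((Equiv.refl ℕ).prodCongr (Equiv.addRight e)).tsum_eq
      (C.indicator fun c => ENNReal.ofReal ((2 : ℝ) ^ (-(c.1 * s))))]
  rfl

/-- The enlarged family is contained in 3ⁿ translates of the original one. This is the price for
replacing a cover by half-open cubes with an open neighbourhood. -/
theorem cubeWeight_nbrs_le (s : ℝ) (C : Set (ℕ × (Fin n → ℤ))) :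
    cubeWeight n s {c | ∃ z, (c.1, z) ∈ C ∧ c.2 ∈ nbrs z} ≤ 3 ^ n * cubeWeight n s C := by
  have hsub : {c : ℕ × (Fin n → ℤ) | ∃ z, (c.1, z) ∈ C ∧ c.2 ∈ nbrs z} ⊆
      ⋃ e ∈ nbrs (0 : Fin n → ℤ), (fun c => (c.1, c.2 + e)) ⁻¹' C := by
    rintro ⟨k, w⟩ ⟨z, hz, hw⟩
    refine Set.mem_iUnion₂.2 ⟨z - w, ?_, by simpa using hz⟩
    simp only [nbrs, Fintype.mem_piFinset, Finset.mem_Icc, Pi.sub_apply, Pi.zero_apply] at hw ⊢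
    exact fun i => by have := hw i; omega
  refine (measure_mono hsub).trans ((measure_biUnion_finset_le _ _).trans ?_)
  simp only [cubeWeight_preimage_add, Finset.sum_const, card_nbrs, nsmul_eq_mul]
  push_cast
  exact le_rfl

/-- A family of dyadic cubes covers a set in whose interior lie the cubes of a smaller family. -/
theorem exists_isOpen_between (C : Set (ℕ × (Fin n → ℤ))) :
    ∃ O : Set (E n), IsOpen O ∧ cover C ⊆ O ∧
      O ⊆ cover {c | ∃ z, (c.1, z) ∈ C ∧ c.2 ∈ nbrs z} := by
  refine ⟨⋃ x : E n, ⋃ k : ℕ, ⋃ _ : (k, dyadicIndex k x) ∈ C, Metric.ball x ((2 : ℝ)⁻¹ ^ k),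
    isOpen_iUnion fun x => isOpen_iUnion fun k => isOpen_iUnion fun _ => Metric.isOpen_ball,
    fun x ⟨k, hk⟩ => ?_, fun y hy => ?_⟩
  · simp only [Set.mem_iUnion]
    exact ⟨x, k, hk, Metric.mem_ball_self (by positivity)⟩
  · simp only [Set.mem_iUnion] at hy
    obtain ⟨x, k, hk, hy⟩ := hy
    refine ⟨k, _, hk, dyadicIndex_mem_nbrs ?_⟩
    rw [dist_comm]
    exact (Metric.mem_ball.1 hy).le

end Dyadic

/-! ### Positive net content and compact subsets -/

section Capacity

variable {n : ℕ}

theorem ediam_cube_le (k : ℕ) (z : Fin n → ℤ) :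
    Metric.ediam {x : E n | dyadicIndex k x = z} ≤ n * ENNReal.ofReal ((2 : ℝ)⁻¹ ^ k) := by
  refine Metric.ediam_le fun x hx y hy => ?_
  have hxy : ∀ i, |x i - y i| ≤ (2 : ℝ)⁻¹ ^ k := fun i => by
    have h1 : dyadicIndex k x i = dyadicIndex k y i := by
      rw [show dyadicIndex k x = z from hx, show dyadicIndex k y = z from hy]
    have h2 := (Int.abs_sub_lt_one_of_floor_eq_floor h1).le
    rw [← mul_sub, abs_mul, abs_of_pos (by positivity)] at h2
    rw [inv_pow, ← one_div, le_div_iff₀ (by positivity), mul_comm]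
    exact h2
  rw [edist_dist, ← ENNReal.ofReal_natCast, ← ENNReal.ofReal_mul (by positivity)]
  refine ENNReal.ofReal_le_ofReal ?_
  rw [EuclideanSpace.dist_eq]
  refine Real.sqrt_le_iff.2 ⟨by positivity, ?_⟩
  calc ∑ i, dist (x i) (y i) ^ 2 ≤ ∑ _i : Fin n, ((2 : ℝ)⁻¹ ^ k) ^ 2 :=
        Finset.sum_le_sum fun i _ => pow_le_pow_left₀ dist_nonneg (by simpa [Real.dist_eq] using hxy i) 2
    _ = n * ((2 : ℝ)⁻¹ ^ k) ^ 2 := by simp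
    _ ≤ n ^ 2 * ((2 : ℝ)⁻¹ ^ k) ^ 2 := by
        gcongr
        exact_mod_cast Nat.le_self_pow two_ne_zero n
    _ = (n * (2 : ℝ)⁻¹ ^ k) ^ 2 := by ring

theorem cubeWeight_singleton_rpow {s : ℝ} (hs : 0 < s) (c : ℕ × (Fin n → ℤ)) :
    cubeWeight n s {c} ^ s⁻¹ = ENNReal.ofReal ((2 : ℝ)⁻¹ ^ c.1) := by
  rw [cubeWeight_singleton, ENNReal.ofReal_rpow_of_nonneg (by positivity) (by positivity),
    ← Real.rpow_mul (by positivity)]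
  congr 1
  rw [neg_mul, mul_assoc, mul_inv_cancel₀ hs.ne', mul_one, Real.rpow_neg (by positivity),
    Real.rpow_natCast, inv_pow]

/-- The content puts no upper limit below 1 on the size of the cubes, but a total weight below 2⁻ʲ
forces every side length below 2^(-j/s), so nearly optimal covers are automatically fine. -/
theorem hausdorffMeasure_eq_zero_of_netContent {s : ℝ} (hs : 0 < s) {S : Set (E n)}
    (h : netContent s S = 0) : μH[s] S = 0 := by
  have hε : ∀ j : ℕ, netContent s S < (2 : ℝ≥0∞)⁻¹ ^ j := fun j => by
    rw [h]; exact ENNReal.pow_pos (by simp) j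
  choose C hC hCw using fun j => exists_cover_lt (hε j)
  have htend : Filter.Tendsto (fun j : ℕ => (2 : ℝ≥0∞)⁻¹ ^ j) Filter.atTop (𝓝 0) :=
    ENNReal.tendsto_pow_atTop_nhds_zero_of_lt_one (by simp [ENNReal.inv_lt_one])
  have hdiam : ∀ j, ∀ c : C j, Metric.ediam {x : E n | dyadicIndex c.1.1 x = c.1.2} ≤
      n * ((2 : ℝ≥0∞)⁻¹ ^ j) ^ s⁻¹ := fun j c => by
    refine (ediam_cube_le _ _).trans ?_
    rw [← cubeWeight_singleton_rpow hs c.1]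
    gcongr
    exact (measure_mono (Set.singleton_subset_iff.2 c.2)).trans (hCw j).le
  have hsum : ∀ j, ∑' c : C j, Metric.ediam {x : E n | dyadicIndex c.1.1 x = c.1.2} ^ s ≤
      (n : ℝ≥0∞) ^ s * (2 : ℝ≥0∞)⁻¹ ^ j := fun j => by
    calc _ ≤ ∑' c : C j, (n : ℝ≥0∞) ^ s * cubeWeight n s {c.1} := by
          refine ENNReal.tsum_le_tsum fun c => ?_
          refine (ENNReal.rpow_le_rpow (ediam_cube_le _ _) hs.le).trans ?_
          rw [← cubeWeight_singleton_rpow hs c.1, ENNReal.mul_rpow_of_nonneg _ _ hs.le,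
            ← ENNReal.rpow_mul, inv_mul_cancel₀ hs.ne', ENNReal.rpow_one]
      _ = (n : ℝ≥0∞) ^ s * cubeWeight n s (C j) := by
          rw [ENNReal.tsum_mul_left, cubeWeight_apply, ← tsum_subtype (C j)]
          simp only [cubeWeight_singleton]
      _ ≤ _ := by gcongr; exact (hCw j).le
  have hr0 : Filter.Tendsto (fun j : ℕ => (n : ℝ≥0∞) * ((2 : ℝ≥0∞)⁻¹ ^ j) ^ s⁻¹) Filter.atTop
      (𝓝 0) := by
    have h1 := (ENNReal.continuous_rpow_const (y := s⁻¹)).tendsto 0 |>.comp htend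
    rw [ENNReal.zero_rpow_of_pos (by positivity)] at h1
    simpa using ENNReal.Tendsto.const_mul h1 (Or.inr (ENNReal.natCast_ne_top n))
  refine le_antisymm ((Measure.hausdorffMeasure_le_liminf_tsum s S _ hr0
    (fun j (c : C j) => {x : E n | dyadicIndex c.1.1 x = c.1.2}) (.of_forall hdiam)
    (.of_forall fun j x hx => ?_)).trans ?_) zero_le
  · obtain ⟨k, hk⟩ := hC j hx
    exact Set.mem_iUnion.2 ⟨⟨_, hk⟩, rfl⟩
  · have h2 : Filter.Tendsto (fun j : ℕ => (n : ℝ≥0∞) ^ s * (2 : ℝ≥0∞)⁻¹ ^ j) Filter.atTop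
        (𝓝 0) := by
      simpa using ENNReal.Tendsto.const_mul htend
        (Or.inr (ENNReal.rpow_ne_top_of_nonneg hs.le (ENNReal.natCast_ne_top n)))
    exact (Filter.liminf_le_liminf (.of_forall hsum)).trans h2.liminf_eq.le

/-- First half of Choquet's capacitability argument: the coordinates of the parameter space are
bounded one at a time. Letting the bound on one coordinate grow gives an increasing union, along
which the content is continuous; no measurability of the images is needed. -/
theorem exists_bound_forall_image_box {s : ℝ} {f : (ℕ → ℕ) → E n} {c : ℝ≥0∞}
    (hc : c < netContent s (Set.range f)) :
    ∃ N : ℕ → ℕ, ∀ k, c < netContent s (f '' {σ | ∀ i < k, σ i ≤ N i}) := by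
  have step : ∀ k (v : ℕ → ℕ), c < netContent s (f '' {σ | ∀ i < k, σ i ≤ v i}) →
      ∃ j, c < netContent s (f '' {σ | ∀ i < k + 1, σ i ≤ Function.update v k j i}) := by
    intro k v hv
    by_contra! hcon
    refine hv.not_ge ?_
    have hmono : Monotone fun j => f '' {σ | ∀ i < k + 1, σ i ≤ Function.update v k j i} :=
      fun a b hab => Set.image_mono fun σ hσ i hi => (hσ i hi).trans
        (update_le_update_iff.2 ⟨hab, fun _ _ => le_rfl⟩ i)
    refine (netContent_mono ?_).trans (netContent_iUnion_le_of_monotone hmono hcon)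
    rintro _ ⟨σ, hσ, rfl⟩
    refine Set.mem_iUnion.2 ⟨σ k, σ, fun i hi => ?_, rfl⟩
    rcases eq_or_ne i k with rfl | hik
    · simp
    · rw [Function.update_of_ne hik]
      exact hσ i (by omega)
  choose! j hj using step
  -- Stage k + 1 changes only coordinate k, so coordinate i is final from stage i + 1 on and the
  -- diagonal bound agrees with stage k below k.
  let v : ℕ → ℕ → ℕ := fun k => Nat.rec 0 (fun k v => Function.update v k (j k v)) k
  have hv : ∀ k, c < netContent s (f '' {σ | ∀ i < k, σ i ≤ v k i}) := fun k => by
    induction k with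
    | zero => simpa using hc
    | succ k ih => exact hj k (v k) ih
  have hstab : ∀ i k, i < k → v k i = v (i + 1) i := fun i k hik => by
    induction k, Nat.succ_le_of_lt hik using Nat.le_induction with
    | base => rfl
    | succ k hk ih =>
      have : v (k + 1) i = v k i := Function.update_of_ne (by omega) _ _
      rw [this, ih (by omega)]
  refine ⟨fun i => v (i + 1) i, fun k => ?_⟩
  have hbox : {σ : ℕ → ℕ | ∀ i < k, σ i ≤ v (i + 1) i} = {σ | ∀ i < k, σ i ≤ v k i} :=
    Set.ext fun σ => forall₂_congr fun i hi => by rw [hstab i k hi]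
  rw [hbox]
  exact hv k

theorem isCompact_setOf_forall_le (N : ℕ → ℕ) : IsCompact {σ : ℕ → ℕ | ∀ i, σ i ≤ N i} := by
  have : {σ : ℕ → ℕ | ∀ i, σ i ≤ N i} = Set.univ.pi fun i => Set.Iic (N i) := by
    ext σ; simp [Pi.le_def]
  rw [this]
  exact isCompact_univ_pi fun i => (Set.finite_Iic _).isCompact

/-- By compactness a whole neighbourhood of the infinite box lies in `U`. Truncating a sequence at
`N` moves it into the box without changing the coordinates already bounded, hence by at most 2⁻ᵏ. -/
theorem exists_box_subset_of_isOpen {N : ℕ → ℕ} {U : Set (ℕ → ℕ)} (hU : IsOpen U)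
    (h : {σ : ℕ → ℕ | ∀ i, σ i ≤ N i} ⊆ U) : ∃ k, {σ : ℕ → ℕ | ∀ i < k, σ i ≤ N i} ⊆ U := by
  let _ : MetricSpace (ℕ → ℕ) := PiNat.metricSpaceNatNat
  obtain ⟨δ, hδ, hδU⟩ := (isCompact_setOf_forall_le N).exists_thickening_subset_open hU h
  obtain ⟨k, hk⟩ := exists_pow_lt_of_lt_one hδ (by norm_num : (1 / 2 : ℝ) < 1)
  refine ⟨k, fun σ hσ => hδU (Metric.mem_thickening_iff.2 ⟨fun i => min (σ i) (N i),
    fun i => min_le_right _ _, lt_of_le_of_lt ?_ hk⟩)⟩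
  exact PiNat.mem_cylinder_iff_dist_le.1 fun i hi => (min_eq_left (hσ i hi)).symm

/-- An analytic set of positive net content has a compact subset of positive net content. -/
theorem exists_isCompact_netContent_pos {s : ℝ} {A : Set (E n)} (hA : AnalyticSet A)
    (h : 0 < netContent s A) : ∃ K ⊆ A, IsCompact K ∧ 0 < netContent s K := by
  obtain ⟨c, hc0, hc⟩ := exists_between h
  rw [AnalyticSet] at hA
  rcases hA with rfl | ⟨f, hf, rfl⟩
  · exact ⟨∅, subset_rfl, isCompact_empty, h⟩
  obtain ⟨N, hN⟩ := exists_bound_forall_image_box hc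
  refine ⟨f '' {σ | ∀ i, σ i ≤ N i}, Set.image_subset_range _ _,
    (isCompact_setOf_forall_le N).image hf, ?_⟩
  -- A cover of the compact image is enlarged to neighbouring cubes so that it contains an open set,
  -- hence the image of a box restricted in finitely many coordinates, of content above `c`. The
  -- enlargement costs the factor 3ⁿ.
  refine lt_of_lt_of_le (b := c / 3 ^ n) (ENNReal.div_pos hc0.ne' (by simp)) ?_
  refine le_iInf₂ fun C hC => ?_
  obtain ⟨O, hO, hCO, hOC⟩ := exists_isOpen_between C
  obtain ⟨k, hk⟩ := exists_box_subset_of_isOpen (hO.preimage hf)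
    (Set.image_subset_iff.1 (hC.trans hCO))
  refine ENNReal.div_le_of_le_mul' ?_
  calc c ≤ netContent s (f '' {σ | ∀ i < k, σ i ≤ N i}) := (hN k).le
    _ ≤ _ := netContent_le ((Set.image_subset_iff.2 hk).trans hOC)
    _ ≤ _ := cubeWeight_nbrs_le s C

theorem exists_isCompact_netContent_pos_of_lt_dimH {s : ℝ} (hs : 0 < s) {A : Set (E n)}
    (hA : MeasurableSet A) (h : ENNReal.ofReal s < dimH A) :
    ∃ K ⊆ A, IsCompact K ∧ 0 < netContent s K := by
  refine exists_isCompact_netContent_pos hA.analyticSet (pos_iff_ne_zero.2 fun h0 => ?_)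
  have h1 := hausdorffMeasure_of_lt_dimH (d := s.toNNReal) h
  rw [Real.coe_toNNReal s hs.le, hausdorffMeasure_eq_zero_of_netContent hs h0] at h1
  exact ENNReal.zero_ne_top h1

end Capacity

/-! ### Frostman measures -/

section Frostman

variable {n : ℕ}

/-- The index of the dyadic cube of twice the size that contains a given dyadic cube. -/
def parent (z : Fin n → ℤ) : Fin n → ℤ := fun i => z i / 2

/-- The indices of the dyadic cubes of half the size that a given dyadic cube contains. -/
noncomputable def kids (p : Fin n → ℤ) : Finset (Fin n → ℤ) :=
  Fintype.piFinset fun i => Finset.Icc (2 * p i) (2 * p i + 1)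

theorem mem_kids {p z : Fin n → ℤ} : z ∈ kids p ↔ parent z = p := by
  simp only [kids, Fintype.mem_piFinset, Finset.mem_Icc, parent, funext_iff]
  exact forall_congr' fun i => by omega

theorem parent_dyadicIndex (k : ℕ) (x : E n) :
    parent (dyadicIndex (k + 1) x) = dyadicIndex k x :=
  funext fun i => (dyadicIndex_succ k x i).symm

theorem parent_iterate_dyadicIndex (j l : ℕ) (x : E n) :
    parent^[l] (dyadicIndex (j + l) x) = dyadicIndex j x := by
  induction l with
  | zero => rfl
  | succ l ih => rw [Function.iterate_succ_apply, ← add_assoc, parent_dyadicIndex, ih]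

/-- Distribution of a unit mass over the dyadic cubes, starting at the unit cube `z₀` and passing
from a cube to its children proportionally to the weights `c`. -/
noncomputable def splitMass (c : ℕ → (Fin n → ℤ) → ℝ≥0∞) (z₀ : Fin n → ℤ) :
    ℕ → (Fin n → ℤ) → ℝ≥0∞
  | 0 => Pi.single z₀ 1
  | k + 1 => fun z => splitMass c z₀ k (parent z) *
      (c (k + 1) z / ∑ w ∈ kids (parent z), c (k + 1) w)

section SplitMass

variable {c : ℕ → (Fin n → ℤ) → ℝ≥0∞} {z₀ : Fin n → ℤ}

/-- The bound for a cube's parent, weakened by subadditivity, has the children's total weight in the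
numerator, which cancels the denominator of the splitting proportion. -/
theorem splitMass_le (hsub : ∀ k p, c k p ≤ ∑ z ∈ kids p, c (k + 1) z) (h0 : c 0 z₀ ≠ 0)
    (hfin : ∀ k z, c k z ≠ ∞) (k : ℕ) (z : Fin n → ℤ) :
    splitMass c z₀ k z ≤ c k z / c 0 z₀ := by
  induction k generalizing z with
  | zero =>
    rcases eq_or_ne z z₀ with rfl | hz
    · simp [splitMass, ENNReal.div_self h0 (hfin 0 z)]
    · simp [splitMass, hz]
  | succ k ih =>
    set tot := ∑ w ∈ kids (parent z), c (k + 1) w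
    calc splitMass c z₀ k (parent z) * (c (k + 1) z / tot)
        ≤ (tot / c 0 z₀) * (c (k + 1) z / tot) := by
          gcongr
          exact (ih _).trans (by gcongr; exact hsub k _)
      _ = (tot / tot) * (c (k + 1) z / c 0 z₀) := by
          simp only [div_eq_mul_inv]; ring
      _ ≤ 1 * (c (k + 1) z / c 0 z₀) := by gcongr; exact ENNReal.div_self_le_one
      _ = _ := one_mul _

theorem sum_splitMass (hsub : ∀ k p, c k p ≤ ∑ z ∈ kids p, c (k + 1) z) (h0 : c 0 z₀ ≠ 0)
    (hfin : ∀ k z, c k z ≠ ∞) (k : ℕ) (p : Fin n → ℤ) :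
    ∑ z ∈ kids p, splitMass c z₀ (k + 1) z = splitMass c z₀ k p := by
  have h1 : ∀ z ∈ kids p, splitMass c z₀ (k + 1) z =
      splitMass c z₀ k p * (c (k + 1) z / ∑ w ∈ kids p, c (k + 1) w) := fun z hz => by
    simp only [splitMass, mem_kids.1 hz]
  rw [Finset.sum_congr rfl h1, ← Finset.mul_sum]
  simp only [div_eq_mul_inv]
  rw [← Finset.sum_mul, ← div_eq_mul_inv]
  -- If all children have weight 0, the proportions are 0/0 = 0 and mass could be lost;
  -- subadditivity then gives weight 0, hence mass 0, to the parent too.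
  by_cases hS : ∑ w ∈ kids p, c (k + 1) w = 0
  · have h2 : splitMass c z₀ k p = 0 := by
      refine le_antisymm ((splitMass_le hsub h0 hfin k p).trans ?_) zero_le
      rw [le_antisymm ((hsub k p).trans hS.le) zero_le, ENNReal.zero_div]
    rw [h2, zero_mul]
  · rw [ENNReal.div_self hS (ENNReal.sum_ne_top.2 fun w _ => hfin _ w), mul_one]

/-- The masses of the cubes of level `k`, as a measure on the set of their indices. -/
noncomputable def levelMeasure (c : ℕ → (Fin n → ℤ) → ℝ≥0∞) (z₀ : Fin n → ℤ) (k : ℕ) :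
    Measure (Fin n → ℤ) := Measure.count.withDensity (splitMass c z₀ k)

theorem levelMeasure_finset (k : ℕ) (F : Finset (Fin n → ℤ)) :
    levelMeasure c z₀ k F = ∑ z ∈ F, splitMass c z₀ k z := by
  rw [← sum_measure_singleton]
  refine Finset.sum_congr rfl fun z _ => ?_
  rw [levelMeasure, withDensity_apply _ (.of_discrete), lintegral_singleton]
  simp

theorem map_parent_levelMeasure (hsub : ∀ k p, c k p ≤ ∑ z ∈ kids p, c (k + 1) z)
    (h0 : c 0 z₀ ≠ 0) (hfin : ∀ k z, c k z ≠ ∞) (k : ℕ) :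
    (levelMeasure c z₀ (k + 1)).map parent = levelMeasure c z₀ k := by
  refine Measure.ext_of_singleton fun p => ?_
  rw [Measure.map_apply .of_discrete .of_discrete]
  have h1 : parent ⁻¹' {p} = (kids p : Set (Fin n → ℤ)) := by
    ext z; simp [mem_kids]
  rw [h1, levelMeasure_finset, sum_splitMass hsub h0 hfin, ← Finset.coe_singleton,
    levelMeasure_finset, Finset.sum_singleton]

theorem map_parent_iterate_levelMeasure (hsub : ∀ k p, c k p ≤ ∑ z ∈ kids p, c (k + 1) z)
    (h0 : c 0 z₀ ≠ 0) (hfin : ∀ k z, c k z ≠ ∞) (j l : ℕ) :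
    (levelMeasure c z₀ (j + l)).map parent^[l] = levelMeasure c z₀ j := by
  induction l with
  | zero => simp
  | succ l ih =>
    rw [Function.iterate_succ, ← Measure.map_map .of_discrete .of_discrete, ← add_assoc,
      map_parent_levelMeasure hsub h0 hfin, ih]

theorem isProbabilityMeasure_levelMeasure (hsub : ∀ k p, c k p ≤ ∑ z ∈ kids p, c (k + 1) z)
    (h0 : c 0 z₀ ≠ 0) (hfin : ∀ k z, c k z ≠ ∞) (k : ℕ) :
    IsProbabilityMeasure (levelMeasure c z₀ k) := by
  constructor
  have h1 := map_parent_iterate_levelMeasure hsub h0 hfin 0 k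
  have h2 : levelMeasure c z₀ 0 Set.univ = 1 := by
    rw [levelMeasure, withDensity_apply _ (.of_discrete), Measure.restrict_univ, lintegral_count,
      splitMass, tsum_pi_single]
  rw [zero_add] at h1
  rw [← h2, ← h1, Measure.map_apply .of_discrete .univ, Set.preimage_univ]

end SplitMass

/-- **Frostman's lemma** for compact sets of positive net content. -/
theorem exists_frostman {s : ℝ} {K : Set (E n)} (hK : IsCompact K) (hpos : 0 < netContent s K) :
    ∃ μ : Measure (E n), IsProbabilityMeasure μ ∧ μ Kᶜ = 0 ∧ ∃ C : ℝ≥0∞, C ≠ ∞ ∧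
      ∀ (x : E n) (j : ℕ), μ (Metric.ball x ((2 : ℝ)⁻¹ ^ j)) ≤
        C * ENNReal.ofReal ((2 : ℝ) ^ (-(j * s))) := by
  classical
  -- Splitting mass proportionally to the content of K in each cube gives the Frostman bound, since
  -- this content is at most the s-th power of the side length.
  obtain ⟨c, hc⟩ : ∃ c : ℕ → (Fin n → ℤ) → ℝ≥0∞,
      ∀ k z, c k z = netContent s (K ∩ {x | dyadicIndex k x = z}) := ⟨_, fun _ _ => rfl⟩
  have hcle : ∀ k z, c k z ≤ ENNReal.ofReal ((2 : ℝ) ^ (-(k * s))) := fun k z => by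
    rw [← cubeWeight_singleton s (k, z)]
    rw [hc]
    refine netContent_le fun x hx => ⟨k, ?_⟩
    rw [Set.mem_singleton_iff, show dyadicIndex k x = z from hx.2]
  have hfin : ∀ k z, c k z ≠ ∞ := fun k z => ne_top_of_le_ne_top ENNReal.ofReal_ne_top (hcle k z)
  have hsub : ∀ k p, c k p ≤ ∑ z ∈ kids p, c (k + 1) z := fun k p => by
    simp only [hc]
    rw [← Finset.sum_coe_sort, ← tsum_fintype (L := .unconditional _)]
    refine le_trans (netContent_mono (T := ⋃ z : kids p, K ∩ {x | dyadicIndex (k + 1) x = z})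
      fun x hx => Set.mem_iUnion.2 ⟨⟨dyadicIndex (k + 1) x, mem_kids.2 ?_⟩, hx.1, rfl⟩)
      (netContent_iUnion_le _)
    rw [parent_dyadicIndex]; exact hx.2
  obtain ⟨z₀, h0⟩ : ∃ z₀, c 0 z₀ ≠ 0 := by
    by_contra! hcon
    refine hpos.ne' (le_antisymm ?_ zero_le)
    calc netContent s K ≤ netContent s (⋃ z, K ∩ {x | dyadicIndex 0 x = z}) :=
          netContent_mono fun x hx => Set.mem_iUnion.2 ⟨_, hx, rfl⟩
      _ ≤ ∑' z, c 0 z := by simp only [hc]; exact netContent_iUnion_le _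
      _ = 0 := by simp [hcon]
  have hKne : Nonempty K := by
    by_contra hcon
    have hKe : K = ∅ := Set.not_nonempty_iff_eq_empty.1 fun h => hcon h.to_subtype
    refine h0 ?_
    rw [hc]
    refine (le_antisymm ((netContent_le (C := ∅) ?_).trans (measure_empty).le) zero_le)
    rw [hKe, Set.empty_inter]; exact Set.empty_subset _
  have hCK : CompactSpace K := isCompact_iff_compactSpace.1 hK
  have hc0 : ∀ k z, c k z ≠ 0 → ∃ x : K, dyadicIndex k (x : E n) = z := fun k z hz => by
    by_contra! hcon
    refine hz (le_antisymm ?_ zero_le)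
    rw [hc]
    exact (netContent_le (C := ∅) fun x hx => (hcon ⟨x, hx.1⟩ hx.2).elim).trans measure_empty.le
  choose! pt hpt' using hc0
  have hpt : ∀ k z, splitMass c z₀ k z ≠ 0 → dyadicIndex k (pt k z : E n) = z := fun k z hz => by
    refine hpt' k z fun h => hz (le_antisymm ((splitMass_le hsub h0 hfin k z).trans ?_) zero_le)
    rw [h, ENNReal.zero_div]
  have hprob := isProbabilityMeasure_levelMeasure hsub h0 hfin
  -- The mass of each level-k cube is placed at one point of K in that cube; cubes without such a
  -- point carry no mass.
  let μ : ℕ → ProbabilityMeasure K := fun k =>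
    ⟨(levelMeasure c z₀ k).map (pt k),
      Measure.isProbabilityMeasure_map (Measurable.of_discrete).aemeasurable⟩
  have hball : ∀ (x : E n) (j k : ℕ), j ≤ k →
      (μ k : Measure K) (Subtype.val ⁻¹' Metric.ball x ((2 : ℝ)⁻¹ ^ j)) ≤
        3 ^ n / c 0 z₀ * ENNReal.ofReal ((2 : ℝ) ^ (-(j * s))) := by
    intro x j k hjk
    obtain ⟨l, rfl⟩ := Nat.exists_eq_add_of_le hjk
    have hae : ∀ᵐ z ∂levelMeasure c z₀ (j + l), splitMass c z₀ (j + l) z ≠ 0 := by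
      rw [levelMeasure, ae_withDensity_iff (Measurable.of_discrete)]
      exact .of_forall fun z hz => hz
    calc (μ (j + l) : Measure K) (Subtype.val ⁻¹' Metric.ball x ((2 : ℝ)⁻¹ ^ j))
        = levelMeasure c z₀ (j + l) (pt (j + l) ⁻¹' (Subtype.val ⁻¹'
            Metric.ball x ((2 : ℝ)⁻¹ ^ j))) := by
          refine Measure.map_apply .of_discrete ?_
          exact measurable_subtype_coe Metric.isOpen_ball.measurableSet
      _ ≤ levelMeasure c z₀ (j + l) (parent^[l] ⁻¹' (nbrs (dyadicIndex j x))) := by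
          refine measure_mono_ae (hae.mono fun z hz (hzU : (pt (j + l) z : E n) ∈ Metric.ball x _) => ?_)
          have h2 : dist x (pt (j + l) z : E n) ≤ (2 : ℝ)⁻¹ ^ j := by
            rw [dist_comm]; exact (Metric.mem_ball.1 hzU).le
          have h1 := dyadicIndex_mem_nbrs h2
          rw [← parent_iterate_dyadicIndex j l (pt (j + l) z : E n), hpt _ _ hz] at h1
          exact Finset.mem_coe.2 h1
      _ = ∑ z ∈ nbrs (dyadicIndex j x), splitMass c z₀ j z := by
          rw [← Measure.map_apply .of_discrete .of_discrete,
            map_parent_iterate_levelMeasure hsub h0 hfin, levelMeasure_finset]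
      _ ≤ ∑ z ∈ nbrs (dyadicIndex j x), ENNReal.ofReal ((2 : ℝ) ^ (-(j * s))) / c 0 z₀ := by
          refine Finset.sum_le_sum fun z _ => (splitMass_le hsub h0 hfin j z).trans ?_
          gcongr
          exact hcle j z
      _ = _ := by
          rw [Finset.sum_const, card_nbrs, nsmul_eq_mul, div_eq_mul_inv, div_eq_mul_inv]
          push_cast
          ring
  -- Weak compactness of the probability measures on K; an ultrafilter takes the place of a
  -- convergent subsequence. The ball estimate survives because balls are open.
  obtain ⟨ν, -, hν⟩ := isCompact_univ.ultrafilter_le_nhds ((Filter.hyperfilter ℕ).map μ)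
    (by simp)
  have hlim : Filter.Tendsto μ (Filter.hyperfilter ℕ : Filter ℕ) (𝓝 ν) := hν
  refine ⟨(ν : Measure K).map Subtype.val,
    Measure.isProbabilityMeasure_map measurable_subtype_coe.aemeasurable, ?_,
    3 ^ n / c 0 z₀, ENNReal.div_ne_top (by simp) h0, fun x j => ?_⟩
  · rw [Measure.map_apply measurable_subtype_coe hK.measurableSet.compl]
    rw [Set.preimage_compl, Subtype.coe_preimage_self, Set.compl_univ, measure_empty]
  · rw [Measure.map_apply measurable_subtype_coe Metric.isOpen_ball.measurableSet]
    refine (ProbabilityMeasure.le_liminf_measure_open_of_tendsto hlim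
      (Metric.isOpen_ball.preimage continuous_subtype_val)).trans ?_
    refine Filter.liminf_le_of_le (by isBoundedDefault) fun b hb => ?_
    have hge : ∀ᶠ k in (Filter.hyperfilter ℕ : Filter ℕ), j ≤ k :=
      (Filter.eventually_ge_atTop j).filter_mono Nat.hyperfilter_le_atTop
    obtain ⟨k, hk1, hk2⟩ := (hb.and hge).exists
    exact hk1.trans (hball x j k hk2)

/-- The `p`-energy of a measure. -/
noncomputable def energy {X : Type*} [PseudoEMetricSpace X] [MeasurableSpace X] (p : ℝ)
    (μ : Measure X) : ℝ≥0∞ := ∫⁻ x, ∫⁻ y, edist x y ^ (-p) ∂μ ∂μ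

/-- One term of the series suffices when the distance is positive and below 1: some i has 2^(-i-2) ≤
d < 2^(-i). The slack of two levels allows a strict upper inequality, as open balls require. At
distance 0 the series diverges. -/
theorem edist_rpow_neg_le_tsum {X : Type*} [PseudoMetricSpace X] {p : ℝ} (hp : 0 < p) (x y : X) :
    edist x y ^ (-p) ≤ 1 + ∑' j : ℕ, (Metric.ball x ((2 : ℝ)⁻¹ ^ j)).indicator
      (fun _ => ENNReal.ofReal ((2 : ℝ) ^ ((j + 2) * p))) y := by
  rcases eq_or_ne (dist y x) 0 with h0 | h0
  · have h1 : ∀ j : ℕ, (1 : ℝ≥0∞) ≤ (Metric.ball x ((2 : ℝ)⁻¹ ^ j)).indicator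
        (fun _ => ENNReal.ofReal ((2 : ℝ) ^ ((j + 2) * p))) y := fun j => by
      rw [Set.indicator_of_mem (by rw [Metric.mem_ball, h0]; positivity), ← ENNReal.ofReal_one]
      exact ENNReal.ofReal_le_ofReal (Real.one_le_rpow (by norm_num) (by positivity))
    have h2 : ∑' j : ℕ, (Metric.ball x ((2 : ℝ)⁻¹ ^ j)).indicator
        (fun _ => ENNReal.ofReal ((2 : ℝ) ^ ((j + 2) * p))) y = ∞ := by
      refine top_le_iff.1 (le_trans ?_ (ENNReal.tsum_le_tsum h1))
      rw [ENNReal.tsum_const_eq_top_of_ne_zero one_ne_zero]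
    rw [h2]; simp
  have hd : 0 < dist y x := lt_of_le_of_ne dist_nonneg h0.symm
  have hed : edist x y = ENNReal.ofReal (dist y x) := by rw [edist_dist, dist_comm]
  rcases le_or_gt 1 (dist y x) with h1 | h1
  · refine le_trans ?_ le_self_add
    rw [hed, ENNReal.rpow_neg, ENNReal.inv_le_one]
    refine ENNReal.one_le_rpow ?_ hp
    rwa [← ENNReal.ofReal_one, ENNReal.ofReal_le_ofReal_iff hd.le]
  · obtain ⟨j, hj1, hj2⟩ := exists_nat_pow_near_of_lt_one hd h1.le (by norm_num : (0 : ℝ) < 2⁻¹)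
      (by norm_num)
    have hi : ∃ i : ℕ, (2 : ℝ)⁻¹ ^ (i + 2) ≤ dist y x ∧ dist y x < (2 : ℝ)⁻¹ ^ i := by
      rcases j with - | j
      · exact ⟨0, le_trans (by norm_num) hj1.le, by simpa using h1⟩
      · exact ⟨j, hj1.le, hj2.trans_lt (pow_lt_pow_right_of_lt_one₀ (by norm_num) (by norm_num)
          (Nat.lt_succ_self j))⟩
    obtain ⟨i, hi1, hi2⟩ := hi
    refine le_trans ?_ (le_add_left (ENNReal.le_tsum i))
    rw [Set.indicator_of_mem (Metric.mem_ball.2 hi2), hed, ENNReal.ofReal_rpow_of_pos hd]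
    refine ENNReal.ofReal_le_ofReal ((Real.rpow_le_rpow_of_nonpos (by positivity) hi1
      (by linarith)).trans_eq ?_)
    rw [inv_pow, Real.inv_rpow (by positivity), Real.rpow_neg (by positivity), inv_inv,
      ← Real.rpow_natCast, ← Real.rpow_mul (by norm_num)]
    push_cast
    rfl

/-- A Frostman exponent s strictly between p and the dimension makes the dyadic series for the
potential geometric with ratio 2^(p-s) < 1, so the potential is even bounded. -/
theorem exists_measure_energy_ne_top {p : ℝ} (hp : 0 < p) {A : Set (E n)} (hA : MeasurableSet A)
    (h : ENNReal.ofReal p < dimH A) : ∃ K ⊆ A, IsCompact K ∧ ∃ μ : Measure (E n),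
      IsProbabilityMeasure μ ∧ μ Kᶜ = 0 ∧ energy p μ ≠ ∞ := by
  obtain ⟨s, hs, hsA⟩ := ENNReal.lt_iff_exists_nnreal_btwn.1 h
  have hps : p < s := by
    rwa [← ENNReal.ofReal_coe_nnreal, ENNReal.ofReal_lt_ofReal_iff_of_nonneg hp.le] at hs
  obtain ⟨K, hKA, hK, hKpos⟩ := exists_isCompact_netContent_pos_of_lt_dimH (hp.trans hps) hA
    (by rwa [ENNReal.ofReal_coe_nnreal])
  obtain ⟨μ, hμ, hμK, C, hC, hball⟩ := exists_frostman hK hKpos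
  refine ⟨K, hKA, hK, μ, hμ, hμK, ?_⟩
  have hterm : ∀ j : ℕ, ENNReal.ofReal ((2 : ℝ) ^ ((j + 2) * p)) *
      (C * ENNReal.ofReal ((2 : ℝ) ^ (-(j * (s : ℝ))))) =
      C * ENNReal.ofReal (2 ^ (2 * p)) * ENNReal.ofReal (2 ^ (p - s)) ^ j := fun j => by
    rw [mul_left_comm, mul_assoc, ← ENNReal.ofReal_pow (by positivity),
      ← ENNReal.ofReal_mul (by positivity), ← ENNReal.ofReal_mul (by positivity),
      ← Real.rpow_natCast, ← Real.rpow_mul (by positivity), ← Real.rpow_add (by positivity),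
      ← Real.rpow_add (by positivity)]
    congr 3; ring
  have hpot : ∀ x, ∫⁻ y, edist x y ^ (-p) ∂μ ≤
      1 + C * ENNReal.ofReal (2 ^ (2 * p)) * (1 - ENNReal.ofReal (2 ^ (p - s)))⁻¹ := fun x => by
    calc ∫⁻ y, edist x y ^ (-p) ∂μ
        ≤ ∫⁻ y, (1 + ∑' j : ℕ, (Metric.ball x ((2 : ℝ)⁻¹ ^ j)).indicator
          (fun _ => ENNReal.ofReal ((2 : ℝ) ^ ((j + 2) * p))) y) ∂μ :=
          lintegral_mono fun y => edist_rpow_neg_le_tsum hp x y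
      _ = 1 + ∑' j : ℕ, ENNReal.ofReal ((2 : ℝ) ^ ((j + 2) * p)) *
            μ (Metric.ball x ((2 : ℝ)⁻¹ ^ j)) := by
          rw [lintegral_add_left measurable_const, lintegral_const, measure_univ, mul_one,
            lintegral_tsum fun j => (measurable_const.indicator
              Metric.isOpen_ball.measurableSet).aemeasurable]
          simp_rw [lintegral_indicator_const Metric.isOpen_ball.measurableSet]
      _ ≤ 1 + ∑' j : ℕ, C * ENNReal.ofReal (2 ^ (2 * p)) * ENNReal.ofReal (2 ^ (p - s)) ^ j := by
          refine add_le_add le_rfl (ENNReal.tsum_le_tsum fun j => ?_)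
          rw [← hterm j]
          gcongr
          exact hball x j
      _ = _ := by rw [ENNReal.tsum_mul_left, ENNReal.tsum_geometric]
  refine ne_top_of_le_ne_top ?_ (lintegral_mono hpot)
  rw [lintegral_const, measure_univ, mul_one]
  refine ENNReal.add_ne_top.2 ⟨ENNReal.one_ne_top, ENNReal.mul_ne_top
    (ENNReal.mul_ne_top hC ENNReal.ofReal_ne_top) ?_⟩
  rw [ENNReal.inv_ne_top, ← pos_iff_ne_zero, tsub_pos_iff_lt, ← ENNReal.ofReal_one]
  exact (ENNReal.ofReal_lt_ofReal_iff one_pos).2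
    (Real.rpow_lt_one_of_one_lt_of_neg (by norm_num) (by linarith))

end Frostman

/-! ### Gaussian kernels and Fourier transforms of measures -/

section GaussKernel

variable {F : Type*} [NormedAddCommGroup F] [InnerProductSpace ℝ F]

/-- The Fourier transform of `ξ ↦ exp (-a ‖ξ‖²)`. -/
noncomputable def gaussKer (a : ℝ) (w : F) : ℝ :=
  (Real.pi / a) ^ ((Module.finrank ℝ F : ℝ) / 2) * Real.exp (-‖w‖ ^ 2 / (4 * a))

theorem gaussKer_nonneg {a : ℝ} (ha : 0 < a) (w : F) : 0 ≤ gaussKer a w := by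
  unfold gaussKer; positivity

theorem continuous_gaussKer (a : ℝ) : Continuous (gaussKer a : F → ℝ) := by
  unfold gaussKer; fun_prop

theorem gaussKer_le {a : ℝ} (ha : 0 < a) (w : F) :
    gaussKer a w ≤ (Real.pi / a) ^ ((Module.finrank ℝ F : ℝ) / 2) := by
  refine mul_le_of_le_one_right (by positivity) (Real.exp_le_one_iff.2 ?_)
  rw [neg_div]
  exact neg_nonpos.2 (by positivity)

variable [FiniteDimensional ℝ F] [MeasurableSpace F] [BorelSpace F]

theorem integral_cexp_eq_gaussKer {a : ℝ} (ha : 0 < a) (w : F) :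
    ∫ v : F, Complex.exp (-a * ‖v‖ ^ 2 + Complex.I * inner ℝ w v) = gaussKer a w := by
  rw [GaussianFourier.integral_cexp_neg_mul_sq_norm_add (by simpa using ha), gaussKer]
  push_cast
  rw [Complex.I_sq, Complex.ofReal_cpow (by positivity)]
  push_cast
  congr 2
  ring

theorem integrable_exp_neg_mul_sq_norm {a : ℝ} (ha : 0 < a) :
    Integrable fun v : F => Real.exp (-a * ‖v‖ ^ 2) := by
  have h := (GaussianFourier.integrable_cexp_neg_mul_sq_norm_add (b := a) (by simpa using ha) 0
    (0 : F)).norm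
  refine h.congr (.of_forall fun v => ?_)
  simp only [Complex.norm_exp]
  congr 1
  simp [← Complex.ofReal_pow]

/-- The mutual Gaussian energy of two measures. -/
noncomputable def gaussEnergy (a : ℝ) (μ ν : Measure F) : ℝ≥0∞ :=
  ∫⁻ z, ENNReal.ofReal (gaussKer a (z.1 - z.2)) ∂(μ.prod ν)

theorem integrable_gaussKer_sub {a : ℝ} (ha : 0 < a) (μ ν : Measure F) [IsFiniteMeasure μ]
    [IsFiniteMeasure ν] : Integrable (fun z : F × F => gaussKer a (z.1 - z.2)) (μ.prod ν) := by
  refine Integrable.of_bound ((continuous_gaussKer a).comp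
    (continuous_fst.sub continuous_snd)).aestronglyMeasurable
    ((Real.pi / a) ^ ((Module.finrank ℝ F : ℝ) / 2)) (.of_forall fun z => ?_)
  rw [Real.norm_of_nonneg (gaussKer_nonneg ha _)]
  exact gaussKer_le ha _

/-- Parseval's formula for the mutual Gaussian energy. -/
theorem integral_gaussKer_prod {a : ℝ} (ha : 0 < a) (μ ν : Measure F) [IsFiniteMeasure μ]
    [IsFiniteMeasure ν] :
    ((∫ z, gaussKer a (z.1 - z.2) ∂(μ.prod ν) : ℝ) : ℂ) =
      ∫ ξ : F, (Real.exp (-a * ‖ξ‖ ^ 2) : ℂ) * (charFun μ ξ * (starRingEnd ℂ) (charFun ν ξ)) := by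
  have h1 : ∀ ξ : F, charFun μ ξ * (starRingEnd ℂ) (charFun ν ξ) =
      ∫ z, Complex.exp (Complex.I * inner ℝ (z.1 - z.2) ξ) ∂(μ.prod ν) := fun ξ => by
    rw [← charFun_neg, charFun_apply, charFun_apply, ← integral_prod_mul]
    refine integral_congr_ae (.of_forall fun z => ?_)
    simp only
    rw [← Complex.exp_add]
    congr 1
    simp only [inner_sub_left, inner_neg_right]
    push_cast
    ring
  have h2 : ∀ ξ : F, (Real.exp (-a * ‖ξ‖ ^ 2) : ℂ) * (charFun μ ξ * (starRingEnd ℂ) (charFun ν ξ)) =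
      ∫ z, Complex.exp (-a * ‖ξ‖ ^ 2 + Complex.I * inner ℝ (z.1 - z.2) ξ) ∂(μ.prod ν) := fun ξ => by
    rw [h1, ← integral_const_mul]
    refine integral_congr_ae (.of_forall fun z => ?_)
    simp only
    rw [Complex.exp_add]
    push_cast
    rfl
  simp_rw [h2]
  rw [integral_integral_swap]
  · simp_rw [integral_cexp_eq_gaussKer ha]
    rw [integral_complex_ofReal]
  · refine Integrable.mono' ((integrable_exp_neg_mul_sq_norm (F := F) ha).comp_fst (μ.prod ν)) ?_
      (.of_forall fun z => ?_)
    · refine Continuous.aestronglyMeasurable ?_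
      simp only [Function.uncurry_def]
      fun_prop
    · simp only [Function.uncurry_def, Complex.norm_exp]
      refine le_of_eq (congrArg Real.exp ?_)
      simp [← Complex.ofReal_pow]

theorem gaussEnergy_eq_ofReal {a : ℝ} (ha : 0 < a) (μ ν : Measure F) [IsFiniteMeasure μ]
    [IsFiniteMeasure ν] :
    gaussEnergy a μ ν = ENNReal.ofReal (∫ z, gaussKer a (z.1 - z.2) ∂(μ.prod ν)) :=
  (ofReal_integral_eq_lintegral_ofReal (integrable_gaussKer_sub ha μ ν)
    (.of_forall fun _ => gaussKer_nonneg ha _)).symm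

/-- The Gaussian factor in Parseval's formula is at most 1. The bound is independent of `a`, which
makes dominated convergence possible as a → 0. -/
theorem gaussEnergy_le {a : ℝ} (ha : 0 < a) (μ ν : Measure F) [IsFiniteMeasure μ]
    [IsFiniteMeasure ν] : gaussEnergy a μ ν ≤ ∫⁻ ξ, ‖charFun μ ξ‖ₑ * ‖charFun ν ξ‖ₑ := by
  rw [gaussEnergy_eq_ofReal ha]
  have h0 : 0 ≤ ∫ z, gaussKer a (z.1 - z.2) ∂(μ.prod ν) :=
    integral_nonneg fun z => gaussKer_nonneg ha _
  have h1 : ENNReal.ofReal (∫ z, gaussKer a (z.1 - z.2) ∂(μ.prod ν)) =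
      ‖((∫ z, gaussKer a (z.1 - z.2) ∂(μ.prod ν) : ℝ) : ℂ)‖ₑ := by
    rw [← ofReal_norm, Complex.norm_real, Real.norm_of_nonneg h0]
  rw [h1, integral_gaussKer_prod ha]
  refine (enorm_integral_le_lintegral_enorm _).trans (lintegral_mono fun ξ => ?_)
  rw [enorm_mul, enorm_mul]
  have h2 : ‖(Real.exp (-a * ‖ξ‖ ^ 2) : ℂ)‖ₑ ≤ 1 := by
    rw [← ofReal_norm, Complex.norm_real, Real.norm_of_nonneg (Real.exp_nonneg _),
      ← ENNReal.ofReal_one]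
    refine ENNReal.ofReal_le_ofReal (Real.exp_le_one_iff.2 ?_)
    rw [neg_mul]
    exact neg_nonpos.2 (by positivity)
  have h3 : ‖(starRingEnd ℂ) (charFun ν ξ)‖ₑ = ‖charFun ν ξ‖ₑ := by
    rw [← ofReal_norm, ← ofReal_norm, RCLike.norm_conj]
  rw [h3]
  exact mul_le_of_le_one_left' h2

theorem gaussEnergy_self {a : ℝ} (ha : 0 < a) (μ : Measure F) [IsFiniteMeasure μ] :
    gaussEnergy a μ μ =
      ∫⁻ ξ, ENNReal.ofReal (Real.exp (-a * ‖ξ‖ ^ 2)) * ‖charFun μ ξ‖ₑ ^ 2 := by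
  have h1 := integral_gaussKer_prod ha μ μ
  have h2 : ∀ ξ : F, (Real.exp (-a * ‖ξ‖ ^ 2) : ℂ) * (charFun μ ξ * (starRingEnd ℂ) (charFun μ ξ)) =
      ((Real.exp (-a * ‖ξ‖ ^ 2) * ‖charFun μ ξ‖ ^ 2 : ℝ) : ℂ) := fun ξ => by
    rw [Complex.mul_conj, Complex.normSq_eq_norm_sq]
    push_cast
    rfl
  simp_rw [h2] at h1
  rw [integral_complex_ofReal, Complex.ofReal_inj] at h1
  rw [gaussEnergy_eq_ofReal ha, h1, ofReal_integral_eq_lintegral_ofReal]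
  · refine lintegral_congr fun ξ => ?_
    rw [ENNReal.ofReal_mul (Real.exp_nonneg _), ENNReal.ofReal_pow (norm_nonneg _), ofReal_norm]
  · refine (integrable_exp_neg_mul_sq_norm ha).mul_bdd (c := μ.real Set.univ ^ 2)
      ((measurable_charFun (μ := μ)).norm.pow_const 2).aestronglyMeasurable (.of_forall fun ξ => ?_)
    rw [Real.norm_of_nonneg (by positivity)]
    exact pow_le_pow_left₀ (norm_nonneg _) (norm_charFun_le ξ) 2
  · exact .of_forall fun ξ => by positivity

/-- The Fourier side of the `p`-energy of a measure. -/
noncomputable def fourierEnergy (p : ℝ) (μ : Measure F) : ℝ≥0∞ :=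
  ∫⁻ ξ : F, ‖charFun μ ξ‖ₑ ^ 2 * ‖ξ‖ₑ ^ (p - Module.finrank ℝ F)

/-- A Young inequality with a free constant, playing the role of Cauchy–Schwarz throughout. -/
theorem ennreal_mul_le_add {x y c : ℝ≥0∞} (h0 : c ≠ 0) (h1 : c ≠ ∞) :
    x * y ≤ c * x ^ 2 + c⁻¹ * y ^ 2 := by
  rcases le_total y (c * x) with h | h
  · refine le_add_right ?_
    calc x * y ≤ x * (c * x) := by gcongr
      _ = c * x ^ 2 := by ring
  · refine le_add_left ?_
    have hx : x ≤ c⁻¹ * y := by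
      rwa [mul_comm, ← div_eq_mul_inv, ENNReal.le_div_iff_mul_le (Or.inl h0) (Or.inl h1), mul_comm]
    calc x * y ≤ (c⁻¹ * y) * y := by gcongr
      _ = c⁻¹ * y ^ 2 := by ring

theorem ae_ne_zero_volume [Nontrivial F] : ∀ᵐ ξ : F, ξ ≠ 0 := by
  simp [ae_iff]

/-- For s + t = 2d the weights of the two Fourier energies are reciprocal. The constant `c` stays
free so that one term can be made small before the other is treated. -/
theorem lintegral_charFun_mul_le [Nontrivial F] {s t : ℝ} (hst : s + t = 2 * Module.finrank ℝ F)
    {c : ℝ≥0∞} (h0 : c ≠ 0) (h1 : c ≠ ∞) (μ ν : Measure F) [IsFiniteMeasure μ] :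
    ∫⁻ ξ, ‖charFun μ ξ‖ₑ * ‖charFun ν ξ‖ₑ ≤ c * fourierEnergy s μ + c⁻¹ * fourierEnergy t ν := by
  calc ∫⁻ ξ, ‖charFun μ ξ‖ₑ * ‖charFun ν ξ‖ₑ
      ≤ ∫⁻ ξ : F, (c * (‖charFun μ ξ‖ₑ ^ 2 * ‖ξ‖ₑ ^ (s - Module.finrank ℝ F)) +
        c⁻¹ * (‖charFun ν ξ‖ₑ ^ 2 * ‖ξ‖ₑ ^ (t - Module.finrank ℝ F))) := by
        refine lintegral_mono_ae (ae_ne_zero_volume.mono fun ξ hξ => ?_)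
        have hr : (‖ξ‖ₑ : ℝ≥0∞) ≠ 0 := by simpa using hξ
        have e1 : ‖ξ‖ₑ ^ (t - Module.finrank ℝ F) = (‖ξ‖ₑ ^ (s - Module.finrank ℝ F))⁻¹ := by
          rw [← ENNReal.rpow_neg]; congr 1; linarith
        have hr0 : ‖ξ‖ₑ ^ (s - Module.finrank ℝ F) ≠ 0 :=
          (ENNReal.rpow_pos (pos_iff_ne_zero.2 hr) enorm_ne_top).ne'
        have hr1 : ‖ξ‖ₑ ^ (s - Module.finrank ℝ F) ≠ ∞ := ENNReal.rpow_ne_top_of_ne_zero hr enorm_ne_top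
        refine (ennreal_mul_le_add (c := c * ‖ξ‖ₑ ^ (s - Module.finrank ℝ F))
          (mul_ne_zero h0 hr0) (ENNReal.mul_ne_top h1 hr1)).trans_eq ?_
        rw [e1, ENNReal.mul_inv (Or.inl h0) (Or.inl h1)]
        ring
    _ = _ := by
        rw [lintegral_add_left, lintegral_const_mul' _ _ h1,
          lintegral_const_mul' _ _ (ENNReal.inv_ne_top.2 h0)]
        · rfl
        · exact (((measurable_charFun (μ := μ)).enorm.pow_const 2).mul
            (measurable_enorm.pow_const _)).const_mul c

end GaussKernel

/-! ### Energies and Fourier transforms -/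

section Subordination

/-- A nonzero Bochner integral already entails integrability, so the closed formula for the integral
is all that is needed. -/
theorem lintegral_ofReal_of_integral_pos {f : ℝ → ℝ} {S : Set ℝ} (hS : MeasurableSet S)
    (hf : ∀ x ∈ S, 0 ≤ f x) (h : 0 < ∫ x in S, f x) :
    ∫⁻ x in S, ENNReal.ofReal (f x) = ENNReal.ofReal (∫ x in S, f x) :=
  (ofReal_integral_eq_lintegral_ofReal (Integrable.of_integral_ne_zero h.ne')
    ((ae_restrict_iff' hS).2 (.of_forall hf))).symm

theorem lintegral_rpow_mul_exp_neg {q r : ℝ} (hq : 0 < q) (hr : 0 < r) :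
    ∫⁻ a in Set.Ioi 0, ENNReal.ofReal (a ^ (q - 1) * Real.exp (-(r * a))) =
      ENNReal.ofReal ((1 / r) ^ q * Real.Gamma q) := by
  have h := Real.integral_rpow_mul_exp_neg_mul_Ioi hq hr
  rw [lintegral_ofReal_of_integral_pos measurableSet_Ioi, h]
  · intro x (hx : 0 < x); positivity
  · rw [h]; positivity

/-- The substitution a ↦ 1/a reduces this to the usual Gamma integral. -/
theorem lintegral_rpow_mul_exp_neg_div {q r : ℝ} (hq : 0 < q) (hr : 0 < r) :
    ∫⁻ a in Set.Ioi 0, ENNReal.ofReal (a ^ (-q - 1) * Real.exp (-(r / a))) =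
      ENNReal.ofReal ((1 / r) ^ q * Real.Gamma q) := by
  have h : ∫ a in Set.Ioi 0, a ^ (-q - 1) * Real.exp (-(r / a)) = (1 / r) ^ q * Real.Gamma q := by
    rw [← Real.integral_rpow_mul_exp_neg_mul_Ioi hq hr,
      ← integral_comp_rpow_Ioi (fun t => t ^ (q - 1) * Real.exp (-(r * t)))
        (by norm_num : (-1 : ℝ) ≠ 0)]
    refine setIntegral_congr_fun measurableSet_Ioi fun x (hx : 0 < x) => ?_
    simp only [smul_eq_mul]
    rw [← Real.rpow_mul hx.le, abs_neg, abs_one, one_mul, ← mul_assoc, ← Real.rpow_add hx,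
      Real.rpow_neg_one, div_eq_mul_inv]
    congr 2
    ring
  rw [lintegral_ofReal_of_integral_pos measurableSet_Ioi, h]
  · intro x (hx : 0 < x); positivity
  · rw [h]; positivity

variable {F : Type*} [NormedAddCommGroup F]

theorem lintegral_rpow_mul_exp_neg_sq_norm {q : ℝ} (hq : 0 < q) {ξ : F} (hξ : ξ ≠ 0) :
    ∫⁻ a in Set.Ioi 0, ENNReal.ofReal (a ^ (q - 1) * Real.exp (-a * ‖ξ‖ ^ 2)) =
      ENNReal.ofReal (Real.Gamma q) * ‖ξ‖ₑ ^ (-(2 * q)) := by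
  have hn : 0 < ‖ξ‖ := norm_pos_iff.2 hξ
  have h := lintegral_rpow_mul_exp_neg hq (pow_pos hn 2)
  simp only [neg_mul]
  simp only [mul_comm (‖ξ‖ ^ 2)] at h
  rw [h, mul_comm, ENNReal.ofReal_mul (by positivity), ← ofReal_norm, ENNReal.ofReal_rpow_of_pos hn]
  congr 2
  rw [one_div, Real.inv_rpow (by positivity), ← Real.rpow_natCast, ← Real.rpow_mul hn.le,
    Real.rpow_neg hn.le]
  norm_num

variable [InnerProductSpace ℝ F]

/-- Subordination: the Riesz kernel is a mixture of Gaussian kernels. At `w = 0` both sides are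
infinite, so measures with atoms need no exception. -/
theorem lintegral_rpow_mul_gaussKer {p : ℝ} (hp : 0 < p) (w : F) :
    ∫⁻ a in Set.Ioi 0, ENNReal.ofReal (a ^ ((Module.finrank ℝ F - p) / 2 - 1) * gaussKer a w) =
      ENNReal.ofReal (Real.pi ^ ((Module.finrank ℝ F : ℝ) / 2) * 4 ^ (p / 2) * Real.Gamma (p / 2)) *
        ‖w‖ₑ ^ (-p) := by
  set d : ℝ := (Module.finrank ℝ F : ℝ) with hd
  have h1 : ∀ a ∈ Set.Ioi (0 : ℝ), ENNReal.ofReal (a ^ ((d - p) / 2 - 1) * gaussKer a w) =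
      ENNReal.ofReal (Real.pi ^ (d / 2)) *
        ENNReal.ofReal (a ^ (-(p / 2) - 1) * Real.exp (-(‖w‖ ^ 2 / 4 / a))) := by
    intro a (ha : 0 < a)
    rw [← ENNReal.ofReal_mul (by positivity)]
    congr 1
    rw [gaussKer, Real.div_rpow Real.pi_pos.le ha.le, ← hd]
    have h2 : a ^ ((d - p) / 2 - 1) = a ^ (-(p / 2) - 1) * a ^ (d / 2) := by
      rw [← Real.rpow_add ha]; congr 1; ring
    have h3 : a ^ (d / 2) ≠ 0 := (Real.rpow_pos_of_pos ha _).ne'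
    have h4 : -‖w‖ ^ 2 / (4 * a) = -(‖w‖ ^ 2 / 4 / a) := by rw [neg_div, div_div]
    rw [h2, h4]
    field_simp
  rw [setLIntegral_congr_fun measurableSet_Ioi h1, lintegral_const_mul' _ _ ENNReal.ofReal_ne_top]
  rcases eq_or_ne w 0 with rfl | hw
  · have h2 : ∫⁻ a in Set.Ioi (0 : ℝ), ENNReal.ofReal (a ^ (-(p / 2) - 1)) = ∞ := by
      by_contra hcon
      refine not_integrableOn_Ioi_rpow (-(p / 2) - 1) ⟨by fun_prop, ?_⟩
      rw [hasFiniteIntegral_iff_ofReal]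
      · exact lt_top_iff_ne_top.2 hcon
      · exact (ae_restrict_iff' measurableSet_Ioi).2
          (.of_forall fun x (hx : 0 < x) => (Real.rpow_pos_of_pos hx _).le)
    have h3 : (‖(0 : F)‖ₑ : ℝ≥0∞) ^ (-p) = ∞ := by
      rw [enorm_zero, ENNReal.zero_rpow_of_neg (by linarith)]
    rw [h3, ENNReal.mul_top (by rw [Ne, ENNReal.ofReal_eq_zero, not_le]; positivity)]
    simp only [norm_zero, ne_eq, OfNat.ofNat_ne_zero, not_false_eq_true, zero_pow, zero_div,
      neg_zero, Real.exp_zero, mul_one, h2]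
    exact ENNReal.mul_top (by rw [Ne, ENNReal.ofReal_eq_zero, not_le]; positivity)
  · have hn : 0 < ‖w‖ := norm_pos_iff.2 hw
    rw [lintegral_rpow_mul_exp_neg_div (by positivity) (by positivity),
      ← ENNReal.ofReal_mul (by positivity), ← ofReal_norm, ENNReal.ofReal_rpow_of_pos hn,
      ← ENNReal.ofReal_mul (by positivity)]
    congr 1
    rw [one_div_div, Real.div_rpow (by positivity) (by positivity), ← Real.rpow_natCast ‖w‖ 2,
      ← Real.rpow_mul hn.le, Real.rpow_neg hn.le]
    have : ((2 : ℕ) : ℝ) * (p / 2) = p := by push_cast; ring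
    rw [this]
    ring

variable [FiniteDimensional ℝ F] [MeasurableSpace F] [BorelSpace F]

theorem energy_eq_lintegral_prod (p : ℝ) (μ : Measure F) [SFinite μ] :
    energy p μ = ∫⁻ z, ‖z.1 - z.2‖ₑ ^ (-p) ∂(μ.prod μ) := by
  rw [lintegral_prod _ (by fun_prop)]
  simp only [energy, edist_eq_enorm_sub]

/-- The energy of a measure in terms of its Fourier transform. -/
theorem exists_fourierEnergy_eq [Nontrivial F] {p : ℝ} (hp : 0 < p)
    (hpd : p < Module.finrank ℝ F) : ∃ C : ℝ≥0∞, C ≠ 0 ∧ C ≠ ∞ ∧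
      ∀ (μ : Measure F) [IsFiniteMeasure μ], fourierEnergy p μ = C * energy p μ := by
  set d : ℝ := (Module.finrank ℝ F : ℝ) with hd
  set q : ℝ := (d - p) / 2 with hq
  have hq0 : 0 < q := by rw [hq]; linarith
  set C₁ := ENNReal.ofReal (Real.Gamma q)
  set C₂ := ENNReal.ofReal (Real.pi ^ (d / 2) * 4 ^ (p / 2) * Real.Gamma (p / 2))
  have hC₁ : C₁ ≠ 0 := by
    rw [Ne, ENNReal.ofReal_eq_zero, not_le]; positivity
  have hC₂ : C₂ ≠ 0 := by
    rw [Ne, ENNReal.ofReal_eq_zero, not_le]; positivity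
  have hC₁' : C₁ ≠ ∞ := ENNReal.ofReal_ne_top
  have hC₂' : C₂ ≠ ∞ := ENNReal.ofReal_ne_top
  refine ⟨C₁⁻¹ * C₂, mul_ne_zero (ENNReal.inv_ne_zero.2 hC₁') hC₂,
    ENNReal.mul_ne_top (ENNReal.inv_ne_top.2 hC₁) hC₂', fun μ _ => ?_⟩
  have hmeas : Measurable fun z : F × ℝ => ENNReal.ofReal (z.2 ^ (q - 1)) *
      (ENNReal.ofReal (Real.exp (-z.2 * ‖z.1‖ ^ 2)) * ‖charFun μ z.1‖ₑ ^ 2) := by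
    have := (measurable_charFun (μ := μ))
    fun_prop
  have hmeas2 : Measurable fun z : ℝ × (F × F) => ENNReal.ofReal (z.1 ^ (q - 1)) *
      ENNReal.ofReal (gaussKer z.1 (z.2.1 - z.2.2)) := by
    unfold gaussKer
    fun_prop
  have h1 : C₁ * fourierEnergy p μ = ∫⁻ ξ : F, ∫⁻ a in Set.Ioi (0 : ℝ), ENNReal.ofReal (a ^ (q - 1)) *
      (ENNReal.ofReal (Real.exp (-a * ‖ξ‖ ^ 2)) * ‖charFun μ ξ‖ₑ ^ 2) := by
    rw [fourierEnergy, ← lintegral_const_mul' _ _ hC₁']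
    refine lintegral_congr_ae (ae_ne_zero_volume.mono fun ξ hξ => ?_)
    have h2 := lintegral_rpow_mul_exp_neg_sq_norm hq0 hξ
    have h3 : -(2 * q) = p - d := by rw [hq]; ring
    rw [h3] at h2
    change C₁ * (‖charFun μ ξ‖ₑ ^ 2 * ‖ξ‖ₑ ^ (p - d)) = _
    rw [mul_left_comm, ← h2, ← lintegral_const_mul' _ _ (by finiteness)]
    refine setLIntegral_congr_fun measurableSet_Ioi fun a (ha : 0 < a) => ?_
    rw [ENNReal.ofReal_mul (by positivity)]
    ring
  -- For each `a`, `gaussEnergy_self` equates the frequency side with the space side; integrating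
  -- over `a` yields the Fourier energy on one and the Riesz energy on the other.
  have h2 : C₁ * fourierEnergy p μ = C₂ * energy p μ := by
    rw [h1, lintegral_lintegral_swap hmeas.aemeasurable]
    have h4 : ∀ a ∈ Set.Ioi (0 : ℝ), ∫⁻ ξ : F, ENNReal.ofReal (a ^ (q - 1)) *
        (ENNReal.ofReal (Real.exp (-a * ‖ξ‖ ^ 2)) * ‖charFun μ ξ‖ₑ ^ 2) =
        ∫⁻ z, ENNReal.ofReal (a ^ (q - 1)) *
          ENNReal.ofReal (gaussKer a (z.1 - z.2)) ∂(μ.prod μ) := by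
      intro a (ha : 0 < a)
      rw [lintegral_const_mul' _ _ ENNReal.ofReal_ne_top,
        lintegral_const_mul' _ _ ENNReal.ofReal_ne_top, ← gaussEnergy_self ha, gaussEnergy]
    rw [setLIntegral_congr_fun measurableSet_Ioi h4,
      lintegral_lintegral_swap hmeas2.aemeasurable, energy_eq_lintegral_prod,
      ← lintegral_const_mul' _ _ hC₂']
    refine lintegral_congr fun z => ?_
    rw [← lintegral_rpow_mul_gaussKer hp (z.1 - z.2)]
    refine setLIntegral_congr_fun measurableSet_Ioi fun a (ha : 0 < a) => ?_
    rw [ENNReal.ofReal_mul (by positivity)]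
  rw [mul_assoc, ← h2, ← mul_assoc, ENNReal.inv_mul_cancel hC₁ hC₁', one_mul]

end Subordination

-- Mollification by Gaussian kernels and absolute continuity

section Smoothing

/-- The scales `1 / (k + 1)`. -/
noncomputable def scale (k : ℕ) : ℝ := 1 / ((k : ℝ) + 1)

theorem scale_pos (k : ℕ) : 0 < scale k := by unfold scale; positivity

theorem scale_le_one (k : ℕ) : scale k ≤ 1 := by
  unfold scale
  rw [div_le_one (by positivity)]
  linarith [(Nat.cast_nonneg k : (0 : ℝ) ≤ k)]

theorem tendsto_scale : Filter.Tendsto scale Filter.atTop (𝓝 0) :=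
  tendsto_one_div_add_atTop_nhds_zero_nat

variable {F : Type*} [NormedAddCommGroup F] [InnerProductSpace ℝ F]

theorem gaussKer_neg (a : ℝ) (w : F) : gaussKer a (-w) = gaussKer a w := by
  simp [gaussKer]

theorem gaussKer_smul_sqrt {a : ℝ} (ha : 0 < a) (w : F) :
    √a ^ Module.finrank ℝ F * gaussKer a (√a • w) = gaussKer 1 w := by
  have h1 : √a ^ Module.finrank ℝ F = a ^ ((Module.finrank ℝ F : ℝ) / 2) := by
    rw [Real.sqrt_eq_rpow, ← Real.rpow_natCast, ← Real.rpow_mul ha.le]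
    congr 1; ring
  have h2 : a ^ ((Module.finrank ℝ F : ℝ) / 2) ≠ 0 := (Real.rpow_pos_of_pos ha _).ne'
  rw [h1, gaussKer, gaussKer, norm_smul, mul_pow, Real.norm_of_nonneg (Real.sqrt_nonneg _),
    Real.sq_sqrt ha.le, Real.div_rpow Real.pi_pos.le ha.le, div_one, ← mul_assoc,
    mul_div_cancel₀ _ h2]
  congr 2
  field_simp

variable [MeasurableSpace F]

/-- Measures on sets at a positive distance have small mutual Gaussian energy. -/
theorem tendsto_gaussEnergy_of_dist {μ ν : Measure F} [IsFiniteMeasure μ] [IsFiniteMeasure ν]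
    {r : ℝ} (hr : 0 < r) (h : ∀ᵐ z ∂(μ.prod ν), r ≤ dist z.1 z.2) :
    Filter.Tendsto (fun k => gaussEnergy (scale k) μ ν) Filter.atTop (𝓝 0) := by
  set d : ℝ := (Module.finrank ℝ F : ℝ)
  have hlim : Filter.Tendsto (fun k : ℕ => ENNReal.ofReal (Real.pi ^ (d / 2) *
      (((k : ℝ) + 1) ^ (d / 2) * Real.exp (-(r ^ 2 / 4) * ((k : ℝ) + 1)))) *
        (μ.prod ν) Set.univ) Filter.atTop (𝓝 0) := by
    have h1 := (tendsto_rpow_mul_exp_neg_mul_atTop_nhds_zero (d / 2) (r ^ 2 / 4)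
      (by positivity)).comp (Filter.tendsto_atTop_add_const_right _ (1 : ℝ)
        (tendsto_natCast_atTop_atTop (R := ℝ)))
    have h2 := ENNReal.tendsto_ofReal (h1.const_mul (Real.pi ^ (d / 2)))
    rw [mul_zero, ENNReal.ofReal_zero] at h2
    simpa using ENNReal.Tendsto.mul_const h2 (Or.inr (measure_ne_top (μ.prod ν) Set.univ))
  refine tendsto_of_tendsto_of_tendsto_of_le_of_le tendsto_const_nhds hlim (fun _ => zero_le)
    fun k => ?_
  rw [← lintegral_const]
  refine lintegral_mono_ae (h.mono fun z hz => ENNReal.ofReal_le_ofReal ?_)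
  have hs : (Real.pi / scale k) ^ (d / 2) = Real.pi ^ (d / 2) * ((k : ℝ) + 1) ^ (d / 2) := by
    rw [scale, div_div_eq_mul_div, div_one, Real.mul_rpow Real.pi_pos.le (by positivity)]
  rw [gaussKer, hs, mul_assoc]
  gcongr
  rw [scale, dist_eq_norm] at *
  have h1 : -‖z.1 - z.2‖ ^ 2 / (4 * (1 / ((k : ℝ) + 1))) =
      -(‖z.1 - z.2‖ ^ 2 / 4) * ((k : ℝ) + 1) := by field_simp
  rw [h1]
  gcongr

variable [FiniteDimensional ℝ F] [BorelSpace F]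

theorem lintegral_comp_smul_addHaar {r : ℝ} (hr : 0 < r) {g : F → ℝ≥0∞} (hg : Measurable g) :
    ENNReal.ofReal (r ^ Module.finrank ℝ F) * ∫⁻ w, g (r • w) = ∫⁻ w, g w := by
  have h := Measure.map_addHaar_smul (volume : Measure F) hr.ne'
  rw [← lintegral_map hg (measurable_const_smul r), h, lintegral_smul_measure, smul_eq_mul,
    ← mul_assoc, ← ENNReal.ofReal_mul (by positivity), abs_of_pos (by positivity),
    mul_inv_cancel₀ (by positivity), ENNReal.ofReal_one, one_mul]

/-- Rescaling moves the dependence on `a` from the kernel to the argument of `h`, where limits as a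
→ 0 can be taken pointwise. -/
theorem lintegral_mul_gaussKer {a : ℝ} (ha : 0 < a) {h : F → ℝ≥0∞} (hh : Measurable h) (x : F) :
    ∫⁻ z, h z * ENNReal.ofReal (gaussKer a (x - z)) =
      ∫⁻ w, h (x + √a • w) * ENNReal.ofReal (gaussKer 1 w) := by
  have hK : Measurable (gaussKer a : F → ℝ) := (continuous_gaussKer a).measurable
  rw [← lintegral_add_left_eq_self _ x, ← lintegral_comp_smul_addHaar (Real.sqrt_pos.2 ha)
    (by fun_prop), ← lintegral_const_mul' _ _ ENNReal.ofReal_ne_top]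
  refine lintegral_congr fun w => ?_
  rw [← gaussKer_smul_sqrt ha w, sub_add_cancel_left, gaussKer_neg,
    ENNReal.ofReal_mul (by positivity)]
  ring

variable (F) in
/-- The integral of the Gaussian kernels. -/
noncomputable def gaussMass : ℝ≥0∞ := ∫⁻ w : F, ENNReal.ofReal (gaussKer 1 w)

theorem gaussMass_ne_zero : gaussMass F ≠ 0 := by
  intro h
  rw [gaussMass, lintegral_eq_zero_iff (continuous_gaussKer 1).measurable.ennreal_ofReal] at h
  obtain ⟨w, hw⟩ := h.exists
  have hpos : 0 < gaussKer 1 w := by unfold gaussKer; positivity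
  simp [hpos.not_ge] at hw

theorem gaussMass_ne_top : gaussMass F ≠ ∞ := by
  have h : Integrable (gaussKer 1 : F → ℝ) := by
    refine ((integrable_exp_neg_mul_sq_norm (F := F) (a := 1 / 4) (by norm_num)).const_mul
      ((Real.pi / 1) ^ ((Module.finrank ℝ F : ℝ) / 2))).congr (.of_forall fun w => ?_)
    simp only [gaussKer]
    congr 2; ring
  exact h.lintegral_lt_top.ne

theorem measurable_gaussKer_sub (a : ℝ) :
    Measurable fun z : F × F => ENNReal.ofReal (gaussKer a (z.1 - z.2)) :=
  ((continuous_gaussKer a).comp (continuous_fst.sub continuous_snd)).measurable.ennreal_ofReal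

theorem gaussEnergy_dirac (a : ℝ) (μ : Measure F) [SFinite μ] (u : F) :
    gaussEnergy a μ (Measure.dirac u) = ∫⁻ x, ENNReal.ofReal (gaussKer a (x - u)) ∂μ := by
  rw [gaussEnergy, lintegral_prod _ (measurable_gaussKer_sub a).aemeasurable]
  refine lintegral_congr fun x => ?_
  exact lintegral_dirac' u ((measurable_gaussKer_sub a).comp measurable_prodMk_left)

theorem gaussEnergy_eq_lintegral_dirac (a : ℝ) (μ ν : Measure F) [SFinite μ] [SFinite ν] :
    gaussEnergy a μ ν = ∫⁻ u, gaussEnergy a μ (Measure.dirac u) ∂ν := by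
  rw [gaussEnergy, lintegral_prod_symm _ (measurable_gaussKer_sub a).aemeasurable]
  simp_rw [gaussEnergy_dirac]

theorem gaussEnergy_restrict_volume {a : ℝ} (ha : 0 < a) (μ : Measure F) [SFinite μ] {U : Set F}
    (hU : MeasurableSet U) : gaussEnergy a μ (volume.restrict U) =
      ∫⁻ x, (∫⁻ w, U.indicator 1 (x + √a • w) * ENNReal.ofReal (gaussKer 1 w)) ∂μ := by
  rw [gaussEnergy, lintegral_prod _ (measurable_gaussKer_sub a).aemeasurable]
  refine lintegral_congr fun x => ?_
  rw [← lintegral_mul_gaussKer ha (measurable_one.indicator hU), ← lintegral_indicator hU]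
  refine lintegral_congr fun z => ?_
  by_cases hz : z ∈ U <;> simp [hz]

/-- The mass of an open set is controlled by the mollifications of the measure. -/
theorem gaussMass_mul_le_liminf (μ : Measure F) [SFinite μ] {U : Set F} (hU : IsOpen U)
    {a : ℕ → ℝ} (ha : ∀ k, 0 < a k) (ha0 : Filter.Tendsto a Filter.atTop (𝓝 0)) :
    gaussMass F * μ U ≤
      Filter.liminf (fun k => gaussEnergy (a k) μ (volume.restrict U)) Filter.atTop := by
  have hm : ∀ k, Measurable fun z : F × F => U.indicator (1 : F → ℝ≥0∞) (z.1 + √(a k) • z.2) *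
      ENNReal.ofReal (gaussKer 1 z.2) := fun k => by
    have h1 : Measurable (U.indicator (1 : F → ℝ≥0∞)) := measurable_one.indicator hU.measurableSet
    have h2 : Measurable (gaussKer 1 : F → ℝ) := (continuous_gaussKer 1).measurable
    fun_prop
  simp_rw [gaussEnergy_restrict_volume (ha _) μ hU.measurableSet]
  calc gaussMass F * μ U
      = ∫⁻ x, (∫⁻ w, U.indicator 1 x * ENNReal.ofReal (gaussKer 1 w)) ∂μ := by
        have h1 : ∀ x, ∫⁻ w : F, U.indicator (1 : F → ℝ≥0∞) x * ENNReal.ofReal (gaussKer 1 w) =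
            U.indicator (fun _ => gaussMass F) x := fun x => by
          by_cases hx : x ∈ U <;> simp [hx, gaussMass]
        rw [lintegral_congr h1, lintegral_indicator_const hU.measurableSet]
    -- The indicator of an open set is lower semicontinuous; the remaining inequalities are Fatou's
    -- lemma, applied in `w` and then in `x`.
    _ ≤ ∫⁻ x, (∫⁻ w, Filter.liminf (fun k => U.indicator (1 : F → ℝ≥0∞) (x + √(a k) • w) *
          ENNReal.ofReal (gaussKer 1 w)) Filter.atTop) ∂μ := by
        refine lintegral_mono fun x => lintegral_mono fun w => ?_
        by_cases hx : x ∈ U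
        · have ht : Filter.Tendsto (fun k => x + √(a k) • w) Filter.atTop (𝓝 x) := by
            have := (((Real.continuous_sqrt.tendsto 0).comp ha0).smul_const w).const_add x
            simpa using this
          refine Filter.le_liminf_of_le (by isBoundedDefault)
            ((ht.eventually (hU.mem_nhds hx)).mono fun k hk => ?_)
          rw [Set.indicator_of_mem hx, Set.indicator_of_mem hk]
          exact le_rfl
        · simp [hx]
    _ ≤ ∫⁻ x, Filter.liminf (fun k => ∫⁻ w, U.indicator (1 : F → ℝ≥0∞) (x + √(a k) • w) *
          ENNReal.ofReal (gaussKer 1 w)) Filter.atTop ∂μ :=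
        lintegral_mono fun x => lintegral_liminf_le fun k => (hm k).comp measurable_prodMk_left
    _ ≤ _ := lintegral_liminf_le fun k => (hm k).lintegral_prod_right'

/-- Plancherel's inequality for the indicator function of a set. -/
theorem fourierEnergy_restrict_volume_le {U : Set F} (hU : MeasurableSet U) (hfin : volume U ≠ ∞) :
    fourierEnergy (Module.finrank ℝ F) (volume.restrict U) ≤ gaussMass F * volume U := by
  have : IsFiniteMeasure (volume.restrict U) := ⟨by simpa using hfin.lt_top⟩
  set ν : Measure F := volume.restrict U
  have hle : ∀ k, gaussEnergy (scale k) ν ν ≤ gaussMass F * volume U := fun k => by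
    rw [gaussEnergy_restrict_volume (scale_pos k) ν hU]
    calc _ ≤ ∫⁻ _x, gaussMass F ∂ν := by
          refine lintegral_mono fun x => lintegral_mono fun w => ?_
          refine mul_le_of_le_one_left' (Set.indicator_le_self' (fun _ _ => zero_le) _)
      _ = _ := by simp [ν]
  calc fourierEnergy (Module.finrank ℝ F) ν
      = ∫⁻ ξ : F, Filter.liminf (fun k => ENNReal.ofReal (Real.exp (-scale k * ‖ξ‖ ^ 2)) *
          ‖charFun ν ξ‖ₑ ^ 2) Filter.atTop := by
        refine lintegral_congr fun ξ => ?_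
        rw [sub_self, ENNReal.rpow_zero, mul_one]
        refine (Filter.Tendsto.liminf_eq ?_).symm
        have h1 : Filter.Tendsto (fun k => ENNReal.ofReal (Real.exp (-scale k * ‖ξ‖ ^ 2)))
            Filter.atTop (𝓝 1) := by
          have h2 : Continuous fun b : ℝ => ENNReal.ofReal (Real.exp (-b * ‖ξ‖ ^ 2)) :=
            ENNReal.continuous_ofReal.comp (by fun_prop)
          simpa [Function.comp_def] using (h2.tendsto 0).comp tendsto_scale
        simpa using ENNReal.Tendsto.mul_const h1 (Or.inl one_ne_zero)
    _ ≤ Filter.liminf (fun k => gaussEnergy (scale k) ν ν) Filter.atTop := by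
        simp_rw [gaussEnergy_self (scale_pos _)]
        refine lintegral_liminf_le fun k => ?_
        have := (measurable_charFun (μ := ν))
        fun_prop
    _ ≤ _ := Filter.liminf_le_of_le (by isBoundedDefault) fun b hb =>
        let ⟨k, hk⟩ := hb.exists
        hk.trans (hle k)

/-- A measure whose Fourier transform is square integrable is absolutely continuous. -/
theorem absolutelyContinuous_of_fourierEnergy [Nontrivial F] {μ : Measure F} [IsFiniteMeasure μ]
    (h : fourierEnergy (Module.finrank ℝ F) μ ≠ ∞) : μ ≪ volume := by
  intro S hS
  refine (mul_eq_zero.1 (le_antisymm (ENNReal.le_of_forall_pos_le_add fun ε hε _ => ?_)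
    zero_le : gaussMass F * μ S = 0)).resolve_left gaussMass_ne_zero
  have hε2 : (ε : ℝ≥0∞) / 2 ≠ 0 := by simpa using hε.ne'
  -- The order of choice matters: `c` makes the energy of μ negligible, and then an open set
  -- containing `S` is taken so small that its volume beats the factor 1/c.
  obtain ⟨c, hc, hcJ⟩ := ENNReal.exists_nnreal_pos_mul_lt h hε2
  have hc0 : (c : ℝ≥0∞) ≠ 0 := by simpa using hc.ne'
  obtain ⟨θ, hθ, hθJ⟩ := ENNReal.exists_nnreal_pos_mul_lt
    (ENNReal.mul_ne_top (ENNReal.inv_ne_top.2 hc0) (gaussMass_ne_top (F := F))) hε2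
  obtain ⟨U, hSU, hU, hUθ⟩ := S.exists_isOpen_lt_of_lt (μ := volume) θ
    (by rw [hS]; exact_mod_cast hθ)
  have hUfin : volume U ≠ ∞ := ne_top_of_lt hUθ
  have : IsFiniteMeasure (volume.restrict U) := ⟨by simpa using hUfin.lt_top⟩
  rw [zero_add]
  calc gaussMass F * μ S ≤ gaussMass F * μ U := by gcongr
    _ ≤ Filter.liminf (fun k => gaussEnergy (scale k) μ (volume.restrict U)) Filter.atTop :=
        gaussMass_mul_le_liminf μ hU scale_pos tendsto_scale
    _ ≤ c * fourierEnergy (Module.finrank ℝ F) μ +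
          (c : ℝ≥0∞)⁻¹ * fourierEnergy (Module.finrank ℝ F) (volume.restrict U) :=
        Filter.liminf_le_of_le (by isBoundedDefault) fun b hb =>
          let ⟨k, hk⟩ := hb.exists
          hk.trans ((gaussEnergy_le (scale_pos k) _ _).trans
            (lintegral_charFun_mul_le (by ring) hc0 ENNReal.coe_ne_top _ _))
    _ ≤ ε / 2 + ε / 2 := by
        refine add_le_add hcJ.le (le_trans ?_ hθJ.le)
        calc _ ≤ (c : ℝ≥0∞)⁻¹ * (gaussMass F * θ) := by
              gcongr
              exact (fourierEnergy_restrict_volume_le hU.measurableSet hUfin).trans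
                (by gcongr)
          _ = _ := by ring
    _ = ε := ENNReal.add_halves _

end Smoothing

/-! ### Vanishing of the mutual Gaussian energy -/

section Vanishing

theorem energy_restrict_le {X : Type*} [PseudoEMetricSpace X] [MeasurableSpace X] (p : ℝ)
    (ν : Measure X) (S : Set X) :
    energy p (ν.restrict S) ≤ ∫⁻ x in S, ∫⁻ y, edist x y ^ (-p) ∂ν ∂ν :=
  lintegral_mono fun _ => lintegral_mono' Measure.restrict_le_self le_rfl

variable {F : Type*} [NormedAddCommGroup F] [InnerProductSpace ℝ F] [FiniteDimensional ℝ F]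
  [MeasurableSpace F] [BorelSpace F]

theorem gaussEnergy_add_right (a : ℝ) (μ ν ν' : Measure F) [SFinite μ] [SFinite ν] [SFinite ν'] :
    gaussEnergy a μ (ν + ν') = gaussEnergy a μ ν + gaussEnergy a μ ν' := by
  rw [gaussEnergy_eq_lintegral_dirac, lintegral_add_measure, ← gaussEnergy_eq_lintegral_dirac,
    ← gaussEnergy_eq_lintegral_dirac]

/-- If `ν` does not charge a compact set that carries `μ`, and the energies allow it, then the
mutual Gaussian energy of `μ` and `ν` vanishes in the limit. -/
theorem tendsto_gaussEnergy_of_energy [Nontrivial F] {μ ν : Measure F} [IsFiniteMeasure μ]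
    [IsFiniteMeasure ν] {s t : ℝ} (hst : s + t = 2 * Module.finrank ℝ F) (ht : 0 < t)
    (htd : t < Module.finrank ℝ F) (hμ : fourierEnergy s μ ≠ ∞) (hν : energy t ν ≠ ∞)
    {C : Set F} (hC : IsCompact C) (hCne : C.Nonempty) (hμC : μ Cᶜ = 0) (hνC : ν C = 0) :
    Filter.Tendsto (fun k => gaussEnergy (scale k) μ ν) Filter.atTop (𝓝 0) := by
  obtain ⟨A, -, hA, hAe⟩ := exists_fourierEnergy_eq (F := F) ht htd
  refine ENNReal.tendsto_nhds_zero.2 fun ε hε => ?_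
  have hε3 : ε / 3 ≠ 0 := by simpa using hε.ne'
  obtain ⟨c, hc, hcJ⟩ := ENNReal.exists_nnreal_pos_mul_lt hμ hε3
  have hc0 : (c : ℝ≥0∞) ≠ 0 := by simpa using hc.ne'
  -- Thin shells around C with C removed: they shrink to the empty set, so the integral of the
  -- potential of ν over them, which bounds the energy of the restriction, tends to 0.
  set S : ℕ → Set F := fun j => {u | u ∉ C ∧ Metric.infDist u C < 1 / ((j : ℝ) + 1)} with hS
  have hSm : ∀ j, MeasurableSet (S j) := fun j => hC.measurableSet.compl.inter
    (measurableSet_lt (Metric.continuous_infDist_pt C).measurable measurable_const)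
  have hSanti : Antitone S := fun i j hij u hu => ⟨hu.1, hu.2.trans_le (by
    gcongr)⟩
  have hSempty : ⋂ j, S j = ∅ := by
    refine Set.eq_empty_of_forall_notMem fun u hu => ?_
    rw [Set.mem_iInter] at hu
    have hpos := (hC.isClosed.notMem_iff_infDist_pos hCne).1 (hu 0).1
    obtain ⟨j, hj⟩ := exists_nat_one_div_lt hpos
    exact (hu j).2.not_gt hj
  have hνS : Filter.Tendsto (fun j => ν (S j)) Filter.atTop (𝓝 0) := by
    have := tendsto_measure_iInter_atTop (μ := ν) (fun j => (hSm j).nullMeasurableSet) hSanti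
      ⟨0, measure_ne_top _ _⟩
    rwa [hSempty, measure_empty] at this
  have hpot := tendsto_setLIntegral_zero (f := fun x => ∫⁻ y, edist x y ^ (-t) ∂ν) hν hνS
  have hpot2 : Filter.Tendsto (fun j => (c : ℝ≥0∞)⁻¹ * (A * ∫⁻ x in S j, ∫⁻ y, edist x y ^ (-t) ∂ν ∂ν))
      Filter.atTop (𝓝 0) := by
    simpa using ENNReal.Tendsto.const_mul (ENNReal.Tendsto.const_mul hpot (Or.inr hA))
      (Or.inr (ENNReal.inv_ne_top.2 hc0))
  obtain ⟨j, hj⟩ := (ENNReal.tendsto_nhds_zero.1 hpot2 (ε / 3) (pos_iff_ne_zero.2 hε3)).exists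
  set D : Set F := {u | 1 / ((j : ℝ) + 1) ≤ Metric.infDist u C} with hD
  have hDm : MeasurableSet D :=
    measurableSet_le measurable_const (Metric.continuous_infDist_pt C).measurable
  have hfar : Filter.Tendsto (fun k => gaussEnergy (scale k) μ (ν.restrict D)) Filter.atTop
      (𝓝 0) := by
    refine tendsto_gaussEnergy_of_dist (r := 1 / ((j : ℝ) + 1)) (by positivity) ?_
    have h1 : ∀ᵐ z ∂(μ.prod (ν.restrict D)), z.1 ∈ C :=
      Measure.quasiMeasurePreserving_fst.ae (p := fun x => x ∈ C) (measure_eq_zero_iff_ae_notMem.1 hμC |>.mono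
        fun x hx => Set.notMem_compl_iff.1 hx)
    have h2 : ∀ᵐ z ∂(μ.prod (ν.restrict D)), z.2 ∈ D :=
      Measure.quasiMeasurePreserving_snd.ae (p := fun x => x ∈ D) (ae_restrict_mem hDm)
    filter_upwards [h1, h2] with z hz1 hz2
    rw [dist_comm]
    exact le_trans hz2 (Metric.infDist_le_dist_of_mem hz1)
  filter_upwards [ENNReal.tendsto_nhds_zero.1 hfar (ε / 3) (pos_iff_ne_zero.2 hε3)] with k hk
  -- The shell part is handled by small energy, the far part by its positive distance from μ, and C
  -- itself is not charged by ν.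
  have hνle : ν ≤ ν.restrict (S j) + ν.restrict D := by
    refine Measure.le_iff.2 fun T hT => ?_
    rw [Measure.add_apply, Measure.restrict_apply hT, Measure.restrict_apply hT]
    calc ν T ≤ ν ((T ∩ S j) ∪ (T ∩ D) ∪ C) := by
          refine measure_mono fun u hu => ?_
          by_cases h1 : u ∈ C
          · exact Or.inr h1
          · rcases lt_or_ge (Metric.infDist u C) (1 / ((j : ℝ) + 1)) with h2 | h2
            · exact Or.inl (Or.inl ⟨hu, h1, h2⟩)
            · exact Or.inl (Or.inr ⟨hu, h2⟩)
      _ ≤ ν (T ∩ S j) + ν (T ∩ D) + ν C :=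
          (measure_union_le _ _).trans (add_le_add (measure_union_le _ _) le_rfl)
      _ = _ := by rw [hνC, add_zero]
  calc gaussEnergy (scale k) μ ν ≤ gaussEnergy (scale k) μ (ν.restrict (S j) + ν.restrict D) := by
        rw [gaussEnergy_eq_lintegral_dirac, gaussEnergy_eq_lintegral_dirac]
        exact lintegral_mono' hνle le_rfl
    _ = gaussEnergy (scale k) μ (ν.restrict (S j)) + gaussEnergy (scale k) μ (ν.restrict D) :=
        gaussEnergy_add_right _ _ _ _
    _ ≤ (ε / 3 + ε / 3) + ε / 3 := by
        refine add_le_add ?_ hk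
        refine ((gaussEnergy_le (scale_pos k) _ _).trans
          (lintegral_charFun_mul_le hst hc0 ENNReal.coe_ne_top _ _)).trans
          (add_le_add hcJ.le (le_trans ?_ hj))
        rw [hAe]
        gcongr
        exact energy_restrict_le _ _ _
    _ = ε := ENNReal.add_thirds ε

theorem lintegral_enorm_charFun_dirac_le (μ : Measure F) (u : F) :
    ∫⁻ ξ, ‖charFun μ ξ‖ₑ * ‖charFun (Measure.dirac u) ξ‖ₑ ≤ ∫⁻ ξ, ‖charFun μ ξ‖ₑ := by
  refine lintegral_mono fun ξ => mul_le_of_le_one_right' ?_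
  rw [← ofReal_norm, ← ENNReal.ofReal_one]
  exact ENNReal.ofReal_le_ofReal (norm_charFun_le_one ξ)

/-- The mollifications of a measure with integrable Fourier transform converge to a continuous
function. -/
theorem exists_continuous_tendsto_gaussEnergy_dirac {μ : Measure F} [IsFiniteMeasure μ]
    (h : Integrable (charFun μ)) : ∃ g : F → ℂ, Continuous g ∧ ∀ u,
      Filter.Tendsto (fun k => gaussEnergy (scale k) μ (Measure.dirac u)) Filter.atTop
        (𝓝 ‖g u‖ₑ) := by
  have hm : ∀ u : F, Measurable fun ξ => charFun μ ξ * (starRingEnd ℂ) (charFun (Measure.dirac u) ξ) := by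
    intro u
    have h1 := measurable_charFun (μ := μ)
    have h2 := measurable_charFun (μ := Measure.dirac u)
    exact h1.mul (Complex.continuous_conj.measurable.comp h2)
  have hb : ∀ u ξ : F, ‖charFun μ ξ * (starRingEnd ℂ) (charFun (Measure.dirac u) ξ)‖ ≤
      ‖charFun μ ξ‖ := fun u ξ => by
    rw [norm_mul, RCLike.norm_conj]
    exact mul_le_of_le_one_right (norm_nonneg _) (norm_charFun_le_one ξ)
  refine ⟨fun u => ∫ ξ, charFun μ ξ * (starRingEnd ℂ) (charFun (Measure.dirac u) ξ), ?_,
    fun u => ?_⟩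
  · refine continuous_of_dominated (fun u => (hm u).aestronglyMeasurable)
      (fun u => .of_forall (hb u)) h.norm (.of_forall fun ξ => ?_)
    simp only [charFun_dirac]
    fun_prop
  · have h1 : ∀ k, gaussEnergy (scale k) μ (Measure.dirac u) =
        ‖∫ ξ : F, (Real.exp (-scale k * ‖ξ‖ ^ 2) : ℂ) *
          (charFun μ ξ * (starRingEnd ℂ) (charFun (Measure.dirac u) ξ))‖ₑ := fun k => by
      rw [← integral_gaussKer_prod (scale_pos k), gaussEnergy_eq_ofReal (scale_pos k), ← ofReal_norm,
        Complex.norm_real, Real.norm_of_nonneg (integral_nonneg fun z => gaussKer_nonneg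
          (scale_pos k) _)]
    simp_rw [h1]
    refine (continuous_enorm.tendsto _).comp
      (tendsto_integral_of_dominated_convergence (fun ξ => ‖charFun μ ξ‖) (fun k => ?_) h.norm
        (fun k => .of_forall fun ξ => ?_) (.of_forall fun ξ => ?_))
    · refine AEStronglyMeasurable.mul (Continuous.aestronglyMeasurable ?_)
        (hm u).aestronglyMeasurable
      fun_prop
    · rw [norm_mul, Complex.norm_real, Real.norm_of_nonneg (Real.exp_nonneg _)]
      refine (mul_le_of_le_one_left (norm_nonneg _) (Real.exp_le_one_iff.2 ?_)).trans (hb u ξ)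
      rw [neg_mul]
      exact neg_nonpos.2 (mul_nonneg (scale_pos k).le (by positivity))
    · have h2 : Continuous fun b : ℝ => (Real.exp (-b * ‖ξ‖ ^ 2) : ℂ) := by fun_prop
      have h3 := (h2.tendsto 0).comp tendsto_scale
      simp only [neg_zero, zero_mul, Real.exp_zero, Complex.ofReal_one] at h3
      simpa using h3.mul_const (charFun μ ξ * (starRingEnd ℂ) (charFun (Measure.dirac u) ξ))

theorem tendsto_gaussEnergy_dirac_of_notMem {μ : Measure F} [IsFiniteMeasure μ] {C : Set F}
    (hC : IsCompact C) (hCne : C.Nonempty) (hμC : μ Cᶜ = 0) {u : F} (hu : u ∉ C) :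
    Filter.Tendsto (fun k => gaussEnergy (scale k) μ (Measure.dirac u)) Filter.atTop (𝓝 0) := by
  refine tendsto_gaussEnergy_of_dist ((hC.isClosed.notMem_iff_infDist_pos hCne).1 hu) ?_
  have h1 : ∀ᵐ z ∂(μ.prod (Measure.dirac u)), z.1 ∈ C :=
    Measure.quasiMeasurePreserving_fst.ae (p := fun x => x ∈ C) (measure_eq_zero_iff_ae_notMem.1 hμC |>.mono
        fun x hx => Set.notMem_compl_iff.1 hx)
  have h2 : ∀ᵐ z ∂(μ.prod (Measure.dirac u)), z.2 = u :=
    Measure.quasiMeasurePreserving_snd.ae (p := fun x => x = u) (by simp [ae_dirac_eq])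
  filter_upwards [h1, h2] with z hz1 hz2
  rw [dist_comm, hz2]
  exact Metric.infDist_le_dist_of_mem hz1

/-- Measures with integrable Fourier transforms, carried by compact sets whose intersection has
empty interior, have vanishing mutual Gaussian energy in the limit. -/
theorem tendsto_gaussEnergy_of_integrable_charFun {μ ν : Measure F} [IsFiniteMeasure μ]
    [IsFiniteMeasure ν] (hμ : Integrable (charFun μ)) (hν : Integrable (charFun ν))
    {C D : Set F} (hC : IsCompact C) (hCne : C.Nonempty) (hμC : μ Cᶜ = 0) (hD : IsCompact D)
    (hDne : D.Nonempty) (hνD : ν Dᶜ = 0) (hCD : interior (C ∩ D) = ∅) :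
    Filter.Tendsto (fun k => gaussEnergy (scale k) μ ν) Filter.atTop (𝓝 0) := by
  obtain ⟨f, hf, hfl⟩ := exists_continuous_tendsto_gaussEnergy_dirac hμ
  obtain ⟨g, hg, hgl⟩ := exists_continuous_tendsto_gaussEnergy_dirac hν
  have hfC : ∀ u, f u ≠ 0 → u ∈ C := fun u hu => by
    by_contra hcon
    refine hu (enorm_eq_zero.1 (tendsto_nhds_unique (hfl u) ?_))
    exact tendsto_gaussEnergy_dirac_of_notMem hC hCne hμC hcon
  have hgD : ∀ u, g u ≠ 0 → u ∈ D := fun u hu => by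
    by_contra hcon
    refine hu (enorm_eq_zero.1 (tendsto_nhds_unique (hgl u) ?_))
    exact tendsto_gaussEnergy_dirac_of_notMem hD hDne hνD hcon
  set U : Set F := {u | f u ≠ 0} with hUdef
  have hU : IsOpen U := isOpen_ne_fun hf continuous_const
  -- The limit functions vanish off C and D. A common point of their nonvanishing sets would be
  -- interior to the intersection of C and D.
  have hgU : ∀ u ∈ U, g u = 0 := fun u hu => by
    by_contra hcon
    have h1 : U ∩ {u | g u ≠ 0} ⊆ interior (C ∩ D) :=
      interior_maximal (fun v hv => ⟨hfC v hv.1, hgD v hv.2⟩)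
        (hU.inter (isOpen_ne_fun hg continuous_const))
    rw [hCD] at h1
    exact h1 ⟨hu, hcon⟩
  have hUfin : volume U ≠ ∞ := ne_top_of_le_ne_top hC.measure_lt_top.ne (measure_mono hfC)
  have hmeas : ∀ (k : ℕ) (μ : Measure F) [IsFiniteMeasure μ],
      Measurable fun u => gaussEnergy (scale k) μ (Measure.dirac u) := fun k μ _ => by
    simp_rw [gaussEnergy_dirac]
    exact (measurable_gaussKer_sub (scale k)).lintegral_prod_left'
  have hbound : ∀ (k : ℕ) (μ : Measure F) [IsFiniteMeasure μ] (u : F),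
      gaussEnergy (scale k) μ (Measure.dirac u) ≤ ∫⁻ ξ, ‖charFun μ ξ‖ₑ := fun k μ _ u =>
    (gaussEnergy_le (scale_pos k) _ _).trans (lintegral_enorm_charFun_dirac_le μ u)
  -- On U the mollifications of ν tend to 0 boundedly, so ν gives no mass to U, and U is where the
  -- limit `f` of the mollifications of μ lives.
  have hνU : ν U = 0 := by
    refine (mul_eq_zero.1 (le_antisymm ((gaussMass_mul_le_liminf ν hU scale_pos
      tendsto_scale).trans ?_) zero_le)).resolve_left gaussMass_ne_zero
    have h1 : Filter.Tendsto (fun k => gaussEnergy (scale k) ν (volume.restrict U)) Filter.atTop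
        (𝓝 (∫⁻ u in U, 0)) := by
      simp_rw [gaussEnergy_eq_lintegral_dirac (scale _) ν (volume.restrict U)]
      refine tendsto_lintegral_of_dominated_convergence (fun _ => ∫⁻ ξ, ‖charFun ν ξ‖ₑ)
        (fun k => hmeas k ν) (fun k => .of_forall (hbound k ν)) ?_
        ((ae_restrict_iff' hU.measurableSet).2 (.of_forall fun u hu => ?_))
      · rw [setLIntegral_const]
        exact ENNReal.mul_ne_top hν.2.ne hUfin
      · simpa [hgU u hu] using hgl u
    rw [h1.liminf_eq, lintegral_zero]
  have h2 : Filter.Tendsto (fun k => gaussEnergy (scale k) μ ν) Filter.atTop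
      (𝓝 (∫⁻ u, ‖f u‖ₑ ∂ν)) := by
    simp_rw [gaussEnergy_eq_lintegral_dirac (scale _) μ ν]
    refine tendsto_lintegral_of_dominated_convergence (fun _ => ∫⁻ ξ, ‖charFun μ ξ‖ₑ)
      (fun k => hmeas k μ) (fun k => .of_forall (hbound k μ)) ?_ (.of_forall hfl)
    rw [lintegral_const]
    exact ENNReal.mul_ne_top hμ.2.ne (measure_ne_top _ _)
  have h3 : ∫⁻ u, ‖f u‖ₑ ∂ν = 0 := by
    rw [lintegral_eq_zero_iff hf.enorm.measurable]
    have h4 : ∀ᵐ u ∂ν, u ∉ U := by rw [ae_iff]; simpa using hνU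
    filter_upwards [h4] with u hu
    simpa [hUdef] using hu
  rwa [h3] at h2

/-- A set that is charged by a measure of finite `t`-energy has dimension at least `t`. -/
theorem le_dimH_of_energy {ν : Measure F} [IsFiniteMeasure ν] {t : ℝ} (ht : 0 < t)
    (hν : energy t ν ≠ ∞) {S : Set F} (hS : MeasurableSet S) (hpos : ν S ≠ 0) :
    ENNReal.ofReal t ≤ dimH S := by
  set ψ : F → ℝ≥0∞ := fun x => ∫⁻ y, edist x y ^ (-t) ∂ν with hψ
  have hψm : Measurable ψ := by
    have : Measurable fun z : F × F => edist z.1 z.2 ^ (-t) := by fun_prop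
    exact this.lintegral_prod_right'
  -- Finite energy makes the potential finite almost everywhere, so part of `S` with positive mass
  -- has bounded potential; there the mass distribution principle applies.
  obtain ⟨N, hN⟩ : ∃ N : ℕ, ν (S ∩ {x | ψ x ≤ N}) ≠ 0 := by
    by_contra! hcon
    refine hpos (measure_mono_null (t := (⋃ N : ℕ, S ∩ {x | ψ x ≤ N}) ∪ {x | ¬ ψ x < ∞}) ?_ ?_)
    · intro x hx
      by_cases h : ψ x < ∞
      · obtain ⟨N, hN⟩ := ENNReal.exists_nat_gt h.ne
        exact Or.inl (Set.mem_iUnion.2 ⟨N, hx, hN.le⟩)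
      · exact Or.inr h
    · refine measure_union_null (measure_iUnion_null hcon) ?_
      exact ae_iff.1 (ae_lt_top hψm hν)
  set T := S ∩ {x | ψ x ≤ N} with hT
  have hTm : MeasurableSet T := hS.inter (measurableSet_le hψm measurable_const)
  have hle : ((N : ℝ≥0∞) + 1)⁻¹ • ν.restrict T ≤ μH[t] := by
    refine Measure.le_hausdorffMeasure t _ 1 one_pos fun s hs => ?_
    rw [Measure.smul_apply, smul_eq_mul, Measure.restrict_apply' hTm]
    rcases (s ∩ T).eq_empty_or_nonempty with he | ⟨x, hxs, hxT⟩
    · simp [he]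
    have hN0 : (N : ℝ≥0∞) + 1 ≠ 0 := by simp
    have hN1 : (N : ℝ≥0∞) + 1 ≠ ∞ := by finiteness
    have hd1 : Metric.ediam s ^ t ≠ ∞ :=
      ENNReal.rpow_ne_top_of_nonneg ht.le (ne_top_of_le_ne_top ENNReal.one_ne_top hs)
    rw [mul_comm, ← div_eq_mul_inv, ENNReal.div_le_iff_le_mul (Or.inl hN0) (Or.inl hN1),
      mul_comm, ← ENNReal.div_le_iff_le_mul (Or.inr hN1) (Or.inl hd1), div_eq_mul_inv,
      ← ENNReal.rpow_neg]
    calc ν (s ∩ T) * Metric.ediam s ^ (-t) ≤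
          ν (Metric.closedEBall x (Metric.ediam s)) * Metric.ediam s ^ (-t) := by
          gcongr
          exact fun y hy => Metric.edist_le_ediam_of_mem hy.1 hxs
      _ = ∫⁻ y in Metric.closedEBall x (Metric.ediam s), Metric.ediam s ^ (-t) ∂ν := by
          rw [setLIntegral_const, mul_comm]
      _ ≤ ∫⁻ y in Metric.closedEBall x (Metric.ediam s), edist x y ^ (-t) ∂ν := by
          refine setLIntegral_mono (by fun_prop) fun y hy => ?_
          rw [ENNReal.rpow_neg, ENNReal.rpow_neg]
          gcongr
          rw [edist_comm]
          exact hy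
      _ ≤ ψ x := setLIntegral_le_lintegral _ _
      _ ≤ N := hxT.2
      _ ≤ _ := le_self_add
  have hne : μH[t] T ≠ 0 := by
    have h1 := hle T
    rw [Measure.smul_apply, Measure.restrict_apply_self, smul_eq_mul] at h1
    exact (lt_of_lt_of_le (ENNReal.mul_pos (ENNReal.inv_ne_zero.2 (by finiteness)) hN) h1).ne'
  have h2 := le_dimH_of_hausdorffMeasure_ne_zero (d := t.toNNReal)
    (by rwa [Real.coe_toNNReal t ht.le])
  exact le_trans h2 (dimH_mono Set.inter_subset_left)

end Vanishing

/-! ### Gaussian random linear maps -/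

section RandomMap

/-- The space of `m`-tuples of vectors of `ℝⁿ`, that is, of linear maps from `ℝⁿ` to `ℝᵐ`. -/
abbrev Tuples (n m : ℕ) : Type := PiLp 2 fun _ : Fin m => E n

variable {n m : ℕ}

/-- The linear map with the given rows. -/
noncomputable def lin (ω : Tuples n m) : E n →L[ℝ] E m :=
  LinearMap.toContinuousLinearMap
    { toFun := fun x => WithLp.toLp 2 fun i => inner ℝ (ω i) x
      map_add' := fun x y => by ext i; simp [inner_add_right]
      map_smul' := fun c x => by ext i; simp [inner_smul_right] }

theorem lin_apply (ω : Tuples n m) (x : E n) (i : Fin m) : lin ω x i = inner ℝ (ω i) x := rfl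

theorem continuous_lin_apply : Continuous fun z : Tuples n m × E n => lin z.1 z.2 := by
  refine (PiLp.continuous_toLp 2 _).comp (continuous_pi fun i => ?_)
  fun_prop

/-- For fixed x and ξ the pairing is linear in ω, so its mean exponential is a value of the
characteristic function of the standard Gaussian. -/
theorem inner_lin (ω : Tuples n m) (x : E n) (ξ : E m) :
    inner ℝ (lin ω x) ξ = inner ℝ ω (WithLp.toLp 2 fun i => ξ i • x : Tuples n m) := by
  simp only [PiLp.inner_apply, lin_apply, inner_smul_right]
  refine Finset.sum_congr rfl fun i _ => ?_
  simp

theorem norm_toLp_smul_sq (x : E n) (ξ : E m) :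
    ‖(WithLp.toLp 2 fun i => ξ i • x : Tuples n m)‖ ^ 2 = ‖ξ‖ ^ 2 * ‖x‖ ^ 2 := by
  rw [PiLp.norm_sq_eq_of_L2, EuclideanSpace.norm_sq_eq, Finset.sum_mul]
  simp [norm_smul, mul_pow]

/-- The law of the Gaussian random linear map. -/
noncomputable abbrev gaussLaw (n m : ℕ) : Measure (Tuples n m) :=
  ProbabilityTheory.stdGaussian (Tuples n m)

theorem integral_cexp_inner_lin (x : E n) (ξ : E m) :
    ∫ ω, Complex.exp (Complex.I * inner ℝ (lin ω x) ξ) ∂(gaussLaw n m) =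
      (Real.exp (-(‖ξ‖ ^ 2 * ‖x‖ ^ 2 / 2)) : ℂ) := by
  have h := ProbabilityTheory.charFun_stdGaussian (WithLp.toLp 2 fun i => ξ i • x : Tuples n m)
  rw [charFun_apply] at h
  simp_rw [← inner_lin] at h
  rw [← Complex.ofReal_pow, norm_toLp_smul_sq] at h
  simp_rw [mul_comm Complex.I]
  rw [h]
  push_cast
  congr 1
  ring

theorem integral_cexp_lin_prod (μ : Measure (E n)) [IsFiniteMeasure μ] (ω : Tuples n m) (ξ : E m) :
    ((‖charFun (μ.map (lin ω)) ξ‖ ^ 2 : ℝ) : ℂ) =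
      ∫ z, Complex.exp (Complex.I * inner ℝ (lin ω (z.1 - z.2)) ξ) ∂(μ.prod μ) := by
  have h1 : ∀ ξ, charFun (μ.map (lin ω)) ξ = ∫ x, Complex.exp (inner ℝ (lin ω x) ξ * Complex.I) ∂μ :=
    fun ξ => by
      rw [charFun_apply, integral_map (lin ω).continuous.aemeasurable]
      exact Continuous.aestronglyMeasurable (by fun_prop)
  rw [← Complex.normSq_eq_norm_sq, ← Complex.mul_conj, ← charFun_neg, h1, h1, ← integral_prod_mul]
  refine integral_congr_ae (.of_forall fun z => ?_)
  simp only
  rw [← Complex.exp_add]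
  congr 1
  simp only [map_sub, inner_sub_left, inner_neg_right]
  push_cast
  ring

theorem measurable_charFun_lin (μ : Measure (E n)) [IsFiniteMeasure μ] :
    Measurable fun z : Tuples n m × E m => charFun (μ.map (lin z.1)) z.2 := by
  have h1 : ∀ z : Tuples n m × E m, charFun (μ.map (lin z.1)) z.2 =
      ∫ x, Complex.exp (inner ℝ (lin z.1 x) z.2 * Complex.I) ∂μ := fun z => by
    rw [charFun_apply, integral_map (lin z.1).continuous.aemeasurable]
    exact Continuous.aestronglyMeasurable (by fun_prop)
  simp_rw [h1]
  refine StronglyMeasurable.measurable (StronglyMeasurable.integral_prod_right'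
    (f := fun y : (Tuples n m × E m) × E n =>
      Complex.exp (inner ℝ (lin y.1.1 y.2) y.1.2 * Complex.I)) (Continuous.stronglyMeasurable ?_))
  have h2 : Continuous fun y : (Tuples n m × E m) × E n => lin y.1.1 y.2 :=
    continuous_lin_apply.comp ((continuous_fst.comp continuous_fst).prodMk continuous_snd)
  fun_prop

theorem measurable_charFun_lin_left (μ : Measure (E n)) [IsFiniteMeasure μ] (ξ : E m) :
    Measurable fun ω : Tuples n m => charFun (μ.map (lin ω)) ξ :=
  (measurable_charFun_lin μ).of_uncurry_right (y := ξ)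

theorem integrable_cexp_lin (ρ : Measure (Tuples n m × (E n × E n))) [IsFiniteMeasure ρ]
    (ξ : E m) : Integrable (Function.uncurry fun (ω : Tuples n m) (z : E n × E n) =>
      Complex.exp (Complex.I * inner ℝ (lin ω (z.1 - z.2)) ξ)) ρ := by
  have h1 : Continuous fun y : Tuples n m × (E n × E n) => (y.1, y.2.1 - y.2.2) := by fun_prop
  have h2 : Continuous fun y : Tuples n m × (E n × E n) => lin y.1 (y.2.1 - y.2.2) :=
    continuous_lin_apply.comp h1
  have h3 : Continuous (Function.uncurry fun (ω : Tuples n m) (z : E n × E n) =>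
      Complex.exp (Complex.I * inner ℝ (lin ω (z.1 - z.2)) ξ)) := by
    simp only [Function.uncurry_def]
    fun_prop
  refine Integrable.of_bound h3.aestronglyMeasurable 1 (.of_forall fun z => ?_)
  simp [Function.uncurry_def, Complex.norm_exp]

theorem lintegral_charFun_lin (μ : Measure (E n)) [IsFiniteMeasure μ] (ξ : E m) :
    ∫⁻ ω, ‖charFun (μ.map (lin ω)) ξ‖ₑ ^ 2 ∂(gaussLaw n m) =
      ∫⁻ z, ENNReal.ofReal (Real.exp (-(‖ξ‖ ^ 2 * ‖z.1 - z.2‖ ^ 2 / 2))) ∂(μ.prod μ) := by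
  have hm := measurable_charFun_lin_left (m := m) μ ξ
  have h1 : ((∫ ω, ‖charFun (μ.map (lin ω)) ξ‖ ^ 2 ∂(gaussLaw n m) : ℝ) : ℂ) =
      ((∫ z, Real.exp (-(‖ξ‖ ^ 2 * ‖z.1 - z.2‖ ^ 2 / 2)) ∂(μ.prod μ) : ℝ) : ℂ) := by
    rw [← integral_complex_ofReal, ← integral_complex_ofReal]
    simp_rw [integral_cexp_lin_prod]
    rw [integral_integral_swap]
    · simp_rw [integral_cexp_inner_lin]
    · exact integrable_cexp_lin _ ξ
  rw [Complex.ofReal_inj] at h1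
  have hb : ∀ ω : Tuples n m, ‖charFun (μ.map (lin ω)) ξ‖ ≤ μ.real Set.univ := fun ω => by
    refine (norm_charFun_le ξ).trans_eq ?_
    rw [measureReal_def, Measure.map_apply (lin ω).continuous.measurable .univ, Set.preimage_univ,
      measureReal_def]
  rw [← ofReal_integral_eq_lintegral_ofReal, ← h1, ofReal_integral_eq_lintegral_ofReal]
  · refine lintegral_congr fun ω => ?_
    rw [ENNReal.ofReal_pow (norm_nonneg _), ofReal_norm]
  · refine Integrable.of_bound (hm.norm.pow_const 2).aestronglyMeasurable (μ.real Set.univ ^ 2)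
      (.of_forall fun ω => ?_)
    rw [Real.norm_of_nonneg (by positivity)]
    exact pow_le_pow_left₀ (norm_nonneg _) (hb ω) 2
  · exact .of_forall fun ω => by positivity
  · refine Integrable.of_bound (Continuous.aestronglyMeasurable (by fun_prop)) 1
      (.of_forall fun z => ?_)
    rw [Real.norm_of_nonneg (Real.exp_nonneg _), Real.exp_le_one_iff]
    exact neg_nonpos.2 (by positivity)
  · exact .of_forall fun z => Real.exp_nonneg _

-- Gaussian averages that produce the Riesz kernel

section RieszGauss

variable {F : Type*} [NormedAddCommGroup F] [InnerProductSpace ℝ F] [FiniteDimensional ℝ F]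
  [MeasurableSpace F] [BorelSpace F]

theorem lintegral_exp_mul_rpow_ne_top [Nontrivial F] {p : ℝ} (hp : 0 < p) :
    ∫⁻ ξ : F, ENNReal.ofReal (Real.exp (-(‖ξ‖ ^ 2 / 2))) * ‖ξ‖ₑ ^ (p - Module.finrank ℝ F) ≠ ∞ := by
  have h1 : Integrable fun ξ : F =>
      Real.exp (-(‖ξ‖ ^ 2 / 2)) * ‖ξ‖ ^ (p - Module.finrank ℝ F) := by
    refine (integrable_fun_norm_addHaar volume
      (f := fun y : ℝ => Real.exp (-(y ^ 2 / 2)) * y ^ (p - Module.finrank ℝ F))).2 ?_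
    refine (integrableOn_rpow_mul_exp_neg_mul_sq (b := 1 / 2) (by norm_num)
      (s := p - 1) (by linarith)).congr_fun (fun y (hy : 0 < y) => ?_) measurableSet_Ioi
    have hd : 1 ≤ Module.finrank ℝ F := Module.finrank_pos
    simp only [smul_eq_mul]
    rw [← Real.rpow_natCast y (_ - 1), Nat.cast_sub hd, mul_left_comm, ← Real.rpow_add hy, mul_comm]
    congr 2 <;> (push_cast; ring)
  have h2 := h1.lintegral_lt_top.ne
  refine ne_of_eq_of_ne (lintegral_congr_ae (ae_ne_zero_volume.mono fun ξ hξ => ?_)) h2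
  simp only
  rw [ENNReal.ofReal_mul (Real.exp_nonneg _), ← ENNReal.ofReal_rpow_of_pos (norm_pos_iff.2 hξ),
    ofReal_norm]

/-- Scaling alone produces the Riesz kernel. No upper bound on `p` by the dimension of the target is
needed, which allows exponents above 2m for images in ℝᵐ. -/
theorem lintegral_exp_mul_rpow [Nontrivial F] (p : ℝ) {r : ℝ} (hr : 0 < r) :
    ∫⁻ ξ : F, ENNReal.ofReal (Real.exp (-(‖ξ‖ ^ 2 * r ^ 2 / 2))) *
      ‖ξ‖ₑ ^ (p - Module.finrank ℝ F) = ENNReal.ofReal r ^ (-p) *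
        ∫⁻ ξ : F, ENNReal.ofReal (Real.exp (-(‖ξ‖ ^ 2 / 2))) *
          ‖ξ‖ₑ ^ (p - Module.finrank ℝ F) := by
  set d : ℝ := (Module.finrank ℝ F : ℝ) with hd
  rw [← lintegral_comp_smul_addHaar hr (g := fun ξ : F =>
    ENNReal.ofReal (Real.exp (-(‖ξ‖ ^ 2 / 2))) * ‖ξ‖ₑ ^ (p - d)) (by fun_prop), ← mul_assoc]
  have hr0 : ENNReal.ofReal r ≠ 0 := by simpa using hr
  rw [← lintegral_const_mul' _ _ (ENNReal.mul_ne_top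
    (ENNReal.rpow_ne_top_of_ne_zero hr0 ENNReal.ofReal_ne_top) ENNReal.ofReal_ne_top)]
  refine lintegral_congr_ae (ae_ne_zero_volume.mono fun ξ hξ => ?_)
  have hξ0 : (‖ξ‖ₑ : ℝ≥0∞) ≠ 0 := by simpa using hξ
  have h1 : ‖r • ξ‖ₑ = ENNReal.ofReal r * ‖ξ‖ₑ := by
    rw [enorm_smul, Real.enorm_eq_ofReal hr.le]
  have h2 : ENNReal.ofReal (r ^ Module.finrank ℝ F) = ENNReal.ofReal r ^ d := by
    rw [ENNReal.ofReal_pow hr.le, hd, ENNReal.rpow_natCast]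
  simp only
  rw [h1, h2, ENNReal.mul_rpow_of_ne_top ENNReal.ofReal_ne_top enorm_ne_top, norm_smul, mul_pow,
    Real.norm_of_nonneg hr.le, ← ENNReal.rpow_add _ _ hr0 ENNReal.ofReal_ne_top]
  have h3 : ENNReal.ofReal r ^ (-p + d) * ENNReal.ofReal r ^ (p - d) = 1 := by
    rw [← ENNReal.rpow_add _ _ hr0 ENNReal.ofReal_ne_top]
    simp
  calc _ = 1 * (ENNReal.ofReal (Real.exp (-(r ^ 2 * ‖ξ‖ ^ 2 / 2))) * ‖ξ‖ₑ ^ (p - d)) := by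
        rw [one_mul, mul_comm (r ^ 2)]
    _ = _ := by rw [← h3]; ring

end RieszGauss

theorem measurable_fourierEnergy_lin (p : ℝ) (μ : Measure (E n)) [IsFiniteMeasure μ] :
    Measurable fun ω : Tuples n m => fourierEnergy p (μ.map (lin ω)) := by
  have := measurable_charFun_lin (m := m) μ
  refine Measurable.lintegral_prod_right' (f := fun z : Tuples n m × E m =>
    ‖charFun (μ.map (lin z.1)) z.2‖ₑ ^ 2 * ‖z.2‖ₑ ^ (p - Module.finrank ℝ (E m))) ?_
  fun_prop

/-- The Fourier energies of the random images of a measure of finite energy have finite mean. -/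
theorem lintegral_fourierEnergy_lin_ne_top [NeZero m] {p : ℝ} (hp : 0 < p) {μ : Measure (E n)}
    [IsFiniteMeasure μ] (hμ : energy p μ ≠ ∞) :
    ∫⁻ ω, fourierEnergy p (μ.map (lin ω)) ∂(gaussLaw n m) ≠ ∞ := by
  have hmc := measurable_charFun_lin (m := m) μ
  set d : ℝ := (Module.finrank ℝ (E m) : ℝ) with hd
  have hm1 : Measurable fun z : Tuples n m × E m =>
      ‖charFun (μ.map (lin z.1)) z.2‖ₑ ^ 2 * ‖z.2‖ₑ ^ (p - d) := by fun_prop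
  have hm2 : Measurable fun z : E m × (E n × E n) =>
      ENNReal.ofReal (Real.exp (-(‖z.1‖ ^ 2 * ‖z.2.1 - z.2.2‖ ^ 2 / 2))) * ‖z.1‖ₑ ^ (p - d) := by
    fun_prop
  set A := ∫⁻ ξ : E m, ENNReal.ofReal (Real.exp (-(‖ξ‖ ^ 2 / 2))) * ‖ξ‖ₑ ^ (p - d) with hA
  have hAtop : A ≠ ∞ := lintegral_exp_mul_rpow_ne_top hp
  rw [energy_eq_lintegral_prod] at hμ
  -- Finite energy keeps the product measure off the diagonal, where the scaling formula fails.
  have hae : ∀ᵐ z ∂(μ.prod μ), 0 < ‖z.1 - z.2‖ := by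
    filter_upwards [ae_lt_top (by fun_prop) hμ] with z hz
    refine norm_pos_iff.2 fun h0 => hz.ne ?_
    rw [h0, enorm_zero, ENNReal.zero_rpow_of_neg (by linarith)]
  have h1 : ∫⁻ ω, fourierEnergy p (μ.map (lin ω)) ∂(gaussLaw n m) =
      ∫⁻ z, A * ‖z.1 - z.2‖ₑ ^ (-p) ∂(μ.prod μ) := by
    unfold fourierEnergy
    rw [lintegral_lintegral_swap hm1.aemeasurable]
    have h2 : ∀ ξ : E m, ∫⁻ ω, ‖charFun (μ.map (lin ω)) ξ‖ₑ ^ 2 * ‖ξ‖ₑ ^ (p - d) ∂(gaussLaw n m) =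
        ∫⁻ z, ENNReal.ofReal (Real.exp (-(‖ξ‖ ^ 2 * ‖z.1 - z.2‖ ^ 2 / 2))) * ‖ξ‖ₑ ^ (p - d)
          ∂(μ.prod μ) := fun ξ => by
      rw [lintegral_mul_const, lintegral_mul_const, lintegral_charFun_lin]
      · fun_prop
      · exact (measurable_charFun_lin_left μ ξ).enorm.pow_const 2
    rw [lintegral_congr h2, lintegral_lintegral_swap hm2.aemeasurable]
    refine lintegral_congr_ae (hae.mono fun z hz => ?_)
    simp only
    rw [lintegral_exp_mul_rpow p hz, ofReal_norm, mul_comm]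
  rw [h1, lintegral_const_mul' _ _ hAtop]
  exact ENNReal.mul_ne_top hAtop hμ

theorem ae_fourierEnergy_lin_ne_top [NeZero m] {p : ℝ} (hp : 0 < p) {μ : Measure (E n)}
    [IsFiniteMeasure μ] (hμ : energy p μ ≠ ∞) :
    ∀ᵐ ω ∂(gaussLaw n m), fourierEnergy p (μ.map (lin ω)) ≠ ∞ :=
  (ae_lt_top (measurable_fourierEnergy_lin p μ)
    (lintegral_fourierEnergy_lin_ne_top hp hμ)).mono fun _ h => h.ne

end RandomMap

-- The mean of the mutual Gaussian energy of random images

section MeanEnergy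

variable {n m : ℕ}

theorem gaussEnergy_map (a : ℝ) (L : E n →L[ℝ] E m) (μ ν : Measure (E n)) [IsFiniteMeasure μ]
    [IsFiniteMeasure ν] : gaussEnergy a (μ.map L) (ν.map L) =
      ∫⁻ z, ENNReal.ofReal (gaussKer a (L (z.1 - z.2))) ∂(μ.prod ν) := by
  have hL := L.continuous.measurable
  rw [gaussEnergy, Measure.map_prod_map _ _ hL hL,
    lintegral_map (measurable_gaussKer_sub a) (hL.prodMap hL)]
  simp

theorem integrable_cexp_lin_gauss {a : ℝ} (ha : 0 < a) (x : E n) :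
    Integrable (Function.uncurry fun (ω : Tuples n m) (ξ : E m) =>
      Complex.exp (-a * ‖ξ‖ ^ 2 + Complex.I * inner ℝ (lin ω x) ξ))
      ((gaussLaw n m).prod volume) := by
  have h1 : Continuous fun y : Tuples n m × E m => (y.1, x) := by fun_prop
  have h2 : Continuous fun y : Tuples n m × E m => lin y.1 x := continuous_lin_apply.comp h1
  have h3 : Continuous (Function.uncurry fun (ω : Tuples n m) (ξ : E m) =>
      Complex.exp (-a * ‖ξ‖ ^ 2 + Complex.I * inner ℝ (lin ω x) ξ)) := by
    simp only [Function.uncurry_def]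
    fun_prop
  refine Integrable.mono' ((integrable_exp_neg_mul_sq_norm (F := E m) ha).comp_snd (gaussLaw n m))
    h3.aestronglyMeasurable (.of_forall fun z => ?_)
  simp only [Function.uncurry_def, Complex.norm_exp]
  refine le_of_eq (congrArg Real.exp ?_)
  simp [← Complex.ofReal_pow]

/-- The vector `lin ω x` is centred Gaussian with variance ‖x‖² in each coordinate; averaging widens
the kernel by the parameter ‖x‖²/2. -/
theorem integral_gaussKer_lin {a : ℝ} (ha : 0 < a) (x : E n) :
    ∫ ω, gaussKer a (lin ω x) ∂(gaussLaw n m) = gaussKer (a + ‖x‖ ^ 2 / 2) (0 : E m) := by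
  rw [← Complex.ofReal_inj, ← integral_complex_ofReal]
  simp_rw [← integral_cexp_eq_gaussKer ha]
  rw [integral_integral_swap (integrable_cexp_lin_gauss ha x),
    ← integral_cexp_eq_gaussKer (by positivity)]
  refine integral_congr_ae (.of_forall fun ξ => ?_)
  simp only
  simp_rw [Complex.exp_add]
  rw [integral_const_mul, integral_cexp_inner_lin]
  push_cast
  rw [← Complex.exp_add, ← Complex.exp_add]
  congr 1
  simp
  ring

theorem lintegral_gaussKer_lin {a : ℝ} (ha : 0 < a) (x : E n) :
    ∫⁻ ω, ENNReal.ofReal (gaussKer a (lin ω x)) ∂(gaussLaw n m) =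
      ENNReal.ofReal (gaussKer (a + ‖x‖ ^ 2 / 2) (0 : E m)) := by
  rw [← integral_gaussKer_lin ha, ofReal_integral_eq_lintegral_ofReal]
  · refine Integrable.of_integral_ne_zero ?_
    rw [integral_gaussKer_lin ha]
    have : 0 < gaussKer (a + ‖x‖ ^ 2 / 2) (0 : E m) := by unfold gaussKer; positivity
    exact this.ne'
  · exact .of_forall fun ω => gaussKer_nonneg ha _

theorem measurable_gaussKer_lin (a : ℝ) : Measurable fun z : Tuples n m × (E n × E n) =>
    ENNReal.ofReal (gaussKer a (lin z.1 (z.2.1 - z.2.2))) := by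
  have h1 : Continuous fun y : Tuples n m × (E n × E n) => (y.1, y.2.1 - y.2.2) := by fun_prop
  have h2 : Continuous fun y : Tuples n m × (E n × E n) => lin y.1 (y.2.1 - y.2.2) :=
    continuous_lin_apply.comp h1
  exact ((continuous_gaussKer a).comp h2).measurable.ennreal_ofReal

theorem measurable_gaussEnergy_lin (a : ℝ) (μ ν : Measure (E n)) [IsFiniteMeasure μ]
    [IsFiniteMeasure ν] :
    Measurable fun ω : Tuples n m => gaussEnergy a (μ.map (lin ω)) (ν.map (lin ω)) := by
  simp_rw [gaussEnergy_map]
  exact (measurable_gaussKer_lin a).lintegral_prod_right'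

theorem lintegral_gaussEnergy_lin {a : ℝ} (ha : 0 < a) (μ ν : Measure (E n)) [IsFiniteMeasure μ]
    [IsFiniteMeasure ν] :
    ∫⁻ ω, gaussEnergy a (μ.map (lin ω)) (ν.map (lin ω)) ∂(gaussLaw n m) =
      ∫⁻ z, ENNReal.ofReal (gaussKer (a + ‖z.1 - z.2‖ ^ 2 / 2) (0 : E m)) ∂(μ.prod ν) := by
  simp_rw [gaussEnergy_map]
  rw [lintegral_lintegral_swap (measurable_gaussKer_lin a).aemeasurable]
  simp_rw [lintegral_gaussKer_lin ha]

/-- The mutual Gaussian energy of the random images of two measures does not vanish in the limit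
almost surely. -/
theorem not_ae_tendsto_gaussEnergy_lin [NeZero m] {μ ν : Measure (E n)} [IsProbabilityMeasure μ]
    [IsProbabilityMeasure ν] {K K' : Set (E n)} (hK : IsCompact K) (hμK : μ Kᶜ = 0)
    (hK' : IsCompact K') (hνK : ν K'ᶜ = 0) {s t : ℝ} (hs : 0 < s) (ht : 0 < t)
    (hst : s + t = 2 * m) (hμ : energy s μ ≠ ∞) (hν : energy t ν ≠ ∞) :
    ¬ ∀ᵐ ω ∂(gaussLaw n m), Filter.Tendsto
      (fun k => gaussEnergy (scale k) (μ.map (lin ω)) (ν.map (lin ω))) Filter.atTop (𝓝 0) := by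
  intro hcon
  have hst' : s + t = 2 * Module.finrank ℝ (E m) := by simpa using hst
  have hprob : ∀ (μ : Measure (E n)) [IsProbabilityMeasure μ] (ω : Tuples n m),
      IsProbabilityMeasure (μ.map (lin ω)) := fun μ _ ω =>
    Measure.isProbabilityMeasure_map (lin ω).continuous.aemeasurable
  have hlim : Filter.Tendsto (fun k => ∫⁻ ω, gaussEnergy (scale k) (μ.map (lin ω)) (ν.map (lin ω))
      ∂(gaussLaw n m)) Filter.atTop (𝓝 (∫⁻ _ω, 0 ∂(gaussLaw n m))) := by
    refine tendsto_lintegral_of_dominated_convergence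
      (fun ω => fourierEnergy s (μ.map (lin ω)) + fourierEnergy t (ν.map (lin ω)))
      (fun k => measurable_gaussEnergy_lin _ μ ν) (fun k => .of_forall fun ω => ?_) ?_ hcon
    · have := hprob μ ω
      have := hprob ν ω
      simpa using (gaussEnergy_le (scale_pos k) _ _).trans
        (lintegral_charFun_mul_le hst' one_ne_zero ENNReal.one_ne_top _ _)
    · rw [lintegral_add_left (measurable_fourierEnergy_lin s μ)]
      exact ENNReal.add_ne_top.2 ⟨lintegral_fourierEnergy_lin_ne_top hs hμ,
        lintegral_fourierEnergy_lin_ne_top ht hν⟩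
  rw [lintegral_zero] at hlim
  obtain ⟨R, hR⟩ := (hK.isBounded.union hK'.isBounded).exists_norm_le
  have hR0 : ∀ᵐ z ∂(μ.prod ν), ‖z.1 - z.2‖ ≤ R + R := by
    have h1 : ∀ᵐ z ∂(μ.prod ν), z.1 ∈ K := Measure.quasiMeasurePreserving_fst.ae
      (p := fun x => x ∈ K) (measure_eq_zero_iff_ae_notMem.1 hμK |>.mono
        fun x hx => Set.notMem_compl_iff.1 hx)
    have h2 : ∀ᵐ z ∂(μ.prod ν), z.2 ∈ K' := Measure.quasiMeasurePreserving_snd.ae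
      (p := fun x => x ∈ K') (measure_eq_zero_iff_ae_notMem.1 hνK |>.mono
        fun x hx => Set.notMem_compl_iff.1 hx)
    filter_upwards [h1, h2] with z hz1 hz2
    exact (norm_sub_le _ _).trans (add_le_add (hR _ (Or.inl hz1)) (hR _ (Or.inr hz2)))
  -- On the bounded supports the parameter a + ‖x - y‖²/2 is at most 1 + (2R)²/2, and the kernel at
  -- 0 decreases in it.
  have hlow : ∀ k, ENNReal.ofReal (gaussKer (1 + (R + R) ^ 2 / 2) (0 : E m)) ≤
      ∫⁻ ω, gaussEnergy (scale k) (μ.map (lin ω)) (ν.map (lin ω)) ∂(gaussLaw n m) := fun k => by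
    rw [lintegral_gaussEnergy_lin (scale_pos k)]
    calc _ = ∫⁻ _z, ENNReal.ofReal (gaussKer (1 + (R + R) ^ 2 / 2) (0 : E m)) ∂(μ.prod ν) := by
          simp
      _ ≤ _ := by
          refine lintegral_mono_ae (hR0.mono fun z hz => ENNReal.ofReal_le_ofReal ?_)
          have h1 := scale_pos k
          have h2 := scale_le_one k
          simp only [gaussKer, norm_zero, ne_eq, OfNat.ofNat_ne_zero, not_false_eq_true, zero_pow,
            neg_zero, zero_div, Real.exp_zero, mul_one]
          gcongr
  have h0 := ge_of_tendsto' hlim hlow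
  rw [nonpos_iff_eq_zero, ENNReal.ofReal_eq_zero] at h0
  have : 0 < gaussKer (1 + (R + R) ^ 2 / 2) (0 : E m) := by unfold gaussKer; positivity
  exact this.not_ge h0

/-- Young's inequality with weight (1 + ‖ξ‖)^q, q = s - d: its inverse is integrable because q > d,
and the weight is at most 2^q (1 + ‖ξ‖^q), which is covered by the energies of exponents d and s. -/
theorem integrable_charFun_of_fourierEnergy {F : Type*} [NormedAddCommGroup F]
    [InnerProductSpace ℝ F] [FiniteDimensional ℝ F] [MeasurableSpace F] [BorelSpace F]
    {μ : Measure F} [IsFiniteMeasure μ] {s : ℝ} (hs : 2 * Module.finrank ℝ F < s)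
    (h1 : fourierEnergy (Module.finrank ℝ F) μ ≠ ∞) (h2 : fourierEnergy s μ ≠ ∞) :
    Integrable (charFun μ) := by
  refine ⟨measurable_charFun.aestronglyMeasurable, ?_⟩
  set d : ℝ := (Module.finrank ℝ F : ℝ) with hd
  set q : ℝ := s - d with hq
  have hq0 : 0 < q := by rw [hq]; have : 0 ≤ d := by rw [hd]; positivity
                         linarith
  have hint : Integrable fun ξ : F => (1 + ‖ξ‖) ^ (-q) :=
    integrable_one_add_norm (by rw [hq]; linarith)
  have hm := measurable_charFun (μ := μ)
  have hle : ∀ ξ : F, ‖charFun μ ξ‖ₑ ≤ ENNReal.ofReal ((1 + ‖ξ‖) ^ (-q)) +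
      2 ^ q * (‖charFun μ ξ‖ₑ ^ 2 * ‖ξ‖ₑ ^ (d - d) + ‖charFun μ ξ‖ₑ ^ 2 * ‖ξ‖ₑ ^ (s - d)) := by
    intro ξ
    have hw : 0 < 1 + ‖ξ‖ := by positivity
    have hc0 : ENNReal.ofReal ((1 + ‖ξ‖) ^ q) ≠ 0 := by
      rw [Ne, ENNReal.ofReal_eq_zero, not_le]; positivity
    have h3 := ennreal_mul_le_add (x := ‖charFun μ ξ‖ₑ) (y := 1) hc0 ENNReal.ofReal_ne_top
    rw [mul_one, one_pow, mul_one, ← ENNReal.ofReal_inv_of_pos (by positivity),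
      ← Real.rpow_neg hw.le, add_comm] at h3
    refine h3.trans (add_le_add le_rfl ?_)
    have h4 : ENNReal.ofReal ((1 + ‖ξ‖) ^ q) ≤ 2 ^ q * (1 + ‖ξ‖ₑ ^ q) := by
      rw [← ENNReal.ofReal_rpow_of_pos hw, ENNReal.ofReal_add zero_le_one (norm_nonneg _),
        ENNReal.ofReal_one, ofReal_norm]
      rcases le_total ‖ξ‖ₑ 1 with h | h
      · calc (1 + ‖ξ‖ₑ) ^ q ≤ 2 ^ q := by
              refine ENNReal.rpow_le_rpow ?_ hq0.le
              rw [← one_add_one_eq_two]; gcongr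
          _ ≤ _ := le_mul_of_one_le_right' le_self_add
      · calc (1 + ‖ξ‖ₑ) ^ q ≤ (2 * ‖ξ‖ₑ) ^ q := by
              refine ENNReal.rpow_le_rpow ?_ hq0.le
              rw [two_mul]; gcongr
          _ = 2 ^ q * ‖ξ‖ₑ ^ q := ENNReal.mul_rpow_of_nonneg _ _ hq0.le
          _ ≤ _ := by gcongr; exact le_add_self
    rw [sub_self, ENNReal.rpow_zero, mul_one]
    calc _ ≤ 2 ^ q * (1 + ‖ξ‖ₑ ^ q) * ‖charFun μ ξ‖ₑ ^ 2 := by gcongr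
      _ = _ := by ring
  refine lt_of_le_of_lt (lintegral_mono hle) ?_
  rw [lintegral_add_left (by fun_prop), lintegral_const_mul' _ _ (by
    exact ENNReal.rpow_ne_top_of_nonneg hq0.le (by simp)), lintegral_add_left (by fun_prop)]
  exact ENNReal.add_lt_top.2 ⟨hint.lintegral_lt_top, ENNReal.mul_lt_top
    (ENNReal.rpow_lt_top_of_nonneg hq0.le (by simp)) (ENNReal.add_lt_top.2
      ⟨lt_top_iff_ne_top.2 h1, lt_top_iff_ne_top.2 h2⟩)⟩

end MeanEnergy

/-! ### From random linear maps to the Grassmannian -/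

section Grassmannian

variable {n m : ℕ}

theorem rotate_rotate (g h : OrthGroup n) (V : Grass n m) :
    rotate g (rotate h V) = rotate (g * h) V := by
  refine Subtype.ext ?_
  simp only [rotate, ← Submodule.map_comp]
  congr 1

/-- `O(n)` acts transitively on the Grassmannian. -/
theorem exists_rotate_eq (V W : Grass n m) : ∃ g : OrthGroup n, rotate g V = W := by
  have hV : Module.finrank ℝ V.1 = m := V.2
  have hW : Module.finrank ℝ W.1 = m := W.2
  let e : V.1 ≃ₗᵢ[ℝ] W.1 := ((stdOrthonormalBasis ℝ V.1).reindex (finCongr hV)).equiv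
    ((stdOrthonormalBasis ℝ W.1).reindex (finCongr hW)) (Equiv.refl _)
  let L : E n →ₗᵢ[ℝ] E n := (W.1.subtypeₗᵢ.comp e.toLinearIsometry).extend
  let g : E n ≃ₗᵢ[ℝ] E n := L.toLinearIsometryEquiv rfl
  have hg : ∀ v : V.1, g v = e v := fun v => LinearIsometry.extend_apply _ v
  refine ⟨Unitary.linearIsometryEquiv.symm g, Subtype.ext ?_⟩
  simp only [rotate, MulEquiv.apply_symm_apply]
  refine le_antisymm ?_ fun w hw => ?_
  · rintro _ ⟨v, hv, rfl⟩
    have := hg ⟨v, hv⟩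
    change g v ∈ W.1
    rw [this]
    exact (e ⟨v, hv⟩).2
  · refine ⟨e.symm ⟨w, hw⟩, (e.symm ⟨w, hw⟩).2, ?_⟩
    change g _ = w
    rw [hg, LinearIsometryEquiv.apply_symm_apply]

/-- Transitivity reduces V to a rotated coordinate plane. The resulting right translation changes
Haar measure at most by a constant factor, which is harmless for null sets. -/
theorem haarO_rotate_null {hm : m ≤ n} {S : Set (Grass n m)} (hS : MeasurableSet S)
    (h : gammaMeas hm S = 0) (V : Grass n m) : haarO n {g | rotate g V ∈ S} = 0 := by
  obtain ⟨h₀, rfl⟩ := exists_rotate_eq (coordPlane hm) V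
  rw [gammaMeas, Measure.map_apply (continuous_rotate _).measurable hS] at h
  have hinst : (haarO n).IsHaarMeasure := by unfold haarO; infer_instance
  have hmap := Measure.isMulInvariant_eq_smul_of_compactSpace ((haarO n).map (· * h₀)) (haarO n)
  have h1 : {g | rotate g (rotate h₀ (coordPlane hm)) ∈ S} =
      (· * h₀) ⁻¹' ((fun g => rotate g (coordPlane hm)) ⁻¹' S) := by
    ext g; simp [rotate_rotate]
  rw [h1, ← Measure.map_apply (measurable_mul_const h₀) ((continuous_rotate _).measurable hS), hmap,
    Measure.smul_apply, h, smul_zero]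

/-- The rows of a linear map, rotated. -/
noncomputable def rotateRows (g : OrthGroup n) (ω : Tuples n m) : Tuples n m :=
  WithLp.toLp 2 fun i => (g : E n →L[ℝ] E n) (ω i)

theorem map_rotateRows (g : OrthGroup n) : (gaussLaw n m).map (rotateRows g) = gaussLaw n m :=
  ProbabilityTheory.stdGaussian_map (LinearIsometryEquiv.piLpCongrRight 2
    fun _ : Fin m => Unitary.linearIsometryEquiv g)

theorem continuous_rotateRows :
    Continuous fun z : OrthGroup n × Tuples n m => rotateRows z.1 z.2 := by
  refine (PiLp.continuous_toLp 2 _).comp (continuous_pi fun i => ?_)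
  have h1 : Continuous fun z : OrthGroup n × Tuples n m => (z.1 : E n →L[ℝ] E n) :=
    continuous_subtype_val.comp continuous_fst
  exact h1.clm_apply (by fun_prop)

theorem lin_rotateRows_apply (g : OrthGroup n) (ω : Tuples n m) (x : E n) :
    lin (rotateRows g ω) (Unitary.linearIsometryEquiv g x) = lin ω x := by
  ext i
  rw [lin_apply, lin_apply]
  exact (Unitary.linearIsometryEquiv g).inner_map_map (ω i) x

/-- The orthogonal complement of the kernel of a linear map. -/
noncomputable def coker (ω : Tuples n m) : Submodule ℝ (E n) :=
  (LinearMap.ker (lin ω : E n →ₗ[ℝ] E m))ᗮ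

theorem coker_rotateRows (g : OrthGroup n) (ω : Tuples n m) :
    coker (rotateRows g ω) = (coker ω).map
      ((Unitary.linearIsometryEquiv g).toLinearEquiv : E n →ₗ[ℝ] E n) := by
  set e := Unitary.linearIsometryEquiv g
  have h1 : LinearMap.ker (lin (rotateRows g ω) : E n →ₗ[ℝ] E m) =
      (LinearMap.ker (lin ω : E n →ₗ[ℝ] E m)).map (e.toLinearEquiv : E n →ₗ[ℝ] E n) := by
    ext x
    constructor
    · intro hx
      refine ⟨e.symm x, ?_, e.apply_symm_apply x⟩
      have := lin_rotateRows_apply g ω (e.symm x)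
      rw [e.apply_symm_apply] at this
      exact this.symm.trans hx
    · rintro ⟨y, hy, rfl⟩
      exact (lin_rotateRows_apply g ω y).trans hy
  rw [coker, h1, coker]
  exact (Submodule.map_orthogonal_equiv _ e).symm

theorem finrank_coker_iff (ω : Tuples n m) :
    Module.finrank ℝ (coker ω) = m ↔ Function.Surjective (lin ω) := by
  have h1 := Submodule.finrank_add_finrank_orthogonal (LinearMap.ker (lin ω : E n →ₗ[ℝ] E m))
  have h2 := LinearMap.finrank_range_add_finrank_ker (lin ω : E n →ₗ[ℝ] E m)
  have h3 : Module.finrank ℝ (coker ω) =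
      Module.finrank ℝ (LinearMap.range (lin ω : E n →ₗ[ℝ] E m)) := by
    rw [coker]; omega
  have h4 : Function.Surjective (lin ω) ↔ LinearMap.range (lin ω : E n →ₗ[ℝ] E m) = ⊤ :=
    LinearMap.range_eq_top.symm
  rw [h3, h4]
  constructor
  · intro h
    exact Submodule.eq_top_of_finrank_eq (by simpa using h)
  · intro h
    rw [h]; simp

/-- The map `L ↦ L L*`. -/
noncomputable def gram (ω : Tuples n m) : E m →L[ℝ] E m :=
  (lin ω).comp (ContinuousLinearMap.adjoint (lin ω))

theorem isUnit_gram_iff (ω : Tuples n m) : IsUnit (gram ω) ↔ Function.Surjective (lin ω) := by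
  rw [ContinuousLinearMap.isUnit_iff_bijective]
  constructor
  · exact fun h => Function.Surjective.of_comp h.2
  · intro h
    have hinj : Function.Injective (gram ω) := by
      refine (injective_iff_map_eq_zero _).2 fun y hy => ?_
      have h1 : ContinuousLinearMap.adjoint (lin ω) y = 0 := by
        rw [← inner_self_eq_zero (𝕜 := ℝ), ContinuousLinearMap.adjoint_inner_left]
        change inner ℝ y (gram ω y) = 0
        rw [hy, inner_zero_right]
      obtain ⟨x, rfl⟩ := h y
      rw [← inner_self_eq_zero (𝕜 := ℝ), ← ContinuousLinearMap.adjoint_inner_left, h1,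
        inner_zero_left]
    exact ⟨hinj, (LinearMap.injective_iff_surjective (f := (gram ω : E m →ₗ[ℝ] E m))).1 hinj⟩

theorem continuous_lin : Continuous (lin : Tuples n m → E n →L[ℝ] E m) :=
  continuous_clm_apply.2 fun _ => continuous_lin_apply.comp (continuous_id.prodMk continuous_const)

theorem continuous_gram : Continuous (gram : Tuples n m → E m →L[ℝ] E m) :=
  continuous_lin.clm_comp ((ContinuousLinearMap.adjoint (𝕜 := ℝ) (E := E n)
    (F := E m)).continuous.comp continuous_lin)

/-- The formula P = L*(LL*)⁻¹L shows that the plane depends continuously on L on the open set of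
surjective maps. -/
theorem starProjection_coker {ω : Tuples n m} (h : Function.Surjective (lin ω)) :
    (coker ω).starProjection = (ContinuousLinearMap.adjoint (lin ω)).comp
      ((Ring.inverse (gram ω)).comp (lin ω)) := by
  ext1 x
  refine Submodule.eq_starProjection_of_mem_orthogonal ?_ ?_
  · refine (Submodule.mem_orthogonal _ _).2 fun k hk => ?_
    rw [ContinuousLinearMap.comp_apply, ContinuousLinearMap.adjoint_inner_right,
      show lin ω k = 0 from hk, inner_zero_left]
  · rw [coker, Submodule.orthogonal_orthogonal]
    change lin ω (x - _) = 0
    have h1 := Ring.mul_inverse_cancel (gram ω) ((isUnit_gram_iff ω).2 h)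
    have h2 := congrArg (fun T : E m →L[ℝ] E m => T (lin ω x)) h1
    rw [map_sub, sub_eq_zero]
    exact h2.symm

/-- The Borel structure of the Grassmannian is pulled back through the projections, so the set is
the preimage of a Borel set of operators under a map continuous on an open set. -/
theorem measurableSet_setOf_coker_mem {S : Set (Grass n m)} (hS : MeasurableSet S) :
    MeasurableSet {ω : Tuples n m | ∃ V ∈ S, V.1 = coker ω} := by
  have h0 : measurableSpace_grass n m = MeasurableSpace.comap
      (fun V : Grass n m => V.1.starProjection) (borel (E n →L[ℝ] E n)) := borel_comap
  have hS' : MeasurableSet[MeasurableSpace.comap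
      (fun V : Grass n m => V.1.starProjection) (borel (E n →L[ℝ] E n))] S := h0 ▸ hS
  obtain ⟨T, hT, rfl⟩ := hS'
  rw [← BorelSpace.measurable_eq (α := E n →L[ℝ] E n)] at hT
  set G : Set (Tuples n m) := {ω | IsUnit (gram ω)} with hG
  have hGo : IsOpen G := Units.isOpen.preimage continuous_gram
  let φ : Tuples n m → E n →L[ℝ] E n := fun ω => (ContinuousLinearMap.adjoint (lin ω)).comp
      ((Ring.inverse (gram ω)).comp (lin ω))
  have hφ : ContinuousOn φ G := by
    have h1 : ContinuousOn (fun ω : Tuples n m => Ring.inverse (gram ω)) G := by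
      rintro ω ⟨u, hu⟩
      have h2 := NormedRing.inverse_continuousAt u
      rw [hu] at h2
      exact (h2.comp continuous_gram.continuousAt).continuousWithinAt
    exact ((ContinuousLinearMap.adjoint (𝕜 := ℝ) (E := E n)
      (F := E m)).continuous.comp continuous_lin).continuousOn.clm_comp
        (h1.clm_comp continuous_lin.continuousOn)
  have h3 : {ω : Tuples n m | ∃ V ∈ (fun V : Grass n m => V.1.starProjection) ⁻¹' T,
      V.1 = coker ω} = Subtype.val '' (G.domRestrict φ ⁻¹' T) := by
    ext ω
    constructor
    · rintro ⟨V, hV, hVω⟩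
      have hs : Function.Surjective (lin ω) := (finrank_coker_iff ω).1 (hVω ▸ V.2)
      refine ⟨⟨ω, (isUnit_gram_iff ω).2 hs⟩, ?_, rfl⟩
      change φ ω ∈ T
      have h4 : V.1.starProjection ∈ T := hV
      rwa [hVω, starProjection_coker hs] at h4
    · rintro ⟨⟨ω', hω'⟩, hT', rfl⟩
      have hs : Function.Surjective (lin ω') := (isUnit_gram_iff ω').1 hω'
      refine ⟨⟨coker ω', (finrank_coker_iff ω').2 hs⟩, ?_, rfl⟩
      change (coker ω').starProjection ∈ T
      rw [starProjection_coker hs]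
      exact hT'
  rw [h3]
  exact MeasurableSet.subtype_image hGo.measurableSet
    ((continuousOn_iff_continuous_domRestrict.1 hφ).measurable hT)

/-- A null set of planes is almost surely not hit by the orthogonal complement of the kernel of
the Gaussian random linear map. -/
theorem ae_notMem_of_gammaMeas_eq_zero {hm : m ≤ n} {S : Set (Grass n m)}
    (h : gammaMeas hm S = 0) :
    ∀ᵐ ω ∂(gaussLaw n m), ∀ V : Grass n m, V.1 = coker ω → V ∉ S := by
  -- The set of planes need not be measurable; a measurable null hull is needed for Fubini.
  set S' := toMeasurable (gammaMeas hm) S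
  have hS' : MeasurableSet S' := measurableSet_toMeasurable _ _
  have hS'0 : gammaMeas hm S' = 0 := by rw [measure_toMeasurable, h]
  set B : Set (Tuples n m) := {ω | ∃ V ∈ S', V.1 = coker ω} with hBdef
  have hB : MeasurableSet B := measurableSet_setOf_coker_mem hS'
  suffices hB0 : gaussLaw n m B = 0 by
    refine (measure_eq_zero_iff_ae_notMem.1 hB0).mono fun ω hω V hV hVS => hω ⟨V, ?_, hV⟩
    exact subset_toMeasurable _ _ hVS
  have hP : MeasurableSet {z : OrthGroup n × Tuples n m | rotateRows z.1 z.2 ∈ B} :=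
    continuous_rotateRows.measurable hB
  -- An extra independent rotation does not change the law of ω. With ω fixed, the rotated plane is
  -- Haar distributed, so exchanging the integrals gives measure 0.
  have h1 : ((haarO n).prod (gaussLaw n m)) {z | rotateRows z.1 z.2 ∈ B} = gaussLaw n m B := by
    rw [Measure.prod_apply hP]
    have h2 : ∀ g : OrthGroup n, gaussLaw n m (Prod.mk g ⁻¹' {z | rotateRows z.1 z.2 ∈ B}) =
        gaussLaw n m B := fun g => by
      have hg : Measurable (rotateRows g : Tuples n m → Tuples n m) :=
        (continuous_rotateRows.comp (Continuous.prodMk_right g)).measurable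
      conv_rhs => rw [← map_rotateRows g, Measure.map_apply hg hB]
      rfl
    rw [lintegral_congr h2, lintegral_const, measure_univ, mul_one]
  rw [← h1, Measure.prod_apply_symm hP]
  refine (lintegral_congr fun ω => ?_).trans lintegral_zero
  by_cases hs : Function.Surjective (lin ω)
  · let V : Grass n m := ⟨coker ω, (finrank_coker_iff ω).2 hs⟩
    refine measure_mono_null ?_ (haarO_rotate_null hS' hS'0 V)
    rintro g ⟨W, hW, hWω⟩
    have : rotate g V = W := Subtype.ext (by rw [hWω, coker_rotateRows]; rfl)
    change rotate g V ∈ S'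
    rwa [this]
  · refine measure_mono_null (t := ∅) ?_ measure_empty
    rintro g ⟨W, hW, hWω⟩
    refine hs ((finrank_coker_iff ω).1 ?_)
    have h3 : Module.finrank ℝ (coker (rotateRows g ω)) = m := hWω ▸ W.2
    rwa [coker_rotateRows, LinearEquiv.finrank_map_eq] at h3

/-- A linear map is an isomorphism on the orthogonal complement of its kernel, which takes the
projections of sets to their images. -/
theorem exists_equiv_image_proj {ω : Tuples n m} (V : Grass n m) (hV : V.1 = coker ω) :
    ∃ e : V.1 ≃L[ℝ] E m, ∀ A : Set (E n), e '' proj V A = lin ω '' A := by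
  have hs : Function.Surjective (lin ω) := (finrank_coker_iff ω).1 (hV ▸ V.2)
  have hproj : ∀ x : E n, lin ω (V.1.orthogonalProjectionOnto x : E n) = lin ω x := fun x => by
    have h1 : x - (V.1.orthogonalProjectionOnto x : E n) ∈ V.1ᗮ :=
      Submodule.sub_starProjection_mem_orthogonal x
    have h2 : x - (V.1.orthogonalProjectionOnto x : E n) ∈
        LinearMap.ker (lin ω : E n →ₗ[ℝ] E m) := by
      have h4 : V.1ᗮ = LinearMap.ker (lin ω : E n →ₗ[ℝ] E m) := by
        rw [hV, coker, Submodule.orthogonal_orthogonal]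
      rwa [h4] at h1
    have h3 : lin ω (x - (V.1.orthogonalProjectionOnto x : E n)) = 0 := h2
    rw [map_sub, sub_eq_zero] at h3
    exact h3.symm
  let f : V.1 →ₗ[ℝ] E m := (lin ω : E n →ₗ[ℝ] E m) ∘ₗ V.1.subtype
  have hf : Function.Surjective f := fun y => by
    obtain ⟨x, rfl⟩ := hs y
    exact ⟨V.1.orthogonalProjectionOnto x, hproj x⟩
  have hrank : Module.finrank ℝ V.1 = Module.finrank ℝ (E m) := by
    rw [finrank_euclideanSpace_fin]; exact V.2
  let e : V.1 ≃ₗ[ℝ] E m := LinearEquiv.ofBijective f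
    ⟨(LinearMap.injective_iff_surjective_of_finrank_eq_finrank hrank).2 hf, hf⟩
  refine ⟨e.toContinuousLinearEquiv, fun A => ?_⟩
  rw [proj, Set.image_image]
  refine Set.image_congr fun x _ => hproj x

end Grassmannian

/-! ### Intersections of projections -/

section Intersections

variable {n m : ℕ}

/-- Large distances contribute at most the total mass, and at distances below 1 the kernel increases
with the exponent. -/
theorem energy_ne_top_of_le {X : Type*} [PseudoEMetricSpace X] [MeasurableSpace X] {p s : ℝ}
    (hp : 0 ≤ p) (hps : p ≤ s) {μ : Measure X} [IsFiniteMeasure μ] (h : energy s μ ≠ ∞) :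
    energy p μ ≠ ∞ := by
  have h1 : ∀ x y : X, edist x y ^ (-p) ≤ 1 + edist x y ^ (-s) := fun x y => by
    rcases le_total (edist x y) 1 with h | h
    · refine le_add_left ?_
      rw [ENNReal.rpow_neg, ENNReal.rpow_neg]
      exact ENNReal.inv_le_inv.2 (ENNReal.rpow_le_rpow_of_exponent_ge h hps)
    · refine le_add_right ?_
      rw [ENNReal.rpow_neg, ENNReal.inv_le_one]
      simpa using ENNReal.rpow_le_rpow h hp
  have h2 : energy p μ ≤ ∫⁻ _x, μ Set.univ ∂μ + energy s μ := by
    calc energy p μ ≤ ∫⁻ x, (μ Set.univ + ∫⁻ y, edist x y ^ (-s) ∂μ) ∂μ := by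
          refine lintegral_mono fun x => (lintegral_mono (h1 x)).trans_eq ?_
          rw [lintegral_add_left measurable_const, lintegral_one]
      _ = _ := lintegral_add_left measurable_const _
  refine ne_top_of_le_ne_top (ENNReal.add_ne_top.2 ⟨?_, h⟩) h2
  rw [lintegral_const]
  finiteness

/-- Almost sure surjectivity: otherwise the image of μ would sit on a proper subspace, against its
absolute continuity. -/
theorem ae_exists_plane [NeZero m] {μ : Measure (E n)} [IsProbabilityMeasure μ]
    (hμ : energy m μ ≠ ∞) : ∀ᵐ ω ∂(gaussLaw n m), ∃ V : Grass n m, V.1 = coker ω := by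
  have hm : (0 : ℝ) < m := by exact_mod_cast NeZero.pos m
  filter_upwards [ae_fourierEnergy_lin_ne_top hm hμ] with ω hω
  have hprob : IsProbabilityMeasure (μ.map (lin ω)) :=
    Measure.isProbabilityMeasure_map (lin ω).continuous.aemeasurable
  have hac : μ.map (lin ω) ≪ volume :=
    absolutelyContinuous_of_fourierEnergy (by rwa [finrank_euclideanSpace_fin])
  suffices hs : Function.Surjective (lin ω) from
    ⟨⟨coker ω, (finrank_coker_iff ω).2 hs⟩, rfl⟩
  by_contra hcon
  have h1 : LinearMap.range (lin ω : E n →ₗ[ℝ] E m) ≠ ⊤ := fun h => hcon (LinearMap.range_eq_top.1 h)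
  have h2 := hac (Measure.addHaar_submodule volume _ h1)
  rw [Measure.map_apply (lin ω).continuous.measurable
    (Submodule.closed_of_finiteDimensional _).measurableSet] at h2
  have h3 : lin ω ⁻¹' (LinearMap.range (lin ω : E n →ₗ[ℝ] E m) : Set (E m)) = Set.univ :=
    Set.eq_univ_of_forall fun x => ⟨x, rfl⟩
  rw [h3, measure_univ] at h2
  exact one_ne_zero h2

/-- A set of planes has positive measure if, for almost every Gaussian random map whose plane
does not belong to it, the mutual Gaussian energies of the images of `μ` and `ν` vanish. -/
theorem gammaMeas_pos [NeZero m] {hm : m ≤ n} {μ ν : Measure (E n)} [IsProbabilityMeasure μ]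
    [IsProbabilityMeasure ν] {K K' : Set (E n)} (hK : IsCompact K) (hμK : μ Kᶜ = 0)
    (hK' : IsCompact K') (hνK : ν K'ᶜ = 0) {s t : ℝ} (hs : m ≤ s) (ht : 0 < t)
    (hst : s + t = 2 * m) (hμ : energy s μ ≠ ∞) (hν : energy t ν ≠ ∞) {S : Set (Grass n m)}
    (h : ∀ᵐ ω ∂(gaussLaw n m), ∀ V : Grass n m, V.1 = coker ω → V ∉ S → Filter.Tendsto
      (fun k => gaussEnergy (scale k) (μ.map (lin ω)) (ν.map (lin ω))) Filter.atTop (𝓝 0)) :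
    0 < gammaMeas hm S := by
  have hm0 : (0 : ℝ) < m := by exact_mod_cast NeZero.pos m
  refine pos_iff_ne_zero.2 fun h0 => not_ae_tendsto_gaussEnergy_lin (m := m) hK hμK hK' hνK
    (hm0.trans_le hs) ht hst hμ hν ?_
  filter_upwards [h, ae_notMem_of_gammaMeas_eq_zero h0,
    ae_exists_plane (energy_ne_top_of_le hm0.le hs hμ)] with ω hω hω' ⟨V, hV⟩
  exact hω V hV (hω' V hV)

theorem map_lin_compl_image {μ : Measure (E n)} {K : Set (E n)} (hK : IsCompact K)
    (hμK : μ Kᶜ = 0) (ω : Tuples n m) : μ.map (lin ω) (lin ω '' K)ᶜ = 0 := by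
  rw [Measure.map_apply (lin ω).continuous.measurable
    (hK.image (lin ω).continuous).measurableSet.compl]
  exact measure_mono_null (fun x hx hxK => hx ⟨x, hxK, rfl⟩) hμK

theorem nonempty_of_measure_compl {μ : Measure (E n)} [IsProbabilityMeasure μ] {K : Set (E n)}
    (hμK : μ Kᶜ = 0) : K.Nonempty := by
  rw [Set.nonempty_iff_ne_empty]
  rintro rfl
  simp at hμK

theorem measure_eq_zero_of_inter {X : Type*} [MeasurableSpace X] {ν : Measure X} {C D : Set X}
    (hD : ν Dᶜ = 0) (h : ν (C ∩ D) = 0) : ν C = 0 :=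
  measure_mono_null (fun x hx => by
    by_cases hxD : x ∈ D
    · exact Or.inl ⟨hx, hxD⟩
    · exact Or.inr hxD) (measure_union_null h hD)

theorem image_inter_proj {V : Grass n m} {ω : Tuples n m} {e : V.1 ≃L[ℝ] E m}
    (he : ∀ A : Set (E n), e '' proj V A = lin ω '' A) (A B : Set (E n)) :
    e '' (proj V A ∩ proj V B) = lin ω '' A ∩ lin ω '' B := by
  rw [Set.image_inter e.injective, he, he]

theorem volume_image_inter_eq_zero {V : Grass n m} {ω : Tuples n m} (hV : V.1 = coker ω)
    {A B : Set (E n)} (h : μH[(m : ℝ)] (proj V A ∩ proj V B) = 0) :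
    volume (lin ω '' A ∩ lin ω '' B) = 0 := by
  obtain ⟨e, he⟩ := exists_equiv_image_proj V hV
  have h1 := e.lipschitz.hausdorffMeasure_image_le (Nat.cast_nonneg m) (proj V A ∩ proj V B)
  rw [h, mul_zero, image_inter_proj he] at h1
  have h2 : (μH[(m : ℝ)] : Measure (E m)).IsAddHaarMeasure := by
    have := isAddHaarMeasure_hausdorffMeasure (E := E m)
    rwa [finrank_euclideanSpace_fin] at this
  exact Measure.absolutelyContinuous_isAddHaarMeasure volume (μH[(m : ℝ)] : Measure (E m))
    (nonpos_iff_eq_zero.1 h1)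

/-- Sets of dimension greater than `m`. -/
theorem gammaMeas_hausdorffMeasure_pos [NeZero m] (hm : m ≤ n) {A B : Set (E n)}
    (hA : MeasurableSet A) (hB : MeasurableSet B) (hAd : (m : ℝ≥0∞) < dimH A)
    (hBd : (m : ℝ≥0∞) < dimH B) :
    0 < gammaMeas hm {V | 0 < μH[(m : ℝ)] (proj V A ∩ proj V B)} := by
  have hm0 : (0 : ℝ) < m := by exact_mod_cast NeZero.pos m
  have h2m : (m : ℝ≥0∞) < ENNReal.ofReal (2 * m) := by
    rw [← ENNReal.ofReal_natCast, ENNReal.ofReal_lt_ofReal_iff (by linarith)]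
    linarith
  -- With m < s < min(dim A, 2m) the complementary exponent 2m - s lies in (0, m), so the m-energy
  -- of ν, also responsible for absolute continuity, controls it.
  obtain ⟨s', hs1, hs2⟩ := ENNReal.lt_iff_exists_nnreal_btwn.1 (lt_min hAd h2m)
  obtain ⟨s, rfl⟩ : ∃ s : ℝ, s.toNNReal = s' := ⟨s', by simp⟩
  have hms : (m : ℝ) < s := by
    rw [← ENNReal.ofReal_natCast] at hs1
    exact (ENNReal.ofReal_lt_ofReal_iff_of_nonneg hm0.le).1 hs1
  have hs2m : s < 2 * m :=
    (ENNReal.ofReal_lt_ofReal_iff (by linarith)).1 (hs2.trans_le (min_le_right _ _))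
  obtain ⟨K, hKA, hK, μ, hμp, hμK, hμ⟩ := exists_measure_energy_ne_top (hm0.trans hms) hA
    (hs2.trans_le (min_le_left _ _))
  obtain ⟨K', hKB, hK', ν, hνp, hνK, hν⟩ := exists_measure_energy_ne_top hm0 hB
    (by rwa [ENNReal.ofReal_natCast])
  have ht0 : 0 < 2 * (m : ℝ) - s := by linarith
  have htm : 2 * (m : ℝ) - s < m := by linarith
  have hνt := energy_ne_top_of_le ht0.le htm.le hν
  refine gammaMeas_pos hK hμK hK' hνK hms.le ht0 (by ring) hμ hνt ?_
  filter_upwards [ae_fourierEnergy_lin_ne_top (hm0.trans hms) hμ, ae_fourierEnergy_lin_ne_top hm0 hν,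
    ae_fourierEnergy_lin_ne_top ht0 hνt] with ω h1 h2 h3 V hV hVS
  have hprob1 : IsProbabilityMeasure (μ.map (lin ω)) :=
    Measure.isProbabilityMeasure_map (lin ω).continuous.aemeasurable
  have hprob2 : IsProbabilityMeasure (ν.map (lin ω)) :=
    Measure.isProbabilityMeasure_map (lin ω).continuous.aemeasurable
  have hfr : (Module.finrank ℝ (E m) : ℝ) = m := by rw [finrank_euclideanSpace_fin]
  have h0 : volume (lin ω '' K ∩ lin ω '' K') = 0 :=
    measure_mono_null (Set.inter_subset_inter (Set.image_mono hKA) (Set.image_mono hKB))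
      (volume_image_inter_eq_zero hV (by simpa using hVS))
  have hac : ν.map (lin ω) ≪ volume :=
    absolutelyContinuous_of_fourierEnergy (by rwa [hfr])
  obtain ⟨C, hC0, -, hC⟩ := exists_fourierEnergy_eq (F := E m) ht0 (by rwa [hfr])
  rw [hC] at h3
  exact tendsto_gaussEnergy_of_energy (s := s) (t := 2 * m - s) (by rw [hfr]; ring) ht0
    (by rwa [hfr]) h1 (fun htop => h3 (by rw [htop, ENNReal.mul_top hC0]))
    (hK.image (lin ω).continuous) ((nonempty_of_measure_compl hμK).image _)
    (map_lin_compl_image hK hμK ω)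
    (measure_eq_zero_of_inter (map_lin_compl_image hK' hνK ω) (hac h0))

/-- Sets of dimension greater than `2 m`. -/
theorem gammaMeas_interior_pos [NeZero m] (hm : m ≤ n) {A B : Set (E n)}
    (hA : MeasurableSet A) (hB : MeasurableSet B) (hAd : (2 * m : ℝ≥0∞) < dimH A)
    (hBd : (2 * m : ℝ≥0∞) < dimH B) :
    0 < gammaMeas hm {V | (interior (proj V A ∩ proj V B)).Nonempty} := by
  have hm0 : (0 : ℝ) < m := by exact_mod_cast NeZero.pos m
  have h2m : (2 * m : ℝ≥0∞) = ENNReal.ofReal (2 * m) := by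
    rw [ENNReal.ofReal_mul zero_le_two, ENNReal.ofReal_natCast, ENNReal.ofReal_ofNat]
  obtain ⟨p', hp1, hp2⟩ := ENNReal.lt_iff_exists_nnreal_btwn.1 (lt_min hAd hBd)
  obtain ⟨p, rfl⟩ : ∃ p : ℝ, p.toNNReal = p' := ⟨p', by simp⟩
  have hmp : 2 * (m : ℝ) < p := by
    rw [h2m] at hp1
    exact (ENNReal.ofReal_lt_ofReal_iff_of_nonneg (by linarith)).1 hp1
  have hp0 : 0 < p := by linarith
  obtain ⟨K, hKA, hK, μ, hμp, hμK, hμ⟩ := exists_measure_energy_ne_top hp0 hA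
    (hp2.trans_le (min_le_left _ _))
  obtain ⟨K', hKB, hK', ν, hνp, hνK, hν⟩ := exists_measure_energy_ne_top hp0 hB
    (hp2.trans_le (min_le_right _ _))
  have hμm := energy_ne_top_of_le hm0.le (by linarith : (m : ℝ) ≤ p) hμ
  have hνm := energy_ne_top_of_le hm0.le (by linarith : (m : ℝ) ≤ p) hν
  -- The exponents s = t = m suffice for the lower bound; the energy of exponent p > 2m serves only
  -- to make the Fourier transforms of the images integrable.
  refine gammaMeas_pos hK hμK hK' hνK le_rfl hm0 (by ring) hμm hνm ?_
  filter_upwards [ae_fourierEnergy_lin_ne_top hp0 hμ, ae_fourierEnergy_lin_ne_top hp0 hν,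
    ae_fourierEnergy_lin_ne_top hm0 hμm, ae_fourierEnergy_lin_ne_top hm0 hνm]
    with ω h1 h2 h3 h4 V hV hVS
  have hprob1 : IsProbabilityMeasure (μ.map (lin ω)) :=
    Measure.isProbabilityMeasure_map (lin ω).continuous.aemeasurable
  have hprob2 : IsProbabilityMeasure (ν.map (lin ω)) :=
    Measure.isProbabilityMeasure_map (lin ω).continuous.aemeasurable
  have hfr : (Module.finrank ℝ (E m) : ℝ) = m := by rw [finrank_euclideanSpace_fin]
  obtain ⟨e, he⟩ := exists_equiv_image_proj V hV
  have hint : interior (lin ω '' K ∩ lin ω '' K') = ∅ := by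
    have h5 : interior (lin ω '' A ∩ lin ω '' B) = ∅ := by
      have h6 : interior (proj V A ∩ proj V B) = ∅ := Set.not_nonempty_iff_eq_empty.1 hVS
      rw [← image_inter_proj he, ← e.coe_toHomeomorph, ← e.toHomeomorph.image_interior, h6,
        Set.image_empty]
    exact Set.subset_empty_iff.1 ((interior_mono (Set.inter_subset_inter (Set.image_mono hKA)
      (Set.image_mono hKB))).trans h5.subset)
  exact tendsto_gaussEnergy_of_integrable_charFun
    (integrable_charFun_of_fourierEnergy (by rwa [hfr]) (by rwa [hfr]) h1)
    (integrable_charFun_of_fourierEnergy (by rwa [hfr]) (by rwa [hfr]) h2)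
    (hK.image (lin ω).continuous) ((nonempty_of_measure_compl hμK).image _)
    (map_lin_compl_image hK hμK ω)
    (hK'.image (lin ω).continuous) ((nonempty_of_measure_compl hνK).image _)
    (map_lin_compl_image hK' hνK ω) hint

/-- Sets of dimensions `dim A > m ≥ dim B` with `dim A + dim B > 2 m`. -/
theorem gammaMeas_dimH_pos [NeZero m] (hm : m ≤ n) {A B : Set (E n)}
    (hA : MeasurableSet A) (hB : MeasurableSet B)
    (hBd : dimH B ≤ (m : ℝ≥0∞)) (hAB : (2 * m : ℝ≥0∞) < dimH A + dimH B) {ε : ℝ} (hε : 0 < ε) :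
    0 < gammaMeas hm {V | dimH B < dimH (proj V A ∩ proj V B) + ENNReal.ofReal ε} := by
  have hm0 : (0 : ℝ) < m := by exact_mod_cast NeZero.pos m
  obtain ⟨a, ha0, ha⟩ : ∃ a : ℝ, 0 ≤ a ∧ dimH A = ENNReal.ofReal a :=
    ⟨(dimH A).toReal, ENNReal.toReal_nonneg, (ENNReal.ofReal_toReal (Real.dimH_ne_top A)).symm⟩
  obtain ⟨b, hb0, hb⟩ : ∃ b : ℝ, 0 ≤ b ∧ dimH B = ENNReal.ofReal b :=
    ⟨(dimH B).toReal, ENNReal.toReal_nonneg, (ENNReal.ofReal_toReal (Real.dimH_ne_top B)).symm⟩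
  have hbm : b ≤ m := by
    rw [hb, ← ENNReal.ofReal_natCast] at hBd
    exact (ENNReal.ofReal_le_ofReal_iff hm0.le).1 hBd
  have hab : 2 * (m : ℝ) < a + b := by
    rw [ha, hb, ← ENNReal.ofReal_add ha0 hb0, ← ENNReal.ofReal_natCast, ← ENNReal.ofReal_ofNat,
      ← ENNReal.ofReal_mul zero_le_two] at hAB
    exact (ENNReal.ofReal_lt_ofReal_iff_of_nonneg (by positivity)).1 hAB
  rcases hb0.eq_or_lt with rfl | hbpos
  · have : {V : Grass n m | dimH B < dimH (proj V A ∩ proj V B) + ENNReal.ofReal ε} = Set.univ := by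
      refine Set.eq_univ_of_forall fun V => ?_
      change dimH B < _
      rw [hb, ENNReal.ofReal_zero]
      exact lt_of_lt_of_le (ENNReal.ofReal_pos.2 hε) le_add_self
    rw [this, measure_univ]
    exact one_pos
  -- The three lower bounds give t > b - ε for the conclusion, t > 0 for the kernel, and 2m - t < a
  -- for the energy on A; t < b gives the energy on B and, as b ≤ m, also 2m - t ≥ m.
  obtain ⟨t, ht1, ht2⟩ : ∃ t, max (max (b - ε) 0) (2 * m - a) < t ∧ t < b :=
    exists_between (max_lt (max_lt (by linarith) hbpos) (by linarith))
  rw [max_lt_iff, max_lt_iff] at ht1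
  obtain ⟨⟨htε, ht0⟩, hta⟩ := ht1
  have hs0 : 0 < 2 * (m : ℝ) - t := by linarith
  obtain ⟨K, hKA, hK, μ, hμp, hμK, hμ⟩ := exists_measure_energy_ne_top hs0 hA
    (by rw [ha, ENNReal.ofReal_lt_ofReal_iff_of_nonneg hs0.le]; linarith)
  obtain ⟨K', hKB, hK', ν, hνp, hνK, hν⟩ := exists_measure_energy_ne_top ht0 hB
    (by rwa [hb, ENNReal.ofReal_lt_ofReal_iff_of_nonneg ht0.le])
  refine gammaMeas_pos hK hμK hK' hνK (by linarith) ht0 (by ring) hμ hν ?_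
  filter_upwards [ae_fourierEnergy_lin_ne_top hs0 hμ, ae_fourierEnergy_lin_ne_top ht0 hν]
    with ω h1 h2 V hV hVS
  have hprob1 : IsProbabilityMeasure (μ.map (lin ω)) :=
    Measure.isProbabilityMeasure_map (lin ω).continuous.aemeasurable
  have hprob2 : IsProbabilityMeasure (ν.map (lin ω)) :=
    Measure.isProbabilityMeasure_map (lin ω).continuous.aemeasurable
  have hfr : (Module.finrank ℝ (E m) : ℝ) = m := by rw [finrank_euclideanSpace_fin]
  obtain ⟨C, hC0, -, hC⟩ := exists_fourierEnergy_eq (F := E m) ht0 (by rw [hfr]; linarith)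
  rw [hC] at h2
  have hen : energy t (ν.map (lin ω)) ≠ ∞ := fun htop => h2 (by rw [htop, ENNReal.mul_top hC0])
  have hKc := hK.image (lin ω).continuous
  have hKc' := hK'.image (lin ω).continuous
  -- If the intersection had positive mass, its dimension would be at least t > b - ε, and the plane
  -- would belong to the set.
  have hnull : ν.map (lin ω) (lin ω '' K ∩ lin ω '' K') = 0 := by
    by_contra hne
    have hdim := le_dimH_of_energy ht0 hen (hKc.measurableSet.inter hKc'.measurableSet) hne
    obtain ⟨e, he⟩ := exists_equiv_image_proj V hV
    have hdim2 : ENNReal.ofReal t ≤ dimH (proj V A ∩ proj V B) := by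
      rw [← e.dimH_image, image_inter_proj he]
      exact hdim.trans (dimH_mono (Set.inter_subset_inter (Set.image_mono hKA)
        (Set.image_mono hKB)))
    refine hVS (lt_of_lt_of_le ?_ (add_le_add hdim2 le_rfl))
    rw [hb, ← ENNReal.ofReal_add ht0.le hε.le, ENNReal.ofReal_lt_ofReal_iff (by linarith)]
    linarith
  exact tendsto_gaussEnergy_of_energy (s := 2 * m - t) (t := t) (by rw [hfr]; ring) ht0
    (by rw [hfr]; linarith) h1 hen hKc ((nonempty_of_measure_compl hμK).image _)
    (map_lin_compl_image hK hμK ω)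
    (measure_eq_zero_of_inter (map_lin_compl_image hK' hνK ω) hnull)

theorem proj_inter_proj_eq_univ (V : Grass n 0) {A B : Set (E n)} (hA : A.Nonempty)
    (hB : B.Nonempty) : proj V A ∩ proj V B = Set.univ ∧ (proj V A ∩ proj V B).Nonempty := by
  have : Subsingleton V.1 := Module.finrank_zero_iff.1 V.2
  have hne : (proj V A ∩ proj V B).Nonempty := by
    obtain ⟨x, hx⟩ := hA
    obtain ⟨y, hy⟩ := hB
    exact ⟨0, ⟨x, hx, Subsingleton.elim _ _⟩, ⟨y, hy, Subsingleton.elim _ _⟩⟩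
  exact ⟨hne.eq_univ, hne⟩

theorem nonempty_of_dimH_pos {A : Set (E n)} (h : 0 < dimH A) : A.Nonempty := by
  rw [Set.nonempty_iff_ne_empty]
  rintro rfl
  simp at h

end Intersections

end ProjInter

/-- For m = 0 the planes are points and every plane qualifies, which is checked directly; the
Fourier argument needs a nontrivial target. In (iii) ε is on the right because subtraction in `ℝ≥0∞`
truncates. -/
theorem theorem1p1 (n m : ℕ) (hm : m ≤ n) (A B : Set (EuclideanSpace ℝ (Fin n)))
    (hA : MeasurableSet A) (hB : MeasurableSet B) :
    ((m : ℝ≥0∞) < dimH A → (m : ℝ≥0∞) < dimH B →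
      0 < ProjInter.gammaMeas hm {V | 0 < Measure.hausdorffMeasure (m : ℝ)
        (ProjInter.proj V A ∩ ProjInter.proj V B)}) ∧
    ((2 * m : ℝ≥0∞) < dimH A → (2 * m : ℝ≥0∞) < dimH B →
      0 < ProjInter.gammaMeas hm
        {V | (interior (ProjInter.proj V A ∩ ProjInter.proj V B)).Nonempty}) ∧
    ((m : ℝ≥0∞) < dimH A → dimH B ≤ (m : ℝ≥0∞) → (2 * m : ℝ≥0∞) < dimH A + dimH B →
      ∀ ε : ℝ, 0 < ε → 0 < ProjInter.gammaMeas hm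
        {V | dimH B < dimH (ProjInter.proj V A ∩ ProjInter.proj V B) + ENNReal.ofReal ε}) := by
  rcases Nat.eq_zero_or_pos m with rfl | hpos
  · have huniv : ∀ S : Set (ProjInter.Grass n 0), (∀ V, V ∈ S) → 0 < ProjInter.gammaMeas hm S :=
      fun S hS => by rw [Set.eq_univ_of_forall hS, measure_univ]; exact one_pos
    refine ⟨fun h1 h2 => huniv _ fun V => ?_, fun h1 h2 => huniv _ fun V => ?_,
      fun _ h2 _ ε hε => huniv _ fun V => ?_⟩
    · have h := (ProjInter.proj_inter_proj_eq_univ V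
        (ProjInter.nonempty_of_dimH_pos (by simpa using h1))
        (ProjInter.nonempty_of_dimH_pos (by simpa using h2))).2
      change 0 < Measure.hausdorffMeasure ((0 : ℕ) : ℝ) _
      rw [Nat.cast_zero]
      exact one_pos.trans_le (Measure.one_le_hausdorffMeasure_zero_of_nonempty h)
    · have h := ProjInter.proj_inter_proj_eq_univ V
        (ProjInter.nonempty_of_dimH_pos (by simpa using h1))
        (ProjInter.nonempty_of_dimH_pos (by simpa using h2))
      change (interior _).Nonempty
      rw [h.1, interior_univ]
      exact ⟨0, trivial⟩
    · have h : dimH B = 0 := by simpa using h2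
      change dimH B < _
      rw [h]
      exact lt_of_lt_of_le (ENNReal.ofReal_pos.2 hε) le_add_self
  · have : NeZero m := ⟨hpos.ne'⟩
    exact ⟨ProjInter.gammaMeas_hausdorffMeasure_pos hm hA hB,
      ProjInter.gammaMeas_interior_pos hm hA hB,
      fun _ h2 h3 ε hε => ProjInter.gammaMeas_dimH_pos hm hA hB h2 h3 hε⟩
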